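/- Let $(M,g)$ be a complete (connected, second countable) smooth Riemannian manifold, $\varphi:M\to\mathbb{R}$ smooth, $p>1$, $q>0$, $a\in\mathbb{R}$, and $\delta:=q(p-1)-1>0$. Write $s^q:=|s|^{q-1}s$ for $s\in\mathbb{R}$. Let $L^r_\varphi(M)$ be the Lebesgue space of the measure $e^{-\varphi}dV_g$, let $W^{1,r}_\varphi(M)$ be the space of $f\in L^r_\varphi(M)$ having a weak gradient $\nabla f$ with $|\nabla f|\in L^r_\varphi(M)$, and let $W^{1,r}_{0;\varphi}(M)$ be the closure of $C_c^\infty(M)$ in it. Let $u$ be a (sign-changing) solution on $M\times(a,\infty)$ of $$\partial_t u=\mathcal{L}_{p,\varphi}u^q,\qquad \mathcal{L}_{p,\varphi}v=e^{\varphi}\operatorname{div}\big(e^{-\varphi}|\nabla v|^{p-2}\nabla v\big),$$ such that for each $t>a$ we have $u(\cdot,t),\,u_t(\cdot,t)\in W^{1,q+1}_{0;\varphi}(M)$ and $\nabla u^q(\cdot,t)\in L^p_\varphi(M)$. Here $u_t(\cdot,t)$ is the derivative at $t$ of $t\mapsto u(\cdot,t)$ in $L^{q+1}_\varphi(M)$,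 and the equation is understood weakly at each time: for all $t>a$ and $\psi\in C_c^\infty(M)$, $$\int_M u_t\,\psi\,e^{-\varphi}dV_g=-\int_M|\nabla u^q|^{p-2}\langle\nabla u^q,\nabla\psi\rangle e^{-\varphi}dV_g .$$ Put $I(t)=\int_M|u(\cdot,t)|^{q+1}e^{-\varphi}dV_g$. For $k\in\mathbb{R}$, say that $u$ vanishes to order $k$ at $\infty$ if there is $C>0$ with $I(t)\le C(t-a+1)^{-k}$ for all $t>a$, and to infinite order at $\infty$ if it vanishes to order $k$ for every integer $k>0$. 1. If $u$ is nontrivial (not $u(\cdot,t)=0$ a.e. on $M$ for every $t>a$), then there are constants $c>0$ and $c'\ge0$ (depending on $u$) such that $$I(t)\ge\big(c+c'(t-a)\big)^{-(q+1)/\delta}\qquad\text{for all }t>a,$$ and the vanishing order of $u$ at $\infty$ is at most $(q+1)/\delta$: if $u$ vanishes to order $k\in\mathbb{R}$ at $\infty$, then $k\le(q+1)/\delta$. 2. (Strong unique continuation at infinity.) If $u$ vanishes to infinite order at $\infty$, then $u\equiv0$, i.e. $u(\cdot,t)=0$ a.e. on $M$ for every $t>a$. -/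

import Mathlib

open Bundle Manifold MeasureTheory Set Filter Topology
open scoped ContDiff ENNReal

noncomputable section

namespace DoublyNonlinear

section Geometry

variable {n : ℕ} {M : Type*} [TopologicalSpace M] [ChartedSpace (EuclideanSpace ℝ (Fin n)) M]

/-- The tangent vector of `M` at the point with coordinates `y` in the chart around `x₀` which has
coordinates `w`: the differential at `y` of the inverse of the chart, applied to `w`. -/
def chartVec (x₀ : M) (y w : EuclideanSpace ℝ (Fin n)) :
    TangentSpace (𝓡 n) ((extChartAt (𝓡 n) x₀).symm y) :=
  mfderiv 𝓘(ℝ, EuclideanSpace ℝ (Fin n)) (𝓡 n) (extChartAt (𝓡 n) x₀).symm y w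

variable [RiemannianBundle (fun x : M => TangentSpace (𝓡 n) x)]

/-- The matrix `g_ij` of the Riemannian metric in the chart around `x₀`. -/
def metricMatrix (x₀ : M) (y : EuclideanSpace ℝ (Fin n)) : Matrix (Fin n) (Fin n) ℝ :=
  Matrix.of fun i j =>
    inner ℝ (chartVec x₀ y (EuclideanSpace.single i 1)) (chartVec x₀ y (EuclideanSpace.single j 1))

/-- The measure `√(det g_ij) dy` of the chart around `x₀`, transported to `M`. -/
def chartVolume [MeasurableSpace M] (x₀ : M) : Measure M :=
  ((volume.restrict (extChartAt (𝓡 n) x₀).target).withDensity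
    (fun y => ENNReal.ofReal √(metricMatrix x₀ y).det)).map (extChartAt (𝓡 n) x₀).symm

variable (n M) in
/-- The Riemannian volume measure `dV_g`. The measures `√(det g_ij) dy` of any two charts agree on
the overlap of their domains, so the least measure above all of them is the one obtained by
glueing them. -/
def riemannianVolume [MeasurableSpace M] : Measure M :=
  ⨆ x₀ : M, chartVolume (n := n) x₀

variable (n) in
/-- The weighted measure `e^{-φ} dV_g`. -/
def weightedVolume [MeasurableSpace M] (φ : M → ℝ) : Measure M :=
  (riemannianVolume n M).withDensity (fun x => ENNReal.ofReal (Real.exp (-φ x)))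

variable (n) in
/-- The Riemannian gradient of a (smooth) function: the vector `∇f` with `⟨∇f, w⟩ = df(w)`. -/
def gradient (f : M → ℝ) (x : M) : TangentSpace (𝓡 n) x :=
  haveI : FiniteDimensional ℝ (TangentSpace (𝓡 n) x) :=
    inferInstanceAs (FiniteDimensional ℝ (EuclideanSpace ℝ (Fin n)))
  haveI : CompleteSpace (TangentSpace (𝓡 n) x) := FiniteDimensional.complete ℝ _
  (InnerProductSpace.toDual ℝ (TangentSpace (𝓡 n) x)).symm (mfderiv (𝓡 n) 𝓘(ℝ, ℝ) f x)

variable (n) in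
/-- The test functions `C_c^∞(M)`. -/
def IsTestFunction (ψ : M → ℝ) : Prop :=
  ContMDiff (𝓡 n) 𝓘(ℝ, ℝ) ∞ ψ ∧ HasCompactSupport ψ

/-- `G` is the weak gradient of `f`: in the chart around each point, `f` is locally integrable and
has the locally integrable weak partial derivative `⟨G, ∂_w⟩` in each coordinate direction `w`. -/
def IsWeakGradient (f : M → ℝ) (G : (x : M) → TangentSpace (𝓡 n) x) : Prop :=
  ∀ x₀ : M,
    LocallyIntegrableOn (fun y => f ((extChartAt (𝓡 n) x₀).symm y))
      (extChartAt (𝓡 n) x₀).target volume ∧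
    ∀ w : EuclideanSpace ℝ (Fin n),
      LocallyIntegrableOn
        (fun y => (inner ℝ (G ((extChartAt (𝓡 n) x₀).symm y)) (chartVec x₀ y w) : ℝ))
        (extChartAt (𝓡 n) x₀).target volume ∧
      ∀ η : EuclideanSpace ℝ (Fin n) → ℝ, ContDiff ℝ ∞ η → HasCompactSupport η →
        tsupport η ⊆ (extChartAt (𝓡 n) x₀).target →
        ∫ y in (extChartAt (𝓡 n) x₀).target,
            f ((extChartAt (𝓡 n) x₀).symm y) * fderiv ℝ η y w =
          -∫ y in (extChartAt (𝓡 n) x₀).target,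
            (inner ℝ (G ((extChartAt (𝓡 n) x₀).symm y)) (chartVec x₀ y w) : ℝ) * η y

variable [MeasurableSpace M]

/-- The norm `(∫ |f|^r e^{-φ} dV_g + ∫ |G|^r e^{-φ} dV_g)^{1/r}` of a function `f` with weak
gradient `G`. -/
def sobolevENorm (φ : M → ℝ) (r : ℝ) (f : M → ℝ) (G : (x : M) → TangentSpace (𝓡 n) x) : ℝ≥0∞ :=
  ((∫⁻ x, ‖f x‖ₑ ^ r ∂weightedVolume n φ) + ∫⁻ x, ‖G x‖ₑ ^ r ∂weightedVolume n φ) ^ (1 / r)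

/-- `f ∈ W^{1,r}_φ(M)`, with weak gradient `G`. -/
def MemSobolev (φ : M → ℝ) (r : ℝ) (f : M → ℝ) (G : (x : M) → TangentSpace (𝓡 n) x) : Prop :=
  IsWeakGradient f G ∧ MemLp f (ENNReal.ofReal r) (weightedVolume n φ) ∧
    MemLp (fun x => ‖G x‖) (ENNReal.ofReal r) (weightedVolume n φ)

variable (n) in
/-- `f ∈ W^{1,r}_{0;φ}(M)`, the closure of `C_c^∞(M)` in `W^{1,r}_φ(M)`. -/
def MemSobolevZero (φ : M → ℝ) (r : ℝ) (f : M → ℝ) : Prop :=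
  ∃ G : (x : M) → TangentSpace (𝓡 n) x, MemSobolev φ r f G ∧
    ∀ ε : ℝ≥0∞, 0 < ε → ∃ ψ : M → ℝ, IsTestFunction n ψ ∧
      sobolevENorm φ r (fun x => f x - ψ x) (fun x => G x - gradient n ψ x) < ε

/-- The signed power `s^q = |s|^{q-1} s`. -/
def signedPow (q s : ℝ) : ℝ := |s| ^ (q - 1) * s

/-- `f = L_{p,φ} v = e^φ div (e^{-φ} |∇v|^{p-2} ∇v)` in the weak sense, where `V` is the gradient
of `v`. -/
def IsWeakDriftPLaplacian (φ : M → ℝ) (p : ℝ) (V : (x : M) → TangentSpace (𝓡 n) x)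
    (f : M → ℝ) : Prop :=
  ∀ ψ : M → ℝ, IsTestFunction n ψ →
    ∫ x, f x * ψ x ∂weightedVolume n φ =
      -∫ x, ‖V x‖ ^ (p - 2) * inner ℝ (V x) (gradient n ψ x) ∂weightedVolume n φ

variable (n) in
/-- `u` is a solution on `M × (a, ∞)` of `∂_t u = L_{p,φ} u^q` such that, for each `t > a`,
`u, u_t ∈ W^{1,q+1}_{0;φ}(M)` and `∇u^q ∈ L^p_φ(M)`. Here `u_t = ut t` is the derivative in
`L^{q+1}_φ(M)` of `t ↦ u(·, t)` and `V t` is the weak gradient of `u(·, t)^q`. -/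
def IsSolution (φ : M → ℝ) (p q a : ℝ) (u : ℝ → M → ℝ) : Prop :=
  ∃ (ut : ℝ → M → ℝ) (V : ℝ → (x : M) → TangentSpace (𝓡 n) x), ∀ t : ℝ, a < t →
    MemSobolevZero n φ (q + 1) (u t) ∧
    MemSobolevZero n φ (q + 1) (ut t) ∧
    Tendsto
      (fun h : ℝ => eLpNorm (fun x => (u (t + h) x - u t x) / h - ut t x)
        (ENNReal.ofReal (q + 1)) (weightedVolume n φ)) (𝓝[≠] 0) (𝓝 0) ∧
    IsWeakGradient (fun x => signedPow q (u t x)) (V t) ∧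
    MemLp (fun x => ‖V t x‖) (ENNReal.ofReal p) (weightedVolume n φ) ∧
    IsWeakDriftPLaplacian φ p (V t) (ut t)

variable (n) in
/-- `I(t) = ∫ |u(·, t)|^{q+1} e^{-φ} dV_g`. -/
def energy (φ : M → ℝ) (q : ℝ) (u : ℝ → M → ℝ) (t : ℝ) : ℝ :=
  ∫ x, |u t x| ^ (q + 1) ∂weightedVolume n φ

variable (n) in
/-- `u` vanishes to order `k` at infinity. -/
def VanishesToOrder (φ : M → ℝ) (q a : ℝ) (u : ℝ → M → ℝ) (k : ℝ) : Prop :=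
  ∃ C : ℝ, 0 < C ∧ ∀ t : ℝ, a < t → energy n φ q u t ≤ C * (t - a + 1) ^ (-k)

variable (n) in
/-- `u` vanishes to infinite order at infinity. -/
def VanishesToInfiniteOrder (φ : M → ℝ) (q a : ℝ) (u : ℝ → M → ℝ) : Prop :=
  ∀ k : ℕ, 0 < k → VanishesToOrder n φ q a u k

variable (n) in
/-- `u ≡ 0` on `M × (a, ∞)`, as a family of elements of `L^{q+1}_φ(M)`. -/
def IsTrivial (φ : M → ℝ) (a : ℝ) (u : ℝ → M → ℝ) : Prop :=
  ∀ t : ℝ, a < t → ∀ᵐ x ∂weightedVolume n φ, u t x = 0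

end Geometry

end DoublyNonlinear

end

/-! Write `v = u^q`, `I = ∫ |u|^(q+1)` and `J = ∫ |∇v|^p`, all with the weight `e^{-φ}`. Testing the
equation at time `t` with `v(t)` gives `I' = -(q+1) J`. Hence `Z = I^(-δ/(q+1))` satisfies `Z' = δ
ρ`, where `ρ = J / I^(pq/(q+1))` is the Rayleigh quotient of `v`, the `p`-th power of `‖∇v‖_p /
‖v‖_{(q+1)/q}`. Once `ρ` is known to be nonincreasing, `Z` grows at most linearly. This is the lower
bound for `I`; it also prevents a positive `I` from reaching zero in finite time. Comparison with
`(t-a+1)^(-k)` for large `t` bounds the vanishing order, and unique continuation follows.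

The monotonicity of `ρ` is obtained without differentiating `J`. The equation at time `t` is tested
with `v(s)` from an earlier time `s`. By Hölder, the pairing `∫ u(t) v(s)` is at most
`I(s)^(q/(q+1)) I(t)^(1/(q+1))`, with equality at `t = s`, and it decreases at a rate of at most
`J(t)^((p-1)/p) J(s)^(1/p)`. With Young's inequality this says that `y = I^(1/(q+1))`, as a function
of the clock `T = ∫ I^(q(p-1)/(q+1))`, lies above each of its tangents to the right. Its slope is
`-ρ`, so `ρ` is nonincreasing (`slope_le_of_above_tangents`, `lower_bound_of_pairings`).

The rest of the work is to show that `v(s)` may be used as a test function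
(`integral_mul_eq_neg_integral_inner`). Completeness gives, through Hopf–Rinow, compactly supported
cutoffs with Lipschitz constant `1/(N+1)`. The error they cause is controlled by `1/(N+1)` times `∫
|θ| |∇v(t)|^(p-1)`, where `θ` is the function tested with, so `θ` has to be in `L^p`. Now `v(s)` is
only in `L^((q+1)/q)`, but `δ > 0` means `(q+1)/q < p`, so its bounded truncations are in `L^p`; the
truncation is removed by dominated convergence (`integral_test_truncated`). A truncation times a
Lipschitz cutoff is not smooth either: it is localized by a partition of unity and mollified in
charts, and the gradient of the cutoff is only ever estimated (`abs_integral_test_le`,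
`abs_integral_test_lipschitz_le`).

The formula for `I'` uses the convexity of `|·|^(q+1)` and the continuity of `f ↦ f^q` from
`L^(q+1)` to its dual (`hasDerivAt_integral_rpow`). -/

namespace DoublyNonlinear

/-! ### The ordinary differential inequality for the energy. -/

section RealAnalysis

/-- A function `ρ` on `[s, t]` with `y' = -ρ w`, `w > 0`, whose primitive `y` lies above its
tangent lines to the right (in the clock `T = ∫ w`), takes a smaller value at `t` than at `s`. -/
lemma slope_le_of_above_tangents {y T ρ w : ℝ → ℝ} {s t : ℝ} (hst : s < t)
    (hw : ∀ x ∈ Icc s t, 0 < w x)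
    (hy : ∀ x ∈ Icc s t, HasDerivAt y (-(ρ x * w x)) x)
    (hT : ∀ x ∈ Icc s t, HasDerivAt T (w x) x)
    (h : ∀ x ∈ Icc s t, ∀ z ∈ Icc s t, x < z → y x - y z ≤ ρ x * (T z - T x)) :
    ρ t ≤ ρ s := by
  -- The argument is of Darboux type, since `ρ` need not be continuous. For a level `l` strictly
  -- between `ρ s` and `ρ t`, the function `g = y + l T` increases at `s` and decreases at `t`, so
  -- it has an interior maximum `m`, where `ρ m = l`. The tangent inequality from `m` to `t` then
  -- says `g m ≤ g t`, while `g t < g m`.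
  by_contra! hlt
  obtain ⟨l, hl1, hl2⟩ := exists_between hlt
  set g : ℝ → ℝ := fun x => y x + l * T x with hg
  have hgd : ∀ x ∈ Icc s t, HasDerivAt g ((l - ρ x) * w x) x := fun x hx =>
    ((hy x hx).add ((hT x hx).const_mul l)).congr_deriv (by ring)
  have hgc : ContinuousOn g (Icc s t) := fun x hx => (hgd x hx).continuousAt.continuousWithinAt
  obtain ⟨m, hm, hmax⟩ := isCompact_Icc.exists_isMaxOn (nonempty_Icc.2 hst.le) hgc
  have hs : s ∈ Icc s t := left_mem_Icc.2 hst.le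
  have ht : t ∈ Icc s t := right_mem_Icc.2 hst.le
  have hms : m ≠ s := by
    rintro rfl
    have h1 : ∀ᶠ x in 𝓝[>] m, g m < g x := by
      have h0 := (hasDerivAt_iff_tendsto_slope.1 (hgd m hs)).mono_left
        (nhdsWithin_mono m (fun x (hx : m < x) => ne_of_gt hx))
      have hpos : 0 < (l - ρ m) * w m := mul_pos (by linarith) (hw m hs)
      filter_upwards [h0.eventually (lt_mem_nhds hpos), self_mem_nhdsWithin] with x hx hx'
      rw [slope_def_field, lt_div_iff₀ (sub_pos.2 hx')] at hx
      linarith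
    obtain ⟨x, hx, hx2⟩ := (h1.and (Ioo_mem_nhdsGT hst)).exists
    exact absurd (hmax (⟨hx2.1.le, hx2.2.le⟩ : x ∈ Icc m t)) (not_le.2 hx)
  have hnt : ∃ x ∈ Icc s t, g t < g x := by
    have h1 : ∀ᶠ x in 𝓝[<] t, g t < g x := by
      have h0 := (hasDerivAt_iff_tendsto_slope.1 (hgd t ht)).mono_left
        (nhdsWithin_mono t (fun x (hx : x < t) => ne_of_lt hx))
      have hneg : (l - ρ t) * w t < 0 := mul_neg_of_neg_of_pos (by linarith) (hw t ht)
      filter_upwards [h0.eventually (gt_mem_nhds hneg), self_mem_nhdsWithin] with x hx hx'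
      rw [slope_def_field, div_lt_iff_of_neg (sub_neg.2 hx')] at hx
      linarith
    obtain ⟨x, hx, hx2⟩ := (h1.and (Ioo_mem_nhdsLT hst)).exists
    exact ⟨x, ⟨hx2.1.le, hx2.2.le⟩, hx⟩
  obtain ⟨x, hx, hxt⟩ := hnt
  have hgm : g t < g m := hxt.trans_le (hmax hx)
  have hmt : m ≠ t := by rintro rfl; exact lt_irrefl _ hgm
  have hms' : s < m := lt_of_le_of_ne hm.1 (Ne.symm hms)
  have hmt' : m < t := lt_of_le_of_ne hm.2 hmt
  have hder : (l - ρ m) * w m = 0 :=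
    (hmax.isLocalMax (Icc_mem_nhds hms' hmt')).hasDerivAt_eq_zero (hgd m hm)
  have hρ : ρ m = l := by
    rcases mul_eq_zero.1 hder with h0 | h0
    · linarith
    · exact absurd h0 (hw m hm).ne'
  have := h m hm t ht hmt'
  rw [hρ] at this
  simp only [hg] at hgm
  linarith

/-- The ordinary differential inequality behind the lower bound: `I` is the energy, `J` its
dissipation, and `B s t`, `D s t` are the pairings of the solution and of its time derivative at
time `t` with the dual of the solution at time `s`. -/
theorem lower_bound_of_pairings {a p q : ℝ} (hp : 1 < p) (hq : 0 < q)
    (hδ : 0 < q * (p - 1) - 1) {I J : ℝ → ℝ} {B D : ℝ → ℝ → ℝ}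
    (hI : ∀ t, a < t → HasDerivAt I (-((q + 1) * J t)) t)
    (hI0 : ∀ t, a < t → 0 ≤ I t) (hJ0 : ∀ t, a < t → 0 ≤ J t)
    (hB : ∀ s t, a < s → a < t → HasDerivAt (B s) (D s t) t)
    (hBs : ∀ s, a < s → B s s = I s)
    (hBle : ∀ s t, a < s → a < t → B s t ≤ I s ^ (q / (q + 1)) * I t ^ (1 / (q + 1)))
    (hD : ∀ s t, a < s → a < t → -D s t ≤ J t ^ ((p - 1) / p) * J s ^ (1 / p))
    {t₁ : ℝ} (ht₁ : a < t₁) (hpos : 0 < I t₁) :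
    ∃ c c' : ℝ, 0 < c ∧ 0 ≤ c' ∧ ∀ t : ℝ, a < t →
      (c + c' * (t - a)) ^ (-((q + 1) / (q * (p - 1) - 1))) ≤ I t := by
  have hq1 : 0 < q + 1 := by linarith
  have hp0 : 0 < p := by linarith
  set δ := q * (p - 1) - 1 with hδdef
  have hIc : ContinuousOn I (Ioi a) := fun t ht => (hI t ht).continuousAt.continuousWithinAt
  have hanti : AntitoneOn I (Ioi a) := by
    refine antitoneOn_of_deriv_nonpos (convex_Ioi a) hIc ?_ ?_
    · intro x hx; rw [interior_Ioi] at hx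
      exact (hI x hx).differentiableAt.differentiableWithinAt
    · intro x hx; rw [interior_Ioi] at hx
      rw [(hI x hx).deriv]
      have := hJ0 x hx
      have := mul_nonneg hq1.le this
      linarith
  -- the Rayleigh quotient is nonincreasing
  set ρ : ℝ → ℝ := fun t => J t * I t ^ (-(p * q / (q + 1))) with hρdef
  have hmono : ∀ s t, a < s → s < t → 0 < I t → ρ t ≤ ρ s := by
    intro s t hs hst hIt
    have hat : ∀ x ∈ Icc s t, a < x := fun x hx => hs.trans_le hx.1
    have hIx : ∀ x ∈ Icc s t, 0 < I x := fun x hx =>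
      hIt.trans_le (hanti (hat x hx) (hs.trans hst) hx.2)
    -- `y` stands for the `L^{q+1}` norm of the solution. The weight `w` is chosen so that `y' = -ρ
    -- w`, which makes `-ρ` the slope of `y` in the clock `T`.
    set y : ℝ → ℝ := fun x => I x ^ (1 / (q + 1)) with hydef
    set w : ℝ → ℝ := fun x => I x ^ (q * (p - 1) / (q + 1)) with hwdef
    set T : ℝ → ℝ := fun x => ∫ z in s..x, w z with hTdef
    have hwc : ContinuousOn w (Ioi a) :=
      hIc.rpow_const (fun x _ => Or.inr (by
        apply div_nonneg _ hq1.le; exact mul_nonneg hq.le (by linarith)))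
    have hw : ∀ x ∈ Icc s t, 0 < w x := fun x hx => Real.rpow_pos_of_pos (hIx x hx) _
    have hTd : ∀ x ∈ Icc s t, HasDerivAt T (w x) x := by
      intro x hx
      refine intervalIntegral.integral_hasDerivAt_right ?_ ?_ ?_
      · refine (hwc.mono ?_).intervalIntegrable
        rw [uIcc_of_le hx.1]; exact fun z hz => hs.trans_le hz.1
      · exact hwc.stronglyMeasurableAtFilter isOpen_Ioi x (hat x hx)
      · exact hwc.continuousAt (Ioi_mem_nhds (hat x hx))
    have hyd : ∀ x ∈ Icc s t, HasDerivAt y (-(ρ x * w x)) x := by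
      intro x hx
      convert (hI x (hat x hx)).rpow_const (p := 1 / (q + 1)) (Or.inl (hIx x hx).ne') using 1
      simp only [hρdef, hwdef]
      rw [mul_assoc, ← Real.rpow_add (hIx x hx),
        show -(p * q / (q + 1)) + q * (p - 1) / (q + 1) = 1 / (q + 1) - 1 by field_simp; ring]
      field_simp
    refine slope_le_of_above_tangents hst hw hyd hTd ?_
    intro x hx z hz hxz
    have hyx : 0 < I x ^ (q / (q + 1)) := Real.rpow_pos_of_pos (hIx x hx) _
    -- the auxiliary monotone function
    set k : ℝ → ℝ := fun τ => B x τ / I x ^ (q / (q + 1)) + ρ x / p * T τ - (1 - 1 / p) * y τ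
      with hk
    have hsub : Icc x z ⊆ Icc s t := Icc_subset_Icc hx.1 hz.2
    have hkd : ∀ τ ∈ Icc x z, HasDerivAt k
        (D x τ / I x ^ (q / (q + 1)) + ρ x / p * w τ - (1 - 1 / p) * (-(ρ τ * w τ))) τ :=
      fun τ hτ => (((hB x τ (hat x hx) (hat τ (hsub hτ))).div_const _).add
        ((hTd τ (hsub hτ)).const_mul _)).sub ((hyd τ (hsub hτ)).const_mul _)
    -- In `k'`, the pairing term is at least `-ρ τ ^ (1 - 1/p) * ρ x ^ (1/p) * w τ` by `hD`, and
    -- Young's inequality splits this product into the other two terms. Then `k x ≤ k z` is the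
    -- tangent inequality divided by `p`.
    have hkmono : MonotoneOn k (Icc x z) := by
      refine monotoneOn_of_deriv_nonneg (convex_Icc x z)
        (fun τ hτ => (hkd τ hτ).continuousAt.continuousWithinAt)
        (fun τ hτ => (hkd τ (interior_subset hτ)).differentiableAt.differentiableWithinAt) ?_
      intro τ hτ
      have hτ' := interior_subset hτ
      rw [(hkd τ hτ').deriv]
      have haτ := hat τ (hsub hτ')
      have hIτ := hIx τ (hsub hτ')
      have h1 := hD x τ (hat x hx) haτ
      -- Young's inequality
      have hρ0 : ∀ τ, a < τ → 0 ≤ ρ τ := fun τ hτ =>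
        mul_nonneg (hJ0 τ hτ) (Real.rpow_nonneg (hI0 τ hτ) _)
      have hyoung := Real.geom_mean_le_arith_mean2_weighted (w₁ := 1 - 1 / p) (w₂ := 1 / p)
        (by rw [sub_nonneg, div_le_one hp0]; exact hp.le) (by positivity)
        (hρ0 τ haτ) (hρ0 x (hat x hx)) (by ring)
      -- All powers of `I` cancel: the exponents in `ρ` and `w` are fitted to the Hölder bound `hD`.
      have h2 : ρ τ ^ (1 - 1 / p) * ρ x ^ (1 / p) * w τ * I x ^ (q / (q + 1)) =
          J τ ^ ((p - 1) / p) * J x ^ (1 / p) := by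
        simp only [hρdef, hwdef]
        rw [Real.mul_rpow (hJ0 τ haτ) (Real.rpow_nonneg hIτ.le _),
          Real.mul_rpow (hJ0 x (hat x hx)) (Real.rpow_nonneg (hIx x hx).le _),
          ← Real.rpow_mul hIτ.le, ← Real.rpow_mul (hIx x hx).le]
        have e1 : I τ ^ (-(p * q / (q + 1)) * (1 - 1 / p)) * I τ ^ (q * (p - 1) / (q + 1)) = 1 := by
          rw [← Real.rpow_add hIτ]
          rw [show -(p * q / (q + 1)) * (1 - 1 / p) + q * (p - 1) / (q + 1) = 0 by
            field_simp; ring, Real.rpow_zero]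
        have e2 : I x ^ (-(p * q / (q + 1)) * (1 / p)) * I x ^ (q / (q + 1)) = 1 := by
          rw [← Real.rpow_add (hIx x hx)]
          rw [show -(p * q / (q + 1)) * (1 / p) + q / (q + 1) = 0 by
            field_simp; ring, Real.rpow_zero]
        rw [show (p - 1) / p = 1 - 1 / p by field_simp]
        linear_combination (J τ ^ (1 - 1 / p) * J x ^ (1 / p)) *
          (I x ^ (-(p * q / (q + 1)) * (1 / p)) * I x ^ (q / (q + 1)) * e1 + e2)
      rw [← h2] at h1
      have h3 : -(ρ τ ^ (1 - 1 / p) * ρ x ^ (1 / p) * w τ) ≤ D x τ / I x ^ (q / (q + 1)) := by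
        rw [le_div_iff₀ hyx]; linarith
      have h4 := mul_le_mul_of_nonneg_right hyoung (hw τ (hsub hτ')).le
      have e : ρ x / p * w τ = 1 / p * ρ x * w τ := by ring
      rw [e]
      linarith
    have h5 := hkmono (left_mem_Icc.2 hxz.le) (right_mem_Icc.2 hxz.le) hxz.le
    have h6 : B x x / I x ^ (q / (q + 1)) = y x := by
      rw [hBs x (hat x hx), div_eq_iff hyx.ne', hydef, ← Real.rpow_add (hIx x hx),
        show 1 / (q + 1) + q / (q + 1) = 1 by field_simp; ring, Real.rpow_one]
    have h7 : B x z / I x ^ (q / (q + 1)) ≤ y z := by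
      rw [div_le_iff₀ hyx, mul_comm]; exact hBle x z (hat x hx) (hat z hz)
    simp only [hk, h6] at h5
    have h8 : (y x - y z) / p ≤ ρ x * (T z - T x) / p := by
      have : ρ x * (T z - T x) / p = ρ x / p * T z - ρ x / p * T x := by ring
      rw [this]
      have : (y x - y z) / p = (1 / p) * y x - (1 / p) * y z := by ring
      rw [this]
      linarith
    exact (div_le_div_iff_of_pos_right hp0).1 h8
  -- growth of `Z = I ^ (-δ / (q + 1))`
  set Z : ℝ → ℝ := fun t => I t ^ (-(δ / (q + 1))) with hZdef
  have hZd : ∀ t, a < t → 0 < I t → HasDerivAt Z (δ * ρ t) t := by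
    intro t ht hIt
    convert (hI t ht).rpow_const (p := -(δ / (q + 1))) (Or.inl hIt.ne') using 1
    simp only [hρdef]
    -- This relation between the exponents is what makes `Z'` exactly `δ ρ`.
    rw [show -(p * q / (q + 1)) = -(δ / (q + 1)) - 1 by rw [hδdef]; field_simp; ring]
    field_simp
  have hρ1 : 0 ≤ ρ t₁ := mul_nonneg (hJ0 t₁ ht₁) (Real.rpow_nonneg hpos.le _)
  have hZle : ∀ t, t₁ ≤ t → 0 < I t → Z t ≤ Z t₁ + δ * ρ t₁ * (t - t₁) := by
    intro t ht hIt
    have hat : ∀ x ∈ Icc t₁ t, a < x := fun x hx => ht₁.trans_le hx.1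
    have hIx : ∀ x ∈ Icc t₁ t, 0 < I x := fun x hx =>
      hIt.trans_le (hanti (hat x hx) (ht₁.trans_le ht) hx.2)
    have := (convex_Icc t₁ t).image_sub_le_mul_sub_of_deriv_le (f := Z) (C := δ * ρ t₁)
      (fun x hx => (hZd x (hat x hx) (hIx x hx)).continuousAt.continuousWithinAt)
      (fun x hx => (hZd x (hat x (interior_subset hx))
        (hIx x (interior_subset hx))).differentiableAt.differentiableWithinAt)
      (fun x hx => by
        rw [interior_Icc] at hx
        have hx' := Ioo_subset_Icc_self hx
        rw [(hZd x (hat x hx') (hIx x hx')).deriv]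
        exact mul_le_mul_of_nonneg_left (hmono t₁ x ht₁ hx.1 (hIx x hx')) hδ.le)
      t₁ (left_mem_Icc.2 ht) t (right_mem_Icc.2 ht) ht
    linarith
  have hZ1 : 0 < Z t₁ := Real.rpow_pos_of_pos hpos _
  have hIZ : ∀ t, 0 ≤ I t → Z t ^ (-((q + 1) / δ)) = I t := fun t ht => by
    rw [hZdef, ← Real.rpow_mul ht, show -(δ / (q + 1)) * -((q + 1) / δ) = 1 by field_simp,
      Real.rpow_one]
  have hκ : -((q + 1) / δ) ≤ 0 := by
    rw [neg_nonpos]; positivity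
  have hlow : ∀ t, t₁ ≤ t → 0 < I t →
      (Z t₁ + δ * ρ t₁ * (t - t₁)) ^ (-((q + 1) / δ)) ≤ I t := by
    intro t ht hIt
    rw [← hIZ t hIt.le]
    exact Real.rpow_le_rpow_of_nonpos (Real.rpow_pos_of_pos hIt _) (hZle t ht hIt) hκ
  have hIpos : ∀ t, t₁ ≤ t → 0 < I t := by
    intro t ht
    by_contra! hIt
    -- At the first zero `b` of `I` after `t₁`, the bound `hlow`, valid before `b`, passes to the
    -- limit and keeps `I b` above a positive constant.
    set S := Icc t₁ t ∩ I ⁻¹' {0} with hS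
    have hsub : Icc t₁ t ⊆ Ioi a := fun x hx => ht₁.trans_le hx.1
    have hSc : IsCompact S :=
      isCompact_Icc.of_isClosed_subset
        ((hIc.mono hsub).preimage_isClosed_of_isClosed isClosed_Icc isClosed_singleton)
        inter_subset_left
    have hSn : S.Nonempty :=
      ⟨t, ⟨ht, le_rfl⟩, le_antisymm hIt (hI0 t (ht₁.trans_le ht))⟩
    obtain ⟨b, hbS, hbmin⟩ := hSc.exists_isLeast hSn
    have hb1 : t₁ < b := lt_of_le_of_ne hbS.1.1 (by rintro rfl; exact hpos.ne' hbS.2)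
    have hbpos : ∀ x ∈ Ico t₁ b, 0 < I x := fun x hx =>
      lt_of_le_of_ne (hI0 x (ht₁.trans_le hx.1)) fun h0 =>
        absurd (hbmin ⟨⟨hx.1, hx.2.le.trans hbS.1.2⟩, h0.symm⟩) (not_le.2 hx.2)
    have hM : ∀ᶠ x in 𝓝[<] b, (Z t₁ + δ * ρ t₁ * (b - t₁)) ^ (-((q + 1) / δ)) ≤ I x := by
      filter_upwards [Ioo_mem_nhdsLT hb1] with x hx
      refine le_trans ?_ (hlow x hx.1.le (hbpos x ⟨hx.1.le, hx.2⟩))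
      refine Real.rpow_le_rpow_of_nonpos ?_ ?_ hκ
      · have := mul_nonneg (mul_nonneg hδ.le hρ1) (sub_nonneg.2 hx.1.le)
        linarith
      · have := mul_le_mul_of_nonneg_left (sub_le_sub_right hx.2.le t₁) (mul_nonneg hδ.le hρ1)
        linarith
    have hlim : Tendsto I (𝓝[<] b) (𝓝 (I b)) :=
      (hI b (ht₁.trans hb1)).continuousAt.tendsto.mono_left nhdsWithin_le_nhds
    have h1 := ge_of_tendsto hlim hM
    rw [hbS.2] at h1
    refine absurd h1 (not_le.2 (Real.rpow_pos_of_pos ?_ _))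
    have := mul_nonneg (mul_nonneg hδ.le hρ1) (sub_nonneg.2 hb1.le)
    linarith
  -- The constants come from the linear bound on `Z` after `t₁`, weakened by `t - t₁ ≤ t - a`.
  -- Before `t₁`, the left side is at most `Z t₁ ^ (-((q + 1) / δ)) = I t₁`, and `I` is
  -- nonincreasing.
  refine ⟨Z t₁, δ * ρ t₁, hZ1, mul_nonneg hδ.le hρ1, fun t ht => ?_⟩
  have hnn : 0 ≤ δ * ρ t₁ := mul_nonneg hδ.le hρ1
  rcases le_total t₁ t with h | h
  · refine le_trans ?_ (hlow t h (hIpos t h))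
    refine Real.rpow_le_rpow_of_nonpos ?_ ?_ hκ
    · have := mul_nonneg hnn (sub_nonneg.2 h); linarith
    · have := mul_le_mul_of_nonneg_left (sub_le_sub_left ht₁.le t) hnn; linarith
  · refine le_trans ?_ (hanti ht ht₁ h)
    rw [← hIZ t₁ hpos.le]
    refine Real.rpow_le_rpow_of_nonpos hZ1 ?_ hκ
    have := mul_nonneg hnn (sub_nonneg.2 ht.le); linarith

/-- A function which is bounded below by `(c + c' (t - a)) ^ (-κ)` and above by
`C (t - a + 1) ^ (-k)` satisfies `k ≤ κ`. -/
lemma order_le_of_bounds {a c c' κ k C : ℝ} (hc : 0 < c) (hc' : 0 ≤ c') (hκ : 0 < κ) {I : ℝ → ℝ}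
    (hlow : ∀ t, a < t → (c + c' * (t - a)) ^ (-κ) ≤ I t)
    (hup : ∀ t, a < t → I t ≤ C * (t - a + 1) ^ (-k)) : k ≤ κ := by
  -- With `s = t - a + 1 > 1` and `m = c + c'`, one has `c + c' (s - 1) ≤ m s`. The two bounds then
  -- give `m ^ (-κ) * s ^ (k - κ) ≤ C`, which fails for large `s` when `k > κ`.
  by_contra! hlt
  set m := c + c' with hm
  have hm0 : 0 < m := by positivity
  have h1 : ∀ s : ℝ, 1 < s → m ^ (-κ) * s ^ (k - κ) ≤ C := by
    intro s hs
    have hs0 : 0 < s := by linarith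
    have h2 := (hlow (s - 1 + a) (by linarith)).trans (hup (s - 1 + a) (by linarith))
    rw [show s - 1 + a - a = s - 1 by ring, show s - 1 + 1 = s by ring] at h2
    have h3 : (m * s) ^ (-κ) ≤ (c + c' * (s - 1)) ^ (-κ) := by
      refine Real.rpow_le_rpow_of_nonpos ?_ ?_ (by linarith)
      · have := mul_nonneg hc' (by linarith : (0 : ℝ) ≤ s - 1); linarith
      · have := mul_le_mul_of_nonneg_left hs.le hc.le
        rw [hm]; linarith
    rw [Real.mul_rpow hm0.le hs0.le] at h3
    have h4 := h3.trans h2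
    have h5 := mul_le_mul_of_nonneg_right h4 (Real.rpow_nonneg hs0.le k)
    rw [mul_assoc, mul_assoc, ← Real.rpow_add hs0, ← Real.rpow_add hs0] at h5
    simpa [show -κ + k = k - κ by ring] using h5
  have h2 : Tendsto (fun s : ℝ => m ^ (-κ) * s ^ (k - κ)) atTop atTop :=
    (tendsto_rpow_atTop (by linarith)).const_mul_atTop (Real.rpow_pos_of_pos hm0 _)
  obtain ⟨s, hs, hs1⟩ := ((h2.eventually_gt_atTop C).and (eventually_gt_atTop 1)).exists
  exact absurd (h1 s hs1) (not_le.2 hs)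

end RealAnalysis

/-! ### Compactness of closed balls. -/

section HopfRinow

/-- A Riemannian manifold is a length space. -/
lemma exists_dist_le_and_dist_le (n : ℕ) {M : Type*} [MetricSpace M]
    [ChartedSpace (EuclideanSpace ℝ (Fin n)) M] [IsManifold (𝓡 n) ∞ M]
    [RiemannianBundle (fun x : M => TangentSpace (𝓡 n) x)]
    [IsRiemannianManifold (𝓡 n) M]
    {x₀ x : M} {r ε : ℝ} (hr : 0 ≤ r) (hε : 0 < ε)
    (h : dist x₀ x < r + ε) : ∃ z, dist x₀ z ≤ r ∧ dist z x ≤ ε := by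
  rcases le_or_gt (dist x₀ x) r with hx | hx
  · exact ⟨x, hx, by simpa using hε.le⟩
  have h1 : riemannianEDist (𝓡 n) x₀ x < ENNReal.ofReal (r + ε) := by
    rw [← IsRiemannianManifold.out, edist_dist]
    exact (ENNReal.ofReal_lt_ofReal_iff (by linarith)).2 h
  -- On a curve of length less than `r + ε`, reaching a point at distance exactly `r` from `x₀` uses
  -- length at least `r`, so less than `ε` remains to reach `x`.
  obtain ⟨γ, h0, h1, hγ, hl⟩ := exists_lt_of_riemannianEDist_lt h1
  have hc : ContinuousOn (fun t => dist x₀ (γ t)) (Icc 0 1) :=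
    (Continuous.dist continuous_const continuous_id).comp_continuousOn hγ.continuousOn
  obtain ⟨τ, hτ, hτr⟩ : r ∈ (fun t => dist x₀ (γ t)) '' Icc 0 1 :=
    intermediate_value_Icc zero_le_one hc ⟨by simpa [h0] using hr, by simpa [h1] using hx.le⟩
  have hτr : dist x₀ (γ τ) = r := hτr
  refine ⟨γ τ, hτr.le, ?_⟩
  have e1 : edist x₀ (γ τ) ≤ pathELength (𝓡 n) γ 0 τ := by
    rw [IsRiemannianManifold.out (I := 𝓡 n)]
    exact riemannianEDist_le_pathELength (hγ.mono (Icc_subset_Icc le_rfl hτ.2)) h0 rfl hτ.1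
  have e2 : edist (γ τ) x ≤ pathELength (𝓡 n) γ τ 1 := by
    rw [IsRiemannianManifold.out (I := 𝓡 n)]
    exact riemannianEDist_le_pathELength (hγ.mono (Icc_subset_Icc hτ.1 le_rfl)) rfl h1 hτ.2
  have e3 := (add_le_add e1 e2).trans_lt ((pathELength_add hτ.1 hτ.2).trans_lt hl)
  rw [edist_dist, edist_dist, ← ENNReal.ofReal_add dist_nonneg dist_nonneg,
    ENNReal.ofReal_lt_ofReal_iff (by linarith), hτr] at e3
  linarith

/-- The Hopf–Rinow theorem: closed balls of a complete Riemannian manifold are compact. -/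
theorem isCompact_closedBall_of_complete (n : ℕ) {M : Type*} [MetricSpace M]
    [ChartedSpace (EuclideanSpace ℝ (Fin n)) M] [IsManifold (𝓡 n) ∞ M]
    [RiemannianBundle (fun x : M => TangentSpace (𝓡 n) x)]
    [IsRiemannianManifold (𝓡 n) M]
    [CompleteSpace M] (x₀ : M) (R : ℝ) :
    IsCompact (Metric.closedBall x₀ R) := by
  have : LocallyCompactSpace M := Manifold.locallyCompact_of_finiteDimensional (𝓡 n)
  -- Let `s` be the supremum of the radii of compact balls. The ball of radius `s` is totally
  -- bounded, since its points are within `ε / 2` of a compact ball of radius slightly below `s`; by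
  -- completeness it is compact. A compact neighbourhood of it then contains a larger ball.
  by_contra hR
  set S := {r : ℝ | 0 ≤ r ∧ IsCompact (Metric.closedBall x₀ r)} with hS
  have h0 : (0 : ℝ) ∈ S := ⟨le_rfl, by simp⟩
  have hbdd : BddAbove S := ⟨R, fun r hr => by
    by_contra! hlt
    exact hR (hr.2.of_isClosed_subset Metric.isClosed_closedBall
      (Metric.closedBall_subset_closedBall hlt.le))⟩
  set s := sSup S with hs
  have hs0 : 0 ≤ s := le_csSup hbdd h0
  have hcomp : IsCompact (Metric.closedBall x₀ s) := by
    refine isCompact_iff_totallyBounded_isComplete.2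
      ⟨?_, Metric.isClosed_closedBall.isComplete⟩
    rw [Metric.totallyBounded_iff]
    intro ε hε
    obtain ⟨r, hrS, hr⟩ := exists_lt_of_lt_csSup ⟨0, h0⟩ (show s - ε / 2 < s by linarith)
    obtain ⟨t, ht, hcov⟩ := (Metric.totallyBounded_iff.1 hrS.2.totallyBounded) (ε / 2) (by linarith)
    refine ⟨t, ht, fun x hx => ?_⟩
    rw [Metric.mem_closedBall, dist_comm] at hx
    obtain ⟨z, hz1, hz2⟩ := exists_dist_le_and_dist_le n (x₀ := x₀) (x := x) (r := r) (ε := ε / 2)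
      hrS.1 (by linarith) (by linarith)
    have hz := hcov (show z ∈ Metric.closedBall x₀ r by rwa [Metric.mem_closedBall, dist_comm])
    simp only [mem_iUnion, Metric.mem_ball, exists_prop] at hz ⊢
    obtain ⟨y, hy, hyz⟩ := hz
    exact ⟨y, hy, by
      have := dist_triangle x z y
      rw [dist_comm x z] at this
      linarith⟩
  obtain ⟨K, hK, hKs⟩ := exists_compact_superset hcomp
  obtain ⟨d, hd, hsub⟩ := hcomp.exists_cthickening_subset_open isOpen_interior hKs
  have hmem : s + d / 2 ∈ S := by
    refine ⟨by linarith, hK.of_isClosed_subset Metric.isClosed_closedBall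
      (Subset.trans ?_ (hsub.trans interior_subset))⟩
    intro x hx
    rw [Metric.mem_closedBall, dist_comm] at hx
    obtain ⟨z, hz1, hz2⟩ := exists_dist_le_and_dist_le n (x₀ := x₀) (x := x) (r := s) (ε := d)
      hs0 hd (by linarith)
    refine Metric.mem_cthickening_of_dist_le x z d _ ?_ (by rwa [dist_comm])
    rwa [Metric.mem_closedBall, dist_comm]
  have := le_csSup hbdd hmem
  linarith

end HopfRinow

/-! ### Mollification in Euclidean spaces. -/

section Mollification

open scoped Convolution

variable {E : Type*} [NormedAddCommGroup E] [InnerProductSpace ℝ E] [FiniteDimensional ℝ E]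
  [MeasurableSpace E] [BorelSpace E]

variable (E) in
/-- The bump functions, supported in the ball of radius `1 / (N + 1)`, used to mollify. -/
noncomputable def mollifier (N : ℕ) : ContDiffBump (0 : E) where
  -- The fixed ratio `rOut = 2 * rIn` is what almost everywhere convergence of the mollifications
  -- requires.
  rIn := 1 / (N + 1) / 2
  rOut := 1 / (N + 1)
  rIn_pos := by positivity
  rIn_lt_rOut := half_lt_self (by positivity)

/-- The `N`-th mollification of `g`. -/
noncomputable def mollify (N : ℕ) (g : E → ℝ) : E → ℝ :=
  (mollifier E N).normed volume ⋆[ContinuousLinearMap.lsmul ℝ ℝ, volume] g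

lemma mollify_apply (N : ℕ) (g : E → ℝ) (x : E) :
    mollify N g x = ∫ t, (mollifier E N).normed volume t * g (x - t) := rfl

lemma tendsto_mollifier_rOut : Tendsto (fun N => (mollifier E N).rOut) atTop (𝓝 0) :=
  tendsto_one_div_add_atTop_nhds_zero_nat

lemma contDiff_mollify (N : ℕ) {g : E → ℝ} (hg : LocallyIntegrable g) :
    ContDiff ℝ ∞ (mollify N g) :=
  (mollifier E N).hasCompactSupport_normed.contDiff_convolution_left _
    (mollifier E N).contDiff_normed hg

lemma ae_tendsto_mollify {g : E → ℝ} (hg : LocallyIntegrable g) :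
    ∀ᵐ x, Tendsto (fun N => mollify N g x) atTop (𝓝 (g x)) :=
  ContDiffBump.ae_convolution_tendsto_right_of_locallyIntegrable (K := 2) tendsto_mollifier_rOut
    (Eventually.of_forall fun N => by simp only [mollifier]; linarith) hg

lemma abs_mollify_le {g : E → ℝ} {C : ℝ} (hC : ∀ x, |g x| ≤ C) (N : ℕ) (x : E) :
    |mollify N g x| ≤ C := by
  have h1 : ‖∫ t, (mollifier E N).normed volume t * g (x - t)‖ ≤
      ∫ t, (mollifier E N).normed volume t * C := by
    refine norm_integral_le_of_norm_le ((mollifier E N).integrable_normed.mul_const C)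
      (Eventually.of_forall fun t => ?_)
    rw [norm_mul, Real.norm_of_nonneg ((mollifier E N).nonneg_normed t)]
    exact mul_le_mul_of_nonneg_left (hC _) ((mollifier E N).nonneg_normed t)
  rwa [integral_mul_const, (mollifier E N).integral_normed, one_mul] at h1

/-- Mollification does not increase the `L^p` norm. -/
lemma eLpNorm_mollify_le {p : ℝ} (hp : 1 < p) {h : E → ℝ}
    (hh : AEStronglyMeasurable h) (N : ℕ) :
    eLpNorm (mollify N h) (ENNReal.ofReal p) volume ≤ eLpNorm h (ENNReal.ofReal p) volume := by
  have hp0 : 0 < p := by linarith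
  have hne : ENNReal.ofReal p ≠ 0 := by simpa using hp0
  rw [eLpNorm_eq_lintegral_rpow_enorm_toReal hne ENNReal.ofReal_ne_top,
    eLpNorm_eq_lintegral_rpow_enorm_toReal hne ENNReal.ofReal_ne_top,
    ENNReal.toReal_ofReal hp0.le]
  refine ENNReal.rpow_le_rpow ?_ (by positivity)
  set ρ : E → ℝ := (mollifier E N).normed volume with hρ
  have hρc : Continuous ρ := (mollifier E N).continuous_normed
  have hρ0 : ∀ t, 0 ≤ ρ t := (mollifier E N).nonneg_normed
  have hρ1 : ∫⁻ t, ENNReal.ofReal (ρ t) = 1 := by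
    rw [← ofReal_integral_eq_lintegral_ofReal (mollifier E N).integrable_normed
      (Eventually.of_forall hρ0), (mollifier E N).integral_normed, ENNReal.ofReal_one]
  -- Mollifying is averaging against the probability measure `ν`. Hölder against the constant `1`
  -- bounds the `p`-th power of the average pointwise, and Tonelli with translation invariance
  -- integrates this bound.
  set ν : Measure E := volume.withDensity fun t => ENNReal.ofReal (ρ t) with hν
  have hρm : Measurable fun t => ENNReal.ofReal (ρ t) := hρc.measurable.ennreal_ofReal
  have hac : ν ≪ volume := withDensity_absolutelyContinuous _ _
  have : IsProbabilityMeasure ν := ⟨by rw [hν, withDensity_apply _ .univ, setLIntegral_univ, hρ1]⟩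
  have hqm : ∀ x : E, Measure.QuasiMeasurePreserving (fun t => x - t) volume volume := fun x =>
    (Measure.measurePreserving_sub_left volume x).quasiMeasurePreserving
  have hhx : ∀ x, AEMeasurable (fun t => ‖h (x - t)‖ₑ) volume := fun x =>
    (hh.comp_quasiMeasurePreserving (hqm x)).enorm
  have key : ∀ x, ‖mollify N h x‖ₑ ^ p ≤ ∫⁻ t, ENNReal.ofReal (ρ t) * ‖h (x - t)‖ₑ ^ p := by
    intro x
    have h1 : ‖mollify N h x‖ₑ ≤ ∫⁻ t, ‖h (x - t)‖ₑ ∂ν := by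
      rw [mollify_apply, hν, lintegral_withDensity_eq_lintegral_mul_non_measurable₀ _
        hρm.aemeasurable (Eventually.of_forall fun _ => ENNReal.ofReal_lt_top)]
      refine (enorm_integral_le_lintegral_enorm _).trans (lintegral_mono fun t => ?_)
      rw [enorm_mul, Real.enorm_of_nonneg (hρ0 t)]; rfl
    have hpq := Real.HolderConjugate.conjExponent hp
    have h2 := ENNReal.lintegral_mul_le_Lp_mul_Lq ν hpq ((hhx x).mono_ac hac)
      (aemeasurable_const (b := (1 : ℝ≥0∞)))
    simp only [Pi.mul_apply, mul_one, ENNReal.one_rpow, lintegral_const, measure_univ] at h2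
    have h3 := ENNReal.rpow_le_rpow (h1.trans h2) hp0.le
    rw [← ENNReal.rpow_mul, one_div_mul_cancel hp0.ne', ENNReal.rpow_one, hν,
      lintegral_withDensity_eq_lintegral_mul_non_measurable₀ _
        hρm.aemeasurable (Eventually.of_forall fun _ => ENNReal.ofReal_lt_top)] at h3
    exact h3
  calc ∫⁻ x, ‖mollify N h x‖ₑ ^ p ≤ ∫⁻ x, ∫⁻ t, ENNReal.ofReal (ρ t) * ‖h (x - t)‖ₑ ^ p :=
        lintegral_mono key
    _ = ∫⁻ t, ∫⁻ x, ENNReal.ofReal (ρ t) * ‖h (x - t)‖ₑ ^ p := by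
        refine lintegral_lintegral_swap ?_
        refine AEMeasurable.mul (hρm.comp measurable_snd).aemeasurable ?_
        refine AEMeasurable.pow_const ?_ p
        exact (hh.comp_quasiMeasurePreserving
          (quasiMeasurePreserving_sub_of_right_invariant volume volume)).enorm
    _ = ∫⁻ t, ENNReal.ofReal (ρ t) * ∫⁻ x, ‖h x‖ₑ ^ p := by
        refine lintegral_congr fun t => ?_
        rw [lintegral_const_mul' _ _ ENNReal.ofReal_ne_top,
          lintegral_sub_right_eq_self (fun x => ‖h x‖ₑ ^ p) t]
    _ = ∫⁻ x, ‖h x‖ₑ ^ p := by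
        rw [lintegral_mul_const _ hρm, hρ1, one_mul]

lemma mollify_sub (N : ℕ) {g h : E → ℝ} (hg : LocallyIntegrable g) (hh : LocallyIntegrable h) :
    mollify N (g - h) = mollify N g - mollify N h := by
  have e : ∀ f : E → ℝ, LocallyIntegrable f → ∀ x, Integrable
      (fun t => (mollifier E N).normed volume t * f (x - t)) := fun f hf x =>
    (mollifier E N).hasCompactSupport_normed.convolutionExists_left
      (ContinuousLinearMap.lsmul ℝ ℝ) (mollifier E N).continuous_normed hf x
  ext x
  simp only [mollify_apply, Pi.sub_apply, mul_sub]
  exact integral_sub (e g hg x) (e h hh x)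

/-- Uniform continuity makes the difference uniformly small. All mollifiers live in the unit ball,
so the difference vanishes off the closed `1`-neighbourhood of the support, a compact set
independent of `N`. -/
lemma tendsto_eLpNorm_mollify_sub_of_continuous {p : ℝ} (hp : 1 < p) {c : E → ℝ}
    (hc : Continuous c) (hcs : HasCompactSupport c) :
    Tendsto (fun N => eLpNorm (mollify N c - c) (ENNReal.ofReal p) volume) atTop (𝓝 0) := by
  have hne : ENNReal.ofReal p ≠ 0 := by simp; linarith
  set K := Metric.cthickening 1 (tsupport c) with hK
  have hKc : IsCompact K := hcs.isCompact.cthickening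
  have hsupp : ∀ N, ∀ x, x ∉ K → (mollify N c - c) x = 0 := by
    intro N x hx
    have hx1 : ∀ t ∈ Metric.closedBall (0 : E) 1, c (x - t) = 0 := by
      intro t ht
      by_contra h0
      refine hx (Metric.mem_cthickening_of_dist_le x (x - t) 1 _ (subset_tsupport c h0) ?_)
      simpa [dist_eq_norm] using ht
    have hcx : c x = 0 := by simpa using hx1 0 (by simp)
    simp only [Pi.sub_apply, hcx, sub_zero, mollify_apply]
    refine integral_eq_zero_of_ae (Eventually.of_forall fun t => ?_)
    by_cases ht : t ∈ Metric.closedBall (0 : E) 1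
    · simp [hx1 t ht]
    · have : (mollifier E N).normed volume t = 0 := by
        rw [← Function.notMem_support, (mollifier E N).support_normed_eq]
        intro h1
        refine ht (Metric.ball_subset_closedBall.trans (Metric.closedBall_subset_closedBall ?_) h1)
        simp only [mollifier]
        rw [div_le_one (by positivity)]
        linarith [(Nat.cast_nonneg N : (0 : ℝ) ≤ N)]
      simp [this]
  have huc : UniformContinuous c := hcs.uniformContinuous_of_continuous hc
  have hmain : ∀ ε : ℝ, 0 < ε → ∀ᶠ N in atTop,
      eLpNorm (mollify N c - c) (ENNReal.ofReal p) volume ≤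
        ENNReal.ofReal ε * volume K ^ (1 / p) := by
    intro ε hε
    obtain ⟨d, hd, hcd⟩ := Metric.uniformContinuous_iff.1 huc ε hε
    filter_upwards [(tendsto_mollifier_rOut (E := E)).eventually (gt_mem_nhds hd)] with N hN
    have h1 : ∀ x, ‖(mollify N c - c) x‖ ≤ ‖K.indicator (fun _ => ε) x‖ := by
      intro x
      by_cases hx : x ∈ K
      · rw [indicator_of_mem hx, Real.norm_of_nonneg hε.le, Pi.sub_apply, ← dist_eq_norm]
        refine (mollifier E N).dist_normed_convolution_le hc.aestronglyMeasurable fun z hz => ?_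
        exact (hcd ((Metric.mem_ball.1 hz).trans hN)).le
      · rw [hsupp N x hx]; simp
    refine (eLpNorm_mono h1).trans ?_
    rw [eLpNorm_indicator_const hKc.measurableSet hne ENNReal.ofReal_ne_top,
      ENNReal.toReal_ofReal (by linarith), Real.enorm_of_nonneg hε.le]
  rw [ENNReal.tendsto_nhds_zero]
  intro e he
  have hV : volume K ^ (1 / p) ≠ ⊤ :=
    ENNReal.rpow_ne_top_of_nonneg (by positivity) hKc.measure_lt_top.ne
  obtain ⟨ε, hε, hεe⟩ : ∃ ε : ℝ, 0 < ε ∧ ENNReal.ofReal ε * volume K ^ (1 / p) ≤ e := by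
    have ht : Tendsto (fun ε : ℝ => ENNReal.ofReal ε * volume K ^ (1 / p)) (𝓝[>] 0) (𝓝 0) := by
      have := ENNReal.Tendsto.mul_const (b := volume K ^ (1 / p))
        ((ENNReal.continuous_ofReal.tendsto (0 : ℝ)).mono_left
          (nhdsWithin_le_nhds (s := Ioi 0))) (Or.inr hV)
      simpa using this
    obtain ⟨ε, h1, h2⟩ := ((ht.eventually (ge_mem_nhds he)).and self_mem_nhdsWithin).exists
    exact ⟨ε, h2, h1⟩
  filter_upwards [hmain ε hε] with N hN using hN.trans hεe

/-- Mollifications converge in `L^p`. -/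
theorem tendsto_eLpNorm_mollify_sub {p : ℝ} (hp : 1 < p) {d : E → ℝ}
    (hd : MemLp d (ENNReal.ofReal p)) :
    Tendsto (fun N => eLpNorm (mollify N d - d) (ENNReal.ofReal p) volume) atTop (𝓝 0) := by
  have hp1 : 1 ≤ ENNReal.ofReal p := by rw [ENNReal.one_le_ofReal]; exact hp.le
  rw [ENNReal.tendsto_nhds_zero]
  intro e he
  rcases eq_or_ne e ⊤ with rfl | htop
  · exact Eventually.of_forall fun _ => le_top
  -- The error is split into `mollify N (d - c)`, `mollify N c - c` and `d - c`, with `c` continuous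
  -- of compact support; the first piece is no larger than the third in norm.
  obtain ⟨c, hcs, hce, hcc, hcm⟩ := hd.exists_hasCompactSupport_eLpNorm_sub_le
    ENNReal.ofReal_ne_top (ε := e / 3) (by simp [he.ne'])
  have h3 : 0 < e / 3 := ENNReal.div_pos he.ne' (by simp)
  filter_upwards [(ENNReal.tendsto_nhds_zero.1
    (tendsto_eLpNorm_mollify_sub_of_continuous hp hcc hcs)) (e / 3) h3] with N hN
  have hdl : LocallyIntegrable d := hd.locallyIntegrable hp1
  have hcl : LocallyIntegrable c := hcm.locallyIntegrable hp1
  have hm : ∀ f : E → ℝ, LocallyIntegrable f → AEStronglyMeasurable (mollify N f) volume :=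
    fun f hf => (contDiff_mollify N hf).continuous.aestronglyMeasurable
  have e1 : mollify N d - d = mollify N (d - c) + (mollify N c - c) - (d - c) := by
    rw [mollify_sub N hdl hcl]; abel
  rw [e1]
  have h4 := eLpNorm_sub_le (((hm _ (hdl.sub hcl))).add ((hm c hcl).sub hcm.1))
    (hd.1.sub hcm.1) hp1
  have h5 := eLpNorm_add_le (hm _ (hdl.sub hcl)) ((hm c hcl).sub hcm.1) hp1
  have h6 := eLpNorm_mollify_le hp (hd.1.sub hcm.1) N
  refine h4.trans ((add_le_add h5 le_rfl).trans ?_)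
  refine (add_le_add (add_le_add (h6.trans hce) hN) hce).trans (le_of_eq ?_)
  rw [ENNReal.add_thirds]

/-- The derivative of a mollification is the mollification of the weak derivative. -/
lemma fderiv_mollify_indicator {Ω K : Set E} (hK : IsCompact K) (hKΩ : K ⊆ Ω) {g d : E → ℝ} {w : E}
    (hg : IntegrableOn g K)
    (hweak : ∀ η : E → ℝ, ContDiff ℝ ∞ η → HasCompactSupport η → tsupport η ⊆ Ω →
      ∫ y in Ω, g y * fderiv ℝ η y w = -∫ y in Ω, d y * η y)
    (hΩ : MeasurableSet Ω) {N : ℕ} {x : E}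
    (hx : Metric.closedBall x (mollifier E N).rOut ⊆ K) :
    fderiv ℝ (mollify N (K.indicator g)) x w = mollify N (K.indicator d) x := by
  set ρ : E → ℝ := (mollifier E N).normed volume with hρ
  have hρs : HasCompactSupport ρ := (mollifier E N).hasCompactSupport_normed
  have hρc : ContDiff ℝ ∞ ρ := (mollifier E N).contDiff_normed
  have hgi : Integrable (K.indicator g) := (integrable_indicator_iff hK.measurableSet).2 hg
  -- The reflected mollifier centred at `x` is an admissible test function because its support lies
  -- in `K`. The sign produced by the reflection cancels the one in the weak derivative.
  set ζ : E → ℝ := fun t => ρ (x - t) with hζ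
  have hts : tsupport ζ ⊆ K := by
    refine Subset.trans (closure_minimal ?_ Metric.isClosed_closedBall) hx
    intro t ht
    have h1 : x - t ∈ Function.support ρ := ht
    rw [hρ, (mollifier E N).support_normed_eq, Metric.mem_ball, dist_zero_right] at h1
    rw [Metric.mem_closedBall, dist_comm, dist_eq_norm]; exact h1.le
  have hζs : HasCompactSupport ζ := hK.of_isClosed_subset (isClosed_tsupport _) hts
  have hζc : ContDiff ℝ ∞ ζ := hρc.comp (contDiff_const.sub contDiff_id)
  have hζd : ∀ t, fderiv ℝ ζ t w = -fderiv ℝ ρ (x - t) w := by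
    intro t
    have h1 : HasFDerivAt (fun s : E => x - s) (-ContinuousLinearMap.id ℝ E) t :=
      (hasFDerivAt_id t).const_sub x
    have h2 := ((hρc.differentiable (by simp)) (x - t)).hasFDerivAt.comp t h1
    have h3 : HasFDerivAt ζ _ t := h2
    rw [h3.fderiv]; simp
  have hzero : ∀ t, t ∉ K → ζ t = 0 := fun t ht => image_eq_zero_of_notMem_tsupport fun h => ht (hts h)
  have hzero' : ∀ t, t ∉ K → fderiv ℝ ζ t = 0 := fun t ht =>
    image_eq_zero_of_notMem_tsupport fun h => ht (hts (tsupport_fderiv_subset ℝ h))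
  have h1 := hweak ζ hζc hζs (hts.trans hKΩ)
  have e1 : ∫ y in Ω, g y * fderiv ℝ ζ y w = ∫ y, K.indicator g y * fderiv ℝ ζ y w := by
    rw [← integral_indicator hΩ]
    refine integral_congr_ae (Eventually.of_forall fun y => ?_)
    by_cases hy : y ∈ K
    · simp [hy, hKΩ hy]
    · simp [indicator, hzero' y hy]
  have e2 : ∫ y in Ω, d y * ζ y = ∫ y, K.indicator d y * ζ y := by
    rw [← integral_indicator hΩ]
    refine integral_congr_ae (Eventually.of_forall fun y => ?_)
    by_cases hy : y ∈ K
    · simp [hy, hKΩ hy]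
    · simp [indicator, hzero y hy]
  rw [e1, e2] at h1
  have hder := hρs.hasFDerivAt_convolution_left (ContinuousLinearMap.lsmul ℝ ℝ)
    (hρc.of_le (by simp)) hgi.locallyIntegrable x (μ := volume)
  have h2 : HasFDerivAt (mollify N (K.indicator g)) _ x := hder
  rw [h2.fderiv]
  have hint : Integrable (fun t => ContinuousLinearMap.precompL E
      (ContinuousLinearMap.lsmul ℝ ℝ : ℝ →L[ℝ] ℝ →L[ℝ] ℝ) (fderiv ℝ ρ t)
      (K.indicator g (x - t))) :=
    (hρs.fderiv ℝ).convolutionExists_left _ (hρc.continuous_fderiv (by simp))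
      hgi.locallyIntegrable x
  rw [convolution_def, ContinuousLinearMap.integral_apply hint]
  simp only [ContinuousLinearMap.precompL_apply, ContinuousLinearMap.lsmul_apply, smul_eq_mul]
  rw [mollify_apply, ← integral_sub_left_eq_self _ volume x]
  rw [← integral_sub_left_eq_self (fun t => (mollifier E N).normed volume t * _) volume x]
  simp only [sub_sub_cancel]
  have e3 : ∫ t, fderiv ℝ ρ (x - t) w * K.indicator g t =
      -∫ y, K.indicator g y * fderiv ℝ ζ y w := by
    rw [← integral_neg]
    refine integral_congr_ae (Eventually.of_forall fun y => ?_)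
    simp only [hζd]; ring
  rw [e3, h1, neg_neg]
  exact integral_congr_ae (Eventually.of_forall fun y => mul_comm _ _)

/-- A one-sided Lipschitz bound in the direction `w` passes to the derivative of the
mollification. -/
lemma abs_fderiv_mollify_le {K : Set E} {g : E → ℝ} {w x : E} {N : ℕ} {C τ : ℝ} (hτ : 0 < τ)
    (hK : MeasurableSet K) (hg : IntegrableOn g K)
    (hC : ∀ z ∈ Metric.ball x (mollifier E N).rOut, ∀ s ∈ Ioo 0 τ,
      z ∈ K ∧ z + s • w ∈ K ∧ |g (z + s • w) - g z| ≤ C * s) :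
    |fderiv ℝ (mollify N (K.indicator g)) x w| ≤ C := by
  have hgi : LocallyIntegrable (K.indicator g) :=
    ((integrable_indicator_iff hK).2 hg).locallyIntegrable
  have hd : HasDerivAt (fun s : ℝ => mollify N (K.indicator g) (x + s • w))
      (fderiv ℝ (mollify N (K.indicator g)) x w) 0 := by
    have h1 : HasFDerivAt (mollify N (K.indicator g)) (fderiv ℝ (mollify N (K.indicator g)) x)
        (x + (0 : ℝ) • w) := by
      simpa using ((contDiff_mollify N hgi).differentiable (by simp) x).hasFDerivAt
    have h2 : HasDerivAt (fun s : ℝ => x + s • w) w 0 := by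
      simpa using ((hasDerivAt_id (0 : ℝ)).smul_const w).const_add x
    exact h1.comp_hasDerivAt 0 h2
  -- The mollification is differentiable, so right difference quotients suffice; each of them is an
  -- average of difference quotients of `g`.
  have h3 := (hasDerivAt_iff_tendsto_slope.1 hd).mono_left
    (nhdsWithin_mono 0 (show Ioi (0 : ℝ) ⊆ {0}ᶜ from fun s hs => ne_of_gt hs))
  refine le_of_tendsto h3.abs ?_
  filter_upwards [Ioo_mem_nhdsGT hτ] with s hs
  rw [slope_def_field, sub_zero, zero_smul, add_zero, abs_div, abs_of_pos hs.1,
    div_le_iff₀ hs.1]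
  have e : ∀ y, Integrable
      (fun t => (mollifier E N).normed volume t * K.indicator g (y - t)) := fun y =>
    (mollifier E N).hasCompactSupport_normed.convolutionExists_left
      (ContinuousLinearMap.lsmul ℝ ℝ) (mollifier E N).continuous_normed hgi y
  rw [mollify_apply, mollify_apply, ← integral_sub (e _) (e _)]
  have h1 : ‖∫ t, ((mollifier E N).normed volume t * K.indicator g (x + s • w - t) -
      (mollifier E N).normed volume t * K.indicator g (x - t))‖ ≤
      ∫ t, (mollifier E N).normed volume t * (C * s) := by
    refine norm_integral_le_of_norm_le ((mollifier E N).integrable_normed.mul_const _)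
      (Eventually.of_forall fun t => ?_)
    by_cases ht : t ∈ Metric.ball (0 : E) (mollifier E N).rOut
    · rw [← mul_sub, norm_mul, Real.norm_of_nonneg ((mollifier E N).nonneg_normed t)]
      refine mul_le_mul_of_nonneg_left ?_ ((mollifier E N).nonneg_normed t)
      obtain ⟨h1, h2, h3⟩ := hC (x - t) (by simpa [dist_eq_norm] using ht) s hs
      rw [show x + s • w - t = x - t + s • w by abel, indicator_of_mem h1, indicator_of_mem h2]
      exact h3
    · have : (mollifier E N).normed volume t = 0 := by
        rwa [← Function.notMem_support, (mollifier E N).support_normed_eq]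
      simp [this]
  rwa [integral_mul_const, (mollifier E N).integral_normed, one_mul] at h1

end Mollification

/-! ### The local test in Euclidean coordinates. -/

section LocalEstimate

variable {E : Type*} [NormedAddCommGroup E] [InnerProductSpace ℝ E] [FiniteDimensional ℝ E]
  [MeasurableSpace E] [BorelSpace E]

/-- `∫ c_N A e_N → 0` when `A ∈ L^{p'}`, `e_N → 0` in `L^p` and `c_N` is bounded. -/
lemma tendsto_integral_mul_mul_zero {α : Type*} [MeasurableSpace α] {μ : Measure α} {P P' : ℝ≥0∞}
    [ENNReal.HolderConjugate P' P] {A : α → ℝ} (hA : MemLp A P' μ) {e c : ℕ → α → ℝ}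
    (he : ∀ N, AEStronglyMeasurable (e N) μ)
    (hlim : Tendsto (fun N => eLpNorm (e N) P μ) atTop (𝓝 0))
    {C : ℝ} (hc : ∀ N x, |c N x| ≤ C) :
    Tendsto (fun N => ∫ x, c N x * (A x * e N x) ∂μ) atTop (𝓝 0) := by
  rw [tendsto_zero_iff_enorm_tendsto_zero]
  have h1 : ∀ N, ‖∫ x, c N x * (A x * e N x) ∂μ‖ₑ ≤
      ENNReal.ofReal C * (eLpNorm A P' μ * eLpNorm (e N) P μ) := by
    intro N
    have h2 := eLpNorm_smul_le_mul_eLpNorm (r := 1) (p := P') (q := P) (he N) hA.1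
    rw [eLpNorm_one_eq_lintegral_enorm] at h2
    calc ‖∫ x, c N x * (A x * e N x) ∂μ‖ₑ ≤ ∫⁻ x, ‖c N x * (A x * e N x)‖ₑ ∂μ :=
          enorm_integral_le_lintegral_enorm _
      _ ≤ ∫⁻ x, ENNReal.ofReal C * ‖(A • e N) x‖ₑ ∂μ := by
          refine lintegral_mono fun x => ?_
          rw [enorm_mul]
          refine mul_le_mul_left ?_ _
          rw [← ofReal_norm]
          exact ENNReal.ofReal_le_ofReal (hc N x)
      _ = ENNReal.ofReal C * ∫⁻ x, ‖(A • e N) x‖ₑ ∂μ :=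
          lintegral_const_mul' _ _ ENNReal.ofReal_ne_top
      _ ≤ _ := mul_le_mul_right h2 _
  refine tendsto_of_tendsto_of_tendsto_of_le_of_le tendsto_const_nhds ?_ (fun _ => zero_le) h1
  have h2 := ENNReal.Tendsto.const_mul (a := eLpNorm A P' μ) hlim (Or.inr hA.2.ne)
  have h3 := ENNReal.Tendsto.const_mul (a := ENNReal.ofReal C) h2 (Or.inr ENNReal.ofReal_ne_top)
  simpa using h3

/-- A compactly supported test of a divergence-form equation by `κ θ(v) η`, where `v` has weak
derivatives `d j` and `η` is only continuous, with `|∑ A j ∂_j η| ≤ a`. -/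
theorem abs_integral_test_le {ι : Type*} [Fintype ι] {b : ι → E} {Ω : Set E} (hΩ : IsOpen Ω)
    {p p' : ℝ} (hpp : p.HolderConjugate p')
    {f v : E → ℝ} {A d : ι → E → ℝ}
    (hf : ∀ K, IsCompact K → K ⊆ Ω → IntegrableOn f K)
    (hA : ∀ j K, IsCompact K → K ⊆ Ω → MemLp (A j) (ENNReal.ofReal p') (volume.restrict K))
    (heq : ∀ ζ : E → ℝ, ContDiff ℝ ∞ ζ → HasCompactSupport ζ → tsupport ζ ⊆ Ω →
      ∫ y in Ω, f y * ζ y = -∫ y in Ω, ∑ j, A j y * fderiv ℝ ζ y (b j))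
    (hv : ∀ K, IsCompact K → K ⊆ Ω → IntegrableOn v K)
    (hd : ∀ j K, IsCompact K → K ⊆ Ω → MemLp (d j) (ENNReal.ofReal p) (volume.restrict K))
    (hweak : ∀ j, ∀ ζ : E → ℝ, ContDiff ℝ ∞ ζ → HasCompactSupport ζ → tsupport ζ ⊆ Ω →
      ∫ y in Ω, v y * fderiv ℝ ζ y (b j) = -∫ y in Ω, d j y * ζ y)
    {κ : E → ℝ} (hκ : ContDiff ℝ ∞ κ) (hκs : HasCompactSupport κ) (hκΩ : tsupport κ ⊆ Ω)
    (hκ0 : ∀ y, 0 ≤ κ y)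
    {θ : ℝ → ℝ} (hθ : ContDiff ℝ ∞ θ) {C : ℝ} (hθC : ∀ s, |θ s| ≤ C) (hθC' : ∀ s, |deriv θ s| ≤ C)
    {η : E → ℝ} (hη : ContinuousOn η Ω) (hη1 : ∀ y, |η y| ≤ 1)
    {a : E → ℝ} (ha : IntegrableOn a (tsupport κ))
    {K : Set E} (hK : IsCompact K) (hKΩ : K ⊆ Ω) (hκK : tsupport κ ⊆ interior K)
    (hgrad : ∀ᶠ N in atTop, ∀ y ∈ tsupport κ,
      |∑ j, A j y * fderiv ℝ (mollify N (K.indicator η)) y (b j)| ≤ a y) :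
    IntegrableOn (fun y => f y * (κ y * θ (v y) * η y) + ∑ j, A j y *
        (fderiv ℝ κ y (b j) * θ (v y) * η y + κ y * (deriv θ (v y) * d j y) * η y)) Ω ∧
    |∫ y in Ω, (f y * (κ y * θ (v y) * η y) + ∑ j, A j y *
        (fderiv ℝ κ y (b j) * θ (v y) * η y + κ y * (deriv θ (v y) * d j y) * η y))| ≤
      ∫ y in Ω, κ y * |θ (v y)| * a y := by
  -- The smooth test function is `κ * θ (h N) * e N`, where `h N` and `e N` mollify `v` and `η`. The
  -- term in which `e N` is differentiated is only estimated, through `hgrad`, so `η` needs no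
  -- derivative; the other terms converge.
  set S := tsupport κ with hS
  have hSc : IsCompact S := hκs
  have hSm : MeasurableSet S := hSc.measurableSet
  have hSK : S ⊆ K := hκK.trans interior_subset
  have hC0 : 0 ≤ C := (abs_nonneg _).trans (hθC 0)
  have hp1 := hpp.lt
  have hp'1 := hpp.symm.lt
  have : ENNReal.HolderConjugate (ENNReal.ofReal p') (ENNReal.ofReal p) := by
    have := hpp.symm.ennrealOfReal
    exact this
  have one_le : ∀ s : ℝ, 1 < s → 1 ≤ ENNReal.ofReal s := fun s hs => by
    rw [ENNReal.one_le_ofReal]; exact hs.le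
  -- the mollified objects
  have hvi : Integrable (K.indicator v) :=
    (integrable_indicator_iff hK.measurableSet).2 (hv K hK hKΩ)
  have hηi : Integrable (K.indicator η) :=
    (integrable_indicator_iff hK.measurableSet).2 ((hη.mono hKΩ).integrableOn_compact hK)
  have hdm : ∀ j, MemLp (K.indicator (d j)) (ENNReal.ofReal p) := fun j =>
    (memLp_indicator_iff_restrict hK.measurableSet).2 (hd j K hK hKΩ)
  have hdl : ∀ j, LocallyIntegrable (K.indicator (d j)) := fun j =>
    (hdm j).locallyIntegrable (one_le p hp1)
  set h : ℕ → E → ℝ := fun N => mollify N (K.indicator v) with hh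
  set e : ℕ → E → ℝ := fun N => mollify N (K.indicator η) with he
  set D : ℕ → ι → E → ℝ := fun N j => mollify N (K.indicator (d j)) with hD
  have hhc : ∀ N, ContDiff ℝ ∞ (h N) := fun N => contDiff_mollify N hvi.locallyIntegrable
  have hec : ∀ N, ContDiff ℝ ∞ (e N) := fun N => contDiff_mollify N hηi.locallyIntegrable
  have hDc : ∀ N j, ContDiff ℝ ∞ (D N j) := fun N j => contDiff_mollify N (hdl j)
  have he1 : ∀ N y, |e N y| ≤ 1 := fun N y => by
    refine abs_mollify_le (fun x => ?_) N y
    by_cases hx : x ∈ K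
    · rw [indicator_of_mem hx]; exact hη1 x
    · simp [indicator_of_notMem hx]
  have hκ1 : ∃ Cκ, 0 ≤ Cκ ∧ ∀ y, |κ y| ≤ Cκ := by
    obtain ⟨c, hc⟩ := hκs.exists_bound_of_continuous hκ.continuous
    exact ⟨c, (norm_nonneg _).trans (hc 0), hc⟩
  obtain ⟨Cκ, hCκ0, hCκ⟩ := hκ1
  have hκd : ∃ Cd, 0 ≤ Cd ∧ ∀ j y, |fderiv ℝ κ y (b j)| ≤ Cd := by
    obtain ⟨c, hc⟩ := (hκs.fderiv ℝ).exists_bound_of_continuous (hκ.continuous_fderiv (by simp))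
    refine ⟨c * ∑ j, ‖b j‖, mul_nonneg ((norm_nonneg _).trans (hc 0))
      (Finset.sum_nonneg fun j _ => norm_nonneg _), fun j y => ?_⟩
    refine ((fderiv ℝ κ y).le_opNorm (b j)).trans (mul_le_mul (hc y) ?_ (norm_nonneg _)
      ((norm_nonneg _).trans (hc 0)))
    exact Finset.single_le_sum (f := fun j => ‖b j‖) (fun j _ => norm_nonneg _) (Finset.mem_univ j)
  obtain ⟨Cd, hCd0, hCd⟩ := hκd
  have hκz : ∀ y, y ∉ S → κ y = 0 := fun y hy => image_eq_zero_of_notMem_tsupport hy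
  have hκz' : ∀ y, y ∉ S → fderiv ℝ κ y = 0 := fun y hy =>
    image_eq_zero_of_notMem_tsupport fun h => hy (tsupport_fderiv_subset ℝ h)
  have toS : ∀ F : E → ℝ, (∀ y, y ∉ S → F y = 0) → ∫ y in Ω, F y = ∫ y in S, F y := fun F hF =>
    (setIntegral_eq_of_subset_of_forall_sdiff_eq_zero hΩ.measurableSet hκΩ
      fun y hy => hF y hy.2)
  have hhae : ∀ᵐ y ∂volume.restrict S, Tendsto (fun N => h N y) atTop (𝓝 (v y)) := by
    rw [ae_restrict_iff' hSm]
    filter_upwards [ae_tendsto_mollify hvi.locallyIntegrable] with y hy hyS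
    rwa [indicator_of_mem (hSK hyS)] at hy
  have heae : ∀ᵐ y ∂volume.restrict S, Tendsto (fun N => e N y) atTop (𝓝 (η y)) := by
    rw [ae_restrict_iff' hSm]
    filter_upwards [ae_tendsto_mollify hηi.locallyIntegrable] with y hy hyS
    rwa [indicator_of_mem (hSK hyS)] at hy
  -- eventually the balls are inside `K`
  have hball : ∀ᶠ N in atTop, ∀ y ∈ S, Metric.closedBall y (mollifier E N).rOut ⊆ K := by
    obtain ⟨r, hr, hrK⟩ := hSc.exists_cthickening_subset_open isOpen_interior hκK
    filter_upwards [(tendsto_mollifier_rOut (E := E)).eventually (ge_mem_nhds hr)] with N hN y hy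
    refine (Metric.closedBall_subset_closedBall hN).trans (Subset.trans ?_
      (hrK.trans interior_subset))
    exact Metric.closedBall_subset_cthickening hy r
  -- integrability on `S`
  have hfS : IntegrableOn f S := hf S hSc hκΩ
  have hAS : ∀ j, MemLp (A j) (ENNReal.ofReal p') (volume.restrict S) := fun j => hA j S hSc hκΩ
  have hdS : ∀ j, MemLp (d j) (ENNReal.ofReal p) (volume.restrict S) := fun j => hd j S hSc hκΩ
  have : IsFiniteMeasure (volume.restrict S) := ⟨by simpa using hSc.measure_lt_top⟩
  have hAi : ∀ j, Integrable (A j) (volume.restrict S) := fun j =>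
    (hAS j).integrable (one_le p' hp'1)
  have hAd : ∀ j, Integrable (fun y => A j y * d j y) (volume.restrict S) := fun j =>
    (hAS j).integrable_mul (hdS j)
  have hvS : AEStronglyMeasurable v (volume.restrict S) := (hv S hSc hκΩ).aestronglyMeasurable
  have hθc : Continuous θ := hθ.continuous
  have hθc' : Continuous (deriv θ) := hθ.continuous_deriv (by simp)
  have hκc : Continuous κ := hκ.continuous
  have hκdc : ∀ j, Continuous fun y => fderiv ℝ κ y (b j) := fun j =>
    (hκ.continuous_fderiv (by simp)).clm_apply continuous_const
  have hηS : AEStronglyMeasurable η (volume.restrict S) :=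
    ((hη.mono hκΩ).aestronglyMeasurable hSm)
  -- the limit of the principal part
  set Q : (E → ℝ) → (E → ℝ) → E → ℝ := fun g t y => f y * (κ y * θ (g y) * t y) + ∑ j, A j y *
        (fderiv ℝ κ y (b j) * θ (g y) * t y + κ y * (deriv θ (g y) * d j y) * t y) with hQ
  have hQm : ∀ g t : E → ℝ, AEStronglyMeasurable g (volume.restrict S) →
      AEStronglyMeasurable t (volume.restrict S) →
      AEStronglyMeasurable (Q g t) (volume.restrict S) := by
    intro g t hg ht
    have h1 := hθc.comp_aestronglyMeasurable hg
    have h2 := hθc'.comp_aestronglyMeasurable hg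
    refine (hfS.aestronglyMeasurable.mul ((hκc.aestronglyMeasurable.mul h1).mul ht)).add ?_
    refine Finset.aestronglyMeasurable_fun_sum _ fun j _ => ?_
    refine (hAS j).1.mul (AEStronglyMeasurable.add ?_ ?_)
    · exact ((hκdc j).aestronglyMeasurable.mul h1).mul ht
    · exact (hκc.aestronglyMeasurable.mul (h2.mul (hdS j).1)).mul ht
  -- `Q` contains the weak derivatives `d j` themselves and not their mollifications, so that one
  -- integrable function dominates it for all `N`. The discrepancy is treated separately, by
  -- convergence in `L^p`.
  set bd : E → ℝ := fun y => |f y| * (Cκ * C) + ∑ j, (|A j y| * (Cd * C) +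
    |A j y * d j y| * (Cκ * C)) with hbd
  have hbdi : Integrable bd (volume.restrict S) := by
    refine (hfS.abs.mul_const _).add (integrable_finsetSum _ fun j _ => ?_)
    exact ((hAi j).abs.mul_const _).add ((hAd j).abs.mul_const _)
  have hQbd : ∀ g t : E → ℝ, (∀ y, |t y| ≤ 1) → ∀ y, ‖Q g t y‖ ≤ bd y := by
    intro g t ht y
    have b1 : |κ y * θ (g y) * t y| ≤ Cκ * C := by
      rw [abs_mul, abs_mul]
      calc |κ y| * |θ (g y)| * |t y| ≤ |κ y| * |θ (g y)| * 1 :=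
            mul_le_mul_of_nonneg_left (ht y) (by positivity)
        _ ≤ Cκ * C := by
          rw [mul_one]; exact mul_le_mul (hCκ y) (hθC _) (abs_nonneg _) hCκ0
    rw [Real.norm_eq_abs]
    refine (abs_add_le _ _).trans (add_le_add ?_ ?_)
    · rw [abs_mul]; exact mul_le_mul_of_nonneg_left b1 (abs_nonneg _)
    · refine (Finset.abs_sum_le_sum_abs _ _).trans (Finset.sum_le_sum fun j _ => ?_)
      rw [mul_add]
      refine (abs_add_le _ _).trans (add_le_add ?_ ?_)
      · rw [abs_mul]
        refine mul_le_mul_of_nonneg_left ?_ (abs_nonneg _)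
        rw [abs_mul, abs_mul]
        calc |fderiv ℝ κ y (b j)| * |θ (g y)| * |t y| ≤ |fderiv ℝ κ y (b j)| * |θ (g y)| * 1 :=
              mul_le_mul_of_nonneg_left (ht y) (by positivity)
          _ ≤ Cd * C := by
            rw [mul_one]; exact mul_le_mul (hCd j y) (hθC _) (abs_nonneg _) hCd0
      · rw [show A j y * (κ y * (deriv θ (g y) * d j y) * t y) =
          (A j y * d j y) * (κ y * deriv θ (g y) * t y) by ring, abs_mul]
        refine mul_le_mul_of_nonneg_left ?_ (abs_nonneg _)
        rw [abs_mul, abs_mul]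
        calc |κ y| * |deriv θ (g y)| * |t y| ≤ |κ y| * |deriv θ (g y)| * 1 :=
              mul_le_mul_of_nonneg_left (ht y) (by positivity)
          _ ≤ Cκ * C := by
            rw [mul_one]; exact mul_le_mul (hCκ y) (hθC' _) (abs_nonneg _) hCκ0
  have hQlim : Tendsto (fun N => ∫ y in S, Q (h N) (e N) y) atTop (𝓝 (∫ y in S, Q v η y)) := by
    refine tendsto_integral_of_dominated_convergence bd (fun N => hQm _ _
      (hhc N).continuous.aestronglyMeasurable (hec N).continuous.aestronglyMeasurable) hbdi
      (fun N => Eventually.of_forall (hQbd _ _ (he1 N))) ?_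
    filter_upwards [hhae, heae] with y hy1 hy2
    have h1 := (hθc.tendsto _).comp hy1
    have h2 := (hθc'.tendsto _).comp hy1
    refine ((h1.const_mul (κ y)).mul hy2).const_mul (f y) |>.add (tendsto_finsetSum _ fun j _ => ?_)
    refine Tendsto.const_mul (A j y) (Tendsto.add ?_ ?_)
    · exact (h1.const_mul _).mul hy2
    · exact ((h2.mul_const _).const_mul _).mul hy2
  -- the error from mollifying the weak derivatives
  have hRlim : Tendsto (fun N => ∑ j, ∫ y in S,
      (κ y * deriv θ (h N y) * e N y) * (A j y * (D N j y - d j y))) atTop (𝓝 0) := by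
    rw [show (0 : ℝ) = ∑ _j : ι, (0 : ℝ) by simp]
    refine tendsto_finsetSum _ fun j _ => ?_
    refine tendsto_integral_mul_mul_zero (P := ENNReal.ofReal p) (hAS j)
      (e := fun N y => D N j y - d j y)
      (fun N => (hDc N j).continuous.aestronglyMeasurable.sub (hdS j).1) ?_
      (C := Cκ * C * 1) (fun N y => ?_)
    · refine tendsto_of_tendsto_of_tendsto_of_le_of_le tendsto_const_nhds
        (tendsto_eLpNorm_mollify_sub hp1 (hdm j)) (fun _ => zero_le) (fun N => ?_)
      refine le_trans (le_of_eq ?_) (eLpNorm_mono_measure _ (Measure.restrict_le_self (s := S)))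
      refine eLpNorm_congr_ae ?_
      rw [EventuallyEq, ae_restrict_iff' hSm]
      refine Eventually.of_forall fun y hy => ?_
      simp [hD, indicator_of_mem (hSK hy)]
    · rw [abs_mul, abs_mul]
      exact mul_le_mul (mul_le_mul (hCκ y) (hθC' _) (abs_nonneg _) hCκ0) (he1 N y) (abs_nonneg _)
        (mul_nonneg hCκ0 hC0)
  -- the right-hand side
  have hPlim : Tendsto (fun N => ∫ y in S, κ y * |θ (h N y)| * a y) atTop
      (𝓝 (∫ y in S, κ y * |θ (v y)| * a y)) := by
    refine tendsto_integral_of_dominated_convergence (fun y => (Cκ * C) * |a y|)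
      (fun N => ?_) (ha.abs.const_mul _) (fun N => Eventually.of_forall fun y => ?_) ?_
    · exact (hκc.aestronglyMeasurable.mul
        (hθc.abs.comp_aestronglyMeasurable (hhc N).continuous.aestronglyMeasurable)).mul ha.1
    · rw [norm_mul, norm_mul, Real.norm_eq_abs, Real.norm_eq_abs, Real.norm_eq_abs, abs_abs]
      exact mul_le_mul_of_nonneg_right (mul_le_mul (hCκ y) (hθC _) (abs_nonneg _) hCκ0)
        (abs_nonneg _)
    · filter_upwards [hhae] with y hy
      exact ((((hθc.tendsto _).comp hy).abs).const_mul _).mul_const _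
  refine ⟨IntegrableOn.of_forall_sdiff_eq_zero (s := S) ?_ hΩ.measurableSet fun y hy => by
    simp [hκz y hy.2, hκz' y hy.2], ?_⟩
  · refine hbdi.mono' (hQm v η ?_ hηS) (Eventually.of_forall (hQbd v η hη1))
    exact hvS
  rw [toS _ (fun y hy => by simp [hκz y hy, hκz' y hy]), toS _ (fun y hy => by simp [hκz y hy])]
  have hlim := (hQlim.add hRlim).abs
  rw [add_zero] at hlim
  refine le_of_tendsto_of_tendsto hlim hPlim ?_
  filter_upwards [hball, hgrad] with N hN hgN
  -- the test function
  set ζ : E → ℝ := fun y => κ y * θ (h N y) * e N y with hζ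
  have hζc : ContDiff ℝ ∞ ζ := (hκ.mul (hθ.comp (hhc N))).mul (hec N)
  have hζz : ∀ y, y ∉ S → ζ y = 0 := fun y hy => by simp [hζ, hκz y hy]
  have hζS : tsupport ζ ⊆ S := closure_minimal (fun y hy => by
    by_contra hyS; exact hy (hζz y hyS)) hSc.isClosed
  have hζs : HasCompactSupport ζ := hSc.of_isClosed_subset (isClosed_tsupport _) hζS
  have h0 := heq ζ hζc hζs (hζS.trans hκΩ)
  have hζz' : ∀ y, y ∉ S → fderiv ℝ ζ y = 0 := fun y hy =>
    image_eq_zero_of_notMem_tsupport fun h => hy (hζS (tsupport_fderiv_subset ℝ h))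
  rw [toS _ (fun y hy => by simp [hζz y hy]), toS _ (fun y hy => by simp [hζz' y hy]),
    eq_neg_iff_add_eq_zero, ← integral_add] at h0
  rotate_left
  · exact hfS.mul_continuousOn hζc.continuous.continuousOn hSc
  · refine integrable_finsetSum _ fun j _ => ?_
    exact IntegrableOn.mul_continuousOn (hAi j) (((hζc.continuous_fderiv (by simp)).clm_apply
      continuous_const).continuousOn) hSc
  have hζd : ∀ j, ∀ y ∈ S, fderiv ℝ ζ y (b j) =
      fderiv ℝ κ y (b j) * θ (h N y) * e N y + κ y * (deriv θ (h N y) * D N j y) * e N y +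
        κ y * θ (h N y) * fderiv ℝ (e N) y (b j) := by
    intro j y hy
    have d1 := (hκ.differentiable (by simp) y).hasFDerivAt
    have d2 := ((hθ.differentiable (by simp) (h N y)).hasDerivAt).comp_hasFDerivAt y
      ((hhc N).differentiable (by simp) y).hasFDerivAt
    have d3 := ((hec N).differentiable (by simp) y).hasFDerivAt
    have d4 : HasFDerivAt ζ _ y := (d1.mul d2).mul d3
    have d5 : fderiv ℝ (h N) y (b j) = D N j y :=
      fderiv_mollify_indicator hK hKΩ (hv K hK hKΩ) (hweak j) hΩ.measurableSet (hN y hy)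
    rw [d4.fderiv]
    simp only [add_apply, smul_apply, smul_eq_mul, d5,
      Function.comp_apply, Pi.mul_apply]
    ring
  set G : E → ℝ := fun y => ∑ j, A j y * fderiv ℝ (e N) y (b j) with hG
  -- The three pieces are the principal part, the error from the mollified weak derivatives, and the
  -- term with the gradient of `e N`. Their integrals add up to zero, so the third one bounds the
  -- first two.
  have hsplit : ∀ y ∈ S, f y * ζ y + ∑ j, A j y * fderiv ℝ ζ y (b j) =
      (Q (h N) (e N) y + ∑ j, (κ y * deriv θ (h N y) * e N y) * (A j y * (D N j y - d j y))) +
        κ y * θ (h N y) * G y := by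
    intro y hy
    simp only [hQ, hG, hζ, Finset.mul_sum, add_assoc, ← Finset.sum_add_distrib]
    congr 1
    refine Finset.sum_congr rfl fun j _ => ?_
    rw [hζd j y hy]; ring
  rw [setIntegral_congr_fun hSm hsplit] at h0
  have hQi : Integrable (Q (h N) (e N)) (volume.restrict S) :=
    hbdi.mono' (hQm _ _ (hhc N).continuous.aestronglyMeasurable
      (hec N).continuous.aestronglyMeasurable) (Eventually.of_forall (hQbd _ _ (he1 N)))
  have hRi : ∀ j, Integrable (fun y => (κ y * deriv θ (h N y) * e N y) *
      (A j y * (D N j y - d j y))) (volume.restrict S) := by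
    intro j
    have hDm : MemLp (fun y => D N j y - d j y) (ENNReal.ofReal p) (volume.restrict S) := by
      refine MemLp.sub ?_ (hdS j)
      obtain ⟨c, hc⟩ := hSc.exists_bound_of_continuousOn (hDc N j).continuous.continuousOn
      refine MemLp.of_bound (hDc N j).continuous.aestronglyMeasurable c ?_
      rw [ae_restrict_iff' hSm]
      exact Eventually.of_forall hc
    have h1 : Integrable (fun y => A j y * (D N j y - d j y)) (volume.restrict S) :=
      (hAS j).integrable_mul hDm
    refine h1.bdd_mul (c := Cκ * C * 1) ?_ (Eventually.of_forall fun y => ?_)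
    · exact ((hκc.mul (hθc'.comp (hhc N).continuous)).mul (hec N).continuous).aestronglyMeasurable
    · rw [Real.norm_eq_abs, abs_mul, abs_mul]
      exact mul_le_mul (mul_le_mul (hCκ y) (hθC' _) (abs_nonneg _) hCκ0) (he1 N y) (abs_nonneg _)
        (mul_nonneg hCκ0 hC0)
  have hGi : Integrable (fun y => κ y * θ (h N y) * G y) (volume.restrict S) := by
    refine Integrable.mono' (ha.abs.const_mul (Cκ * C)) ?_ ?_
    · refine (hκc.mul (hθc.comp (hhc N).continuous)).aestronglyMeasurable.mul ?_
      refine Finset.aestronglyMeasurable_fun_sum _ fun j _ => (hAS j).1.mul ?_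
      exact (((hec N).continuous_fderiv (by simp)).clm_apply
        continuous_const).aestronglyMeasurable
    · rw [ae_restrict_iff' hSm]
      refine Eventually.of_forall fun y hy => ?_
      rw [Real.norm_eq_abs, abs_mul, abs_mul]
      exact mul_le_mul (mul_le_mul (hCκ y) (hθC _) (abs_nonneg _) hCκ0)
        ((hgN y hy).trans (le_abs_self _)) (abs_nonneg _) (mul_nonneg hCκ0 hC0)
  have hRs := integrable_finsetSum (Finset.univ : Finset ι) fun j _ => hRi j
  rw [integral_add (f := fun y => Q (h N) (e N) y + ∑ j, (κ y * deriv θ (h N y) * e N y) *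
      (A j y * (D N j y - d j y))) (hQi.add hRs) hGi,
    integral_add hQi hRs, integral_finsetSum _ fun j _ => hRi j] at h0
  rw [eq_neg_of_add_eq_zero_left h0, abs_neg]
  refine (norm_integral_le_integral_norm _).trans (setIntegral_mono_on hGi.norm ?_ hSm ?_)
  · refine ha.bdd_mul (c := Cκ * C) (f := fun y => κ y * |θ (h N y)|) ?_
      (Eventually.of_forall fun y => ?_)
    · exact (hκc.mul (hθc.comp (hhc N).continuous).abs).aestronglyMeasurable
    · rw [norm_mul, Real.norm_eq_abs, Real.norm_eq_abs, abs_abs]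
      exact mul_le_mul (hCκ y) (hθC _) (abs_nonneg _) hCκ0
  · intro y hy
    rw [norm_mul, norm_mul, Real.norm_of_nonneg (hκ0 y)]
    exact mul_le_mul_of_nonneg_left (hgN y hy) (mul_nonneg (hκ0 y) (abs_nonneg _))

end LocalEstimate

/-! ### The coordinate frame and the metric in a chart. -/

section ChartGeometry

variable {n : ℕ} {M : Type*} [TopologicalSpace M] [ChartedSpace (EuclideanSpace ℝ (Fin n)) M]

lemma isOpen_chartTarget (x₀ : M) : IsOpen (extChartAt (𝓡 n) x₀).target :=
  isOpen_extChartAt_target x₀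

/-- The coordinates, in the chart around `x₀`, of a tangent vector at the point with coordinates
`y`. -/
noncomputable def chartCoord (x₀ : M) (y : EuclideanSpace ℝ (Fin n))
    (X : TangentSpace (𝓡 n) ((extChartAt (𝓡 n) x₀).symm y)) : EuclideanSpace ℝ (Fin n) :=
  mfderiv (𝓡 n) 𝓘(ℝ, EuclideanSpace ℝ (Fin n)) (extChartAt (𝓡 n) x₀)
    ((extChartAt (𝓡 n) x₀).symm y) X

lemma chartVec_smul (x₀ : M) (y : EuclideanSpace ℝ (Fin n)) (c : ℝ)
    (w : EuclideanSpace ℝ (Fin n)) :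
    chartVec x₀ y (c • w) = c • chartVec x₀ y w :=
  map_smul (mfderiv 𝓘(ℝ, EuclideanSpace ℝ (Fin n)) (𝓡 n) (extChartAt (𝓡 n) x₀).symm y) c w

lemma chartVec_sum {ι : Type*} (x₀ : M) (y : EuclideanSpace ℝ (Fin n)) (s : Finset ι) (c : ι → ℝ)
    (w : ι → EuclideanSpace ℝ (Fin n)) :
    chartVec x₀ y (∑ i ∈ s, c i • w i) = ∑ i ∈ s, c i • chartVec x₀ y (w i) := by
  have := map_sum (mfderiv 𝓘(ℝ, EuclideanSpace ℝ (Fin n)) (𝓡 n) (extChartAt (𝓡 n) x₀).symm y)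
    (fun i => c i • w i) s
  refine this.trans (Finset.sum_congr rfl fun i _ => chartVec_smul x₀ y (c i) (w i))

lemma sum_single_eq (w : EuclideanSpace ℝ (Fin n)) :
    ∑ i, w i • EuclideanSpace.single i (1 : ℝ) = w := by
  ext j
  simp [Finset.sum_apply, Pi.single_apply]

lemma chartVec_eq_sum (x₀ : M) (y w : EuclideanSpace ℝ (Fin n)) :
    chartVec x₀ y w = ∑ i, w i • chartVec x₀ y (EuclideanSpace.single i (1 : ℝ)) := by
  conv_lhs => rw [← sum_single_eq w]
  exact chartVec_sum x₀ y _ _ _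

variable [IsManifold (𝓡 n) ∞ M]

lemma contMDiffOn_chart_symm (x₀ : M) :
    ContMDiffOn 𝓘(ℝ, EuclideanSpace ℝ (Fin n)) (𝓡 n) ∞ (extChartAt (𝓡 n) x₀).symm
      (extChartAt (𝓡 n) x₀).target :=
  contMDiffOn_extChartAt_symm x₀

lemma mdifferentiableAt_chart_symm {x₀ : M} {y : EuclideanSpace ℝ (Fin n)}
    (hy : y ∈ (extChartAt (𝓡 n) x₀).target) :
    MDifferentiableAt 𝓘(ℝ, EuclideanSpace ℝ (Fin n)) (𝓡 n) (extChartAt (𝓡 n) x₀).symm y :=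
  ((contMDiffOn_chart_symm x₀).contMDiffAt
    ((isOpen_chartTarget x₀).mem_nhds hy)).mdifferentiableAt (by simp)

lemma chartVec_chartCoord {x₀ : M} {y : EuclideanSpace ℝ (Fin n)}
    (hy : y ∈ (extChartAt (𝓡 n) x₀).target)
    (X : TangentSpace (𝓡 n) ((extChartAt (𝓡 n) x₀).symm y)) :
    chartVec x₀ y (chartCoord x₀ y X) = X := by
  have h := mfderivWithin_extChartAt_symm_comp_mfderiv_extChartAt (I := 𝓡 n) (x := x₀) hy
  rw [mfderivWithin_of_mem_nhds (by simp)] at h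
  exact congrArg (fun L => L X) h

lemma chartCoord_chartVec {x₀ : M} {y : EuclideanSpace ℝ (Fin n)}
    (hy : y ∈ (extChartAt (𝓡 n) x₀).target) (w : EuclideanSpace ℝ (Fin n)) :
    chartCoord x₀ y (chartVec x₀ y w) = w := by
  have h := mfderiv_extChartAt_comp_mfderivWithin_extChartAt_symm (I := 𝓡 n) (x := x₀) hy
  rw [mfderivWithin_of_mem_nhds (by simp)] at h
  exact congrArg (fun L => L w) h

/-- The chain rule along a chart. -/
lemma fderiv_comp_chart_symm {x₀ : M} {y : EuclideanSpace ℝ (Fin n)}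
    (hy : y ∈ (extChartAt (𝓡 n) x₀).target) {ψ : M → ℝ}
    (hψ : MDifferentiableAt (𝓡 n) 𝓘(ℝ, ℝ) ψ ((extChartAt (𝓡 n) x₀).symm y))
    (w : EuclideanSpace ℝ (Fin n)) :
    fderiv ℝ (fun z => ψ ((extChartAt (𝓡 n) x₀).symm z)) y w =
      mfderiv (𝓡 n) 𝓘(ℝ, ℝ) ψ ((extChartAt (𝓡 n) x₀).symm y) (chartVec x₀ y w) := by
  have h := mfderiv_comp y hψ (mdifferentiableAt_chart_symm hy)
  rw [mfderiv_eq_fderiv] at h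
  exact congrArg (fun L => L w) h

variable [RiemannianBundle (fun x : M => TangentSpace (𝓡 n) x)]

lemma inner_gradient (ψ : M → ℝ) (x : M) (X : TangentSpace (𝓡 n) x) :
    inner ℝ (gradient n ψ x) X = mfderiv (𝓡 n) 𝓘(ℝ, ℝ) ψ x X := by
  unfold gradient
  have : FiniteDimensional ℝ (TangentSpace (𝓡 n) x) :=
    inferInstanceAs (FiniteDimensional ℝ (EuclideanSpace ℝ (Fin n)))
  have : CompleteSpace (TangentSpace (𝓡 n) x) := FiniteDimensional.complete ℝ _
  exact InnerProductSpace.toDual_symm_apply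

variable [IsContMDiffRiemannianBundle (𝓡 n) ∞ (EuclideanSpace ℝ (Fin n))
  (fun x : M => TangentSpace (𝓡 n) x)]

/-- A frame field is the tangent map of the inverse chart along a constant field, hence continuous
into the tangent bundle, and the metric is continuous there. -/
lemma continuousOn_inner_chartVec (x₀ : M) (v w : EuclideanSpace ℝ (Fin n)) :
    ContinuousOn (fun y => (inner ℝ (chartVec x₀ y v) (chartVec x₀ y w) : ℝ))
      (extChartAt (𝓡 n) x₀).target := by
  have h1 : ∀ w : EuclideanSpace ℝ (Fin n),
      ContMDiffOn 𝓘(ℝ, EuclideanSpace ℝ (Fin n)) ((𝓡 n).prod 𝓘(ℝ, EuclideanSpace ℝ (Fin n))) 0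
        (fun y => (⟨(extChartAt (𝓡 n) x₀).symm y, chartVec x₀ y w⟩ : TangentBundle (𝓡 n) M))
        (extChartAt (𝓡 n) x₀).target := by
    intro w
    have h2 := (contMDiffOn_chart_symm (n := n) x₀).contMDiffOn_tangentMapWithin
      (m := 0) (by simp) (isOpen_chartTarget x₀).uniqueMDiffOn
    have h3 : ContMDiffOn 𝓘(ℝ, EuclideanSpace ℝ (Fin n)) _ 0
        (fun y : EuclideanSpace ℝ (Fin n) =>
          (⟨y, w⟩ : TangentBundle 𝓘(ℝ, EuclideanSpace ℝ (Fin n)) (EuclideanSpace ℝ (Fin n))))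
        (extChartAt (𝓡 n) x₀).target :=
      contMDiffOn_vectorSpace_iff_contDiffOn.2 contDiffOn_const
    have h4 := h2.comp h3 (fun y hy => hy)
    refine h4.congr fun y hy => ?_
    simp only [tangentMapWithin, Function.comp_apply]
    rw [mfderivWithin_of_isOpen (isOpen_chartTarget x₀) hy]
    rfl
  have : IsContMDiffRiemannianBundle (𝓡 n) 0 (EuclideanSpace ℝ (Fin n))
      (fun x : M => TangentSpace (𝓡 n) x) := IsContMDiffRiemannianBundle.of_le (n := ∞) (by simp)
  exact ((h1 v).inner_bundle (E := fun x : M => TangentSpace (𝓡 n) x) (h1 w)).continuousOn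

omit [IsManifold (𝓡 n) ∞ M] [IsContMDiffRiemannianBundle (𝓡 n) ∞ (EuclideanSpace ℝ (Fin n))
  (fun x : M => TangentSpace (𝓡 n) x)] in
lemma inner_chartVec_eq_sum (x₀ : M) (y v w : EuclideanSpace ℝ (Fin n)) :
    (inner ℝ (chartVec x₀ y v) (chartVec x₀ y w) : ℝ) =
      ∑ i, ∑ j, v i * w j * metricMatrix x₀ y i j := by
  rw [chartVec_eq_sum x₀ y v, chartVec_eq_sum x₀ y w, sum_inner]
  refine Finset.sum_congr rfl fun i _ => ?_
  rw [inner_sum]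
  refine Finset.sum_congr rfl fun j _ => ?_
  rw [real_inner_smul_left, real_inner_smul_right, metricMatrix, Matrix.of_apply, mul_assoc]

/-- Continuity jointly in the point and the vector comes from writing the norm as the square root of
a quadratic form with continuous coefficients. -/
lemma continuousOn_norm_chartVec (x₀ : M) :
    ContinuousOn (fun p : EuclideanSpace ℝ (Fin n) × EuclideanSpace ℝ (Fin n) =>
      ‖chartVec x₀ p.1 p.2‖) ((extChartAt (𝓡 n) x₀).target ×ˢ univ) := by
  have h1 : (fun p : EuclideanSpace ℝ (Fin n) × EuclideanSpace ℝ (Fin n) =>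
      ‖chartVec x₀ p.1 p.2‖) = fun p =>
      √(∑ i, ∑ j, p.2 i * p.2 j * metricMatrix x₀ p.1 i j) := by
    ext p
    rw [← inner_chartVec_eq_sum, real_inner_self_eq_norm_sq, Real.sqrt_sq (norm_nonneg _)]
  rw [h1]
  refine ContinuousOn.sqrt ?_
  refine continuousOn_finsetSum _ fun i _ => continuousOn_finsetSum _ fun j _ => ?_
  refine ContinuousOn.mul (Continuous.continuousOn (by fun_prop)) ?_
  exact (continuousOn_inner_chartVec x₀ _ _).comp continuousOn_fst fun p hp => hp.1

omit [IsContMDiffRiemannianBundle (𝓡 n) ∞ (EuclideanSpace ℝ (Fin n))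
  (fun x : M => TangentSpace (𝓡 n) x)] in
lemma norm_chartVec_pos {x₀ : M} {y w : EuclideanSpace ℝ (Fin n)}
    (hy : y ∈ (extChartAt (𝓡 n) x₀).target) (hw : w ≠ 0) : 0 < ‖chartVec x₀ y w‖ := by
  rw [norm_pos_iff]
  intro h
  apply hw
  rw [← chartCoord_chartVec hy w, h]
  exact map_zero (mfderiv (𝓡 n) 𝓘(ℝ, EuclideanSpace ℝ (Fin n)) (extChartAt (𝓡 n) x₀)
    ((extChartAt (𝓡 n) x₀).symm y))

omit [IsManifold (𝓡 n) ∞ M] [IsContMDiffRiemannianBundle (𝓡 n) ∞ (EuclideanSpace ℝ (Fin n))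
  (fun x : M => TangentSpace (𝓡 n) x)] in
lemma norm_chartVec_eq (x₀ : M) (y w : EuclideanSpace ℝ (Fin n)) :
    ‖chartVec x₀ y w‖ = ‖w‖ * ‖chartVec x₀ y (‖w‖⁻¹ • w)‖ := by
  rcases eq_or_ne w 0 with rfl | hw
  · have h : chartVec x₀ y (0 : EuclideanSpace ℝ (Fin n)) = 0 :=
      map_zero (mfderiv 𝓘(ℝ, EuclideanSpace ℝ (Fin n)) (𝓡 n) (extChartAt (𝓡 n) x₀).symm y)
    rw [norm_zero, zero_mul, h]
    exact norm_zero
  · have h0 : ‖w‖ ≠ 0 := norm_ne_zero_iff.2 hw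
    rw [chartVec_smul, norm_smul, norm_inv, norm_norm, mul_inv_cancel_left₀ h0]

/-- On a compact subset of a chart, the metric is uniformly equivalent to the Euclidean one, and
varies by a factor of at most two on small balls. -/
lemma exists_norm_chartVec_bounds {x₀ : M} {K : Set (EuclideanSpace ℝ (Fin n))} (hK : IsCompact K)
    (hKΩ : K ⊆ (extChartAt (𝓡 n) x₀).target) :
    ∃ m C r : ℝ, 0 < m ∧ 0 < C ∧ 0 < r ∧
      (∀ y ∈ K, ∀ w, m * ‖w‖ ≤ ‖chartVec x₀ y w‖) ∧
      (∀ y ∈ K, ∀ w, ‖chartVec x₀ y w‖ ≤ C * ‖w‖) ∧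
      (∀ y ∈ K, ∀ z ∈ K, dist z y < r → ∀ w, ‖chartVec x₀ z w‖ ≤ 2 * ‖chartVec x₀ y w‖) := by
  -- By homogeneity only unit vectors matter, and `K ×ˢ Sp` is compact. Uniform continuity with
  -- tolerance `m`, a lower bound for the norm there, makes the norms of a unit vector at nearby
  -- points differ by less than the norm itself, hence the factor two.
  set Sp := Metric.sphere (0 : EuclideanSpace ℝ (Fin n)) 1 with hSp
  have hc : IsCompact (K ×ˢ Sp) := hK.prod (isCompact_sphere _ _)
  have hcont : ContinuousOn (fun p : EuclideanSpace ℝ (Fin n) × EuclideanSpace ℝ (Fin n) =>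
      ‖chartVec x₀ p.1 p.2‖) (K ×ˢ Sp) :=
    (continuousOn_norm_chartVec x₀).mono (prod_mono hKΩ (subset_univ _))
  have hunit : ∀ w : EuclideanSpace ℝ (Fin n), w ≠ 0 → ‖w‖⁻¹ • w ∈ Sp := fun w hw => by
    rw [hSp, mem_sphere_zero_iff_norm, norm_smul, norm_inv, norm_norm,
      inv_mul_cancel₀ (norm_ne_zero_iff.2 hw)]
  obtain ⟨m, hm, hmin⟩ := hc.exists_forall_le' hcont (a := 0) fun p hp =>
    norm_chartVec_pos (hKΩ hp.1) (by
      rintro h0; have := hp.2; rw [h0, hSp, mem_sphere_zero_iff_norm, norm_zero] at this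
      exact zero_ne_one this)
  obtain ⟨C, hC⟩ := hc.exists_bound_of_continuousOn hcont
  have huc := hc.uniformContinuousOn_of_continuous hcont
  obtain ⟨r, hr, hrm⟩ := Metric.uniformContinuousOn_iff.1 huc m hm
  refine ⟨m, max C 1, r, hm, lt_max_of_lt_right one_pos, hr, fun y hy w => ?_, fun y hy w => ?_,
    fun y hy z hz hzy w => ?_⟩ <;> rcases eq_or_ne w 0 with rfl | hw
  · rw [norm_zero, mul_zero]; exact norm_nonneg _
  · rw [norm_chartVec_eq, mul_comm]
    exact mul_le_mul_of_nonneg_left (hmin (y, ‖w‖⁻¹ • w) ⟨hy, hunit w hw⟩) (norm_nonneg _)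
  · rw [norm_chartVec_eq]; simp
  · rw [norm_chartVec_eq, mul_comm]
    refine mul_le_mul_of_nonneg_right (le_trans ?_ (le_max_left _ _)) (norm_nonneg _)
    exact (le_abs_self _).trans (hC (y, ‖w‖⁻¹ • w) ⟨hy, hunit w hw⟩)
  · rw [norm_chartVec_eq, norm_chartVec_eq x₀ y]; simp
  · rw [norm_chartVec_eq, norm_chartVec_eq x₀ y, mul_left_comm]
    refine mul_le_mul_of_nonneg_left ?_ (norm_nonneg _)
    have h1 := hrm (z, ‖w‖⁻¹ • w) ⟨hz, hunit w hw⟩ (y, ‖w‖⁻¹ • w) ⟨hy, hunit w hw⟩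
      (by
        rw [Prod.dist_eq, dist_self, max_eq_left dist_nonneg]; exact hzy)
    have h2 := hmin (y, ‖w‖⁻¹ • w) ⟨hy, hunit w hw⟩
    rw [Real.dist_eq] at h1
    have h3 := (abs_lt.1 h1).2
    simp only at h2 h3
    linarith

end ChartGeometry

/-! ### Lipschitz functions in a chart. -/

section Lipschitz

variable {n : ℕ} {M : Type*} [MetricSpace M] [ChartedSpace (EuclideanSpace ℝ (Fin n)) M]
  [IsManifold (𝓡 n) ∞ M] [RiemannianBundle (fun x : M => TangentSpace (𝓡 n) x)]

/-- The distance between the endpoints of a coordinate segment. -/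
lemma dist_chart_symm_le [IsRiemannianManifold (𝓡 n) M] {x₀ : M}
    {y w : EuclideanSpace ℝ (Fin n)} {C τ : ℝ} (hC : 0 ≤ C) (hτ : 0 ≤ τ)
    (h : ∀ t ∈ Icc 0 τ, y + t • w ∈ (extChartAt (𝓡 n) x₀).target ∧
      ‖chartVec x₀ (y + t • w) w‖ ≤ C) :
    dist ((extChartAt (𝓡 n) x₀).symm y) ((extChartAt (𝓡 n) x₀).symm (y + τ • w)) ≤ C * τ := by
  -- The distance is at most the length of the image of the segment, whose speed is at most `C`.
  set γ : ℝ → M := fun t => (extChartAt (𝓡 n) x₀).symm (y + t • w) with hγ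
  have hline : ContMDiff 𝓘(ℝ, ℝ) 𝓘(ℝ, EuclideanSpace ℝ (Fin n)) ∞ (fun t : ℝ => y + t • w) := by
    rw [contMDiff_iff_contDiff]; fun_prop
  have hγs : ContMDiffOn 𝓘(ℝ, ℝ) (𝓡 n) 1 γ (Icc 0 τ) :=
    (((contMDiffOn_chart_symm x₀).comp hline.contMDiffOn fun t ht => (h t ht).1)).of_le (by simp)
  have h1 := riemannianEDist_le_pathELength (I := 𝓡 n) hγs rfl rfl hτ
  rw [← IsRiemannianManifold.out, pathELength_eq_lintegral_mfderiv_Icc] at h1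
  have h2 : ∫⁻ t in Icc 0 τ, ‖mfderiv 𝓘(ℝ, ℝ) (𝓡 n) γ t 1‖ₑ ≤ ∫⁻ _ in Icc 0 τ, ENNReal.ofReal C := by
    refine setLIntegral_mono' measurableSet_Icc fun t ht => ?_
    have e : mfderiv 𝓘(ℝ, ℝ) (𝓡 n) γ t 1 = chartVec x₀ (y + t • w) w := by
      have h3 := mfderiv_comp t (mdifferentiableAt_chart_symm (h t ht).1)
        (hline.mdifferentiableAt (by simp))
      have h4 : fderiv ℝ (fun t : ℝ => y + t • w) t 1 = w := by
        have : HasFDerivAt (fun t : ℝ => y + t • w) ((ContinuousLinearMap.id ℝ ℝ).smulRight w) t :=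
          ((hasFDerivAt_id t).smul_const w).const_add y
        rw [this.fderiv]; simp
      have h5 := congrArg (fun L => L 1) h3
      refine h5.trans ?_
      rw [mfderiv_eq_fderiv]
      exact congrArg (chartVec x₀ (y + t • w)) h4
    rw [e, ← ofReal_norm]
    exact ENNReal.ofReal_le_ofReal (h t ht).2
  rw [lintegral_const, Measure.restrict_apply_univ, Real.volume_Icc, sub_zero,
    ← ENNReal.ofReal_mul hC] at h2
  have h3 := h1.trans h2
  rw [edist_dist, ENNReal.ofReal_le_ofReal_iff (by positivity)] at h3
  simpa [hγ] using h3

variable [IsContMDiffRiemannianBundle (𝓡 n) ∞ (EuclideanSpace ℝ (Fin n))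
  (fun x : M => TangentSpace (𝓡 n) x)]

/-- The gradient of a mollified Lipschitz function is bounded, up to a factor of two, by the
Lipschitz constant. -/
lemma eventually_abs_fderiv_mollify_le [IsRiemannianManifold (𝓡 n) M] {x₀ : M} {η : M → ℝ} {l : ℝ}
    (hl : 0 ≤ l) (hη : ∀ x y, |η x - η y| ≤ l * dist x y)
    {S K : Set (EuclideanSpace ℝ (Fin n))} (hS : IsCompact S) (hK : IsCompact K)
    (hSK : S ⊆ interior K) (hKΩ : K ⊆ (extChartAt (𝓡 n) x₀).target) :
    ∀ᶠ N in atTop, ∀ y ∈ S, ∀ w, |fderiv ℝ (mollify N (K.indicator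
      fun z => η ((extChartAt (𝓡 n) x₀).symm z))) y w| ≤ 2 * l * ‖chartVec x₀ y w‖ := by
  obtain ⟨m, C, r, hm, hC, hr, -, -, h2⟩ := exists_norm_chartVec_bounds hK hKΩ
  obtain ⟨r', hr', hrK⟩ := hS.exists_cthickening_subset_open isOpen_interior hSK
  -- The mollification radius and the displacement `s • w` both stay below `r₁`. All segments used
  -- are thus within `2 * r₁` of `y`: inside `K`, and where norms are at most twice those at `y`.
  set r₁ := min r r' / 2 with hr₁
  have hr₁0 : 0 < r₁ := by positivity
  have hηc : Continuous η := by
    refine continuous_iff_continuousAt.2 fun x => ?_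
    rw [ContinuousAt, tendsto_iff_dist_tendsto_zero]
    have : Tendsto (fun y => l * dist y x) (𝓝 x) (𝓝 0) := by
      have h : Continuous fun y => l * dist y x := by fun_prop
      simpa using h.tendsto x
    exact squeeze_zero (fun _ => dist_nonneg) (fun y => by rw [Real.dist_eq]; exact hη y x) this
  have hηi : IntegrableOn (fun z => η ((extChartAt (𝓡 n) x₀).symm z)) K :=
    ((hηc.comp_continuousOn (contMDiffOn_chart_symm x₀).continuousOn).mono hKΩ).integrableOn_compact
      hK
  filter_upwards [(tendsto_mollifier_rOut (E := EuclideanSpace ℝ (Fin n))).eventually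
    (gt_mem_nhds hr₁0)] with N hN y hy w
  have hyK : y ∈ K := interior_subset (hSK hy)
  have hw : 0 < ‖w‖ + 1 := by positivity
  -- The `+ 1` in the denominator covers `w = 0`.
  refine abs_fderiv_mollify_le (τ := r₁ / (‖w‖ + 1)) (by positivity) hK.measurableSet hηi ?_
  intro z hz s hs
  have hpt : ∀ t ∈ Icc 0 s, dist (z + t • w) y < 2 * r₁ := by
    intro t ht
    have h3 : dist (z + t • w) z < r₁ := by
      rw [dist_eq_norm, add_sub_cancel_left, norm_smul, Real.norm_of_nonneg ht.1]
      have h4 : t * ‖w‖ ≤ s * (‖w‖ + 1) :=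
        mul_le_mul ht.2 (by linarith) (norm_nonneg _) hs.1.le
      exact h4.trans_lt ((lt_div_iff₀ hw).1 hs.2)
    have h4 := dist_triangle (z + t • w) z y
    have h5 : dist z y < r₁ := (Metric.mem_ball.1 hz).trans hN
    linarith
  have hptK : ∀ t ∈ Icc 0 s, z + t • w ∈ K := by
    intro t ht
    refine interior_subset (hrK (Metric.mem_cthickening_of_dist_le _ y r' _ hy ?_))
    have := hpt t ht
    have h6 : 2 * r₁ ≤ r' := by rw [hr₁]; linarith [min_le_right r r']
    linarith
  have h0 := hptK 0 (left_mem_Icc.2 hs.1.le)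
  rw [zero_smul, add_zero] at h0
  refine ⟨h0, hptK s (right_mem_Icc.2 hs.1.le), (hη _ _).trans ?_⟩
  have h7 := dist_chart_symm_le (x₀ := x₀) (y := z) (w := w) (C := 2 * ‖chartVec x₀ y w‖) (τ := s)
    (by positivity) hs.1.le (fun t ht => ⟨hKΩ (hptK t ht), h2 y hyK _ (hptK t ht) (by
      have := hpt t ht
      have h6 : 2 * r₁ ≤ r := by rw [hr₁]; linarith [min_le_left r r']
      linarith) w⟩)
  rw [dist_comm]
  calc l * _ ≤ l * (2 * ‖chartVec x₀ y w‖ * s) := mul_le_mul_of_nonneg_left h7 hl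
    _ = _ := by ring

end Lipschitz

/-! ### The Riemannian and weighted volumes in charts. -/

section ChartMeasure

variable {n : ℕ} {M : Type*} [TopologicalSpace M] [ChartedSpace (EuclideanSpace ℝ (Fin n)) M]
  [IsManifold (𝓡 n) ∞ M] [RiemannianBundle (fun x : M => TangentSpace (𝓡 n) x)]

lemma metricMatrix_posDef {x₀ : M} {y : EuclideanSpace ℝ (Fin n)}
    (hy : y ∈ (extChartAt (𝓡 n) x₀).target) : (metricMatrix x₀ y).PosDef := by
  refine Matrix.PosDef.of_dotProduct_mulVec_pos ?_ fun x hx => ?_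
  · ext i j
    simp only [metricMatrix, Matrix.conjTranspose_apply, Matrix.of_apply, star_trivial]
    exact real_inner_comm _ _
  · have h1 := inner_chartVec_eq_sum x₀ y (WithLp.toLp 2 x) (WithLp.toLp 2 x)
    rw [real_inner_self_eq_norm_sq] at h1
    have h2 : star x ⬝ᵥ (metricMatrix x₀ y).mulVec x =
        ∑ i, ∑ j, x i * x j * metricMatrix x₀ y i j := by
      simp only [dotProduct, Matrix.mulVec, star_trivial, Finset.mul_sum]
      exact Finset.sum_congr rfl fun i _ => Finset.sum_congr rfl fun j _ => by ring
    rw [h2, ← h1]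
    refine pow_pos (norm_chartVec_pos hy ?_) 2
    intro h0
    apply hx
    simpa using congrArg (WithLp.ofLp) h0

/-- Every tangent space is the model space by definition, so a model vector has a meaning at both
points. The lemma is needed because the two expressions of one point in two charts are equal but not
definitionally so. -/
lemma inner_congr_point {x x' : M} (h : x = x') (v w : EuclideanSpace ℝ (Fin n)) :
    (inner ℝ (show TangentSpace (𝓡 n) x from v) (show TangentSpace (𝓡 n) x from w) : ℝ) =
      inner ℝ (show TangentSpace (𝓡 n) x' from v) (show TangentSpace (𝓡 n) x' from w) := by
  subst h; rfl

/-- The change of coordinates from the chart around `x₀` to the chart around `x₁`. -/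
noncomputable def chartTransition (x₀ x₁ : M) (y : EuclideanSpace ℝ (Fin n)) :
    EuclideanSpace ℝ (Fin n) :=
  extChartAt (𝓡 n) x₁ ((extChartAt (𝓡 n) x₀).symm y)

omit [RiemannianBundle (fun x : M => TangentSpace (𝓡 n) x)] in
lemma differentiableAt_chartTransition {x₀ x₁ : M} {y : EuclideanSpace ℝ (Fin n)}
    (hy : y ∈ (extChartAt (𝓡 n) x₀).target)
    (hy' : (extChartAt (𝓡 n) x₀).symm y ∈ (extChartAt (𝓡 n) x₁).source) :
    DifferentiableAt ℝ (chartTransition x₀ x₁) y := by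
  rw [← mdifferentiableAt_iff_differentiableAt]
  exact (mdifferentiableAt_extChartAt (by simpa using hy')).comp y
    (mdifferentiableAt_chart_symm hy)

omit [RiemannianBundle (fun x : M => TangentSpace (𝓡 n) x)] in
lemma chartVec_transition {x₀ x₁ : M} {y : EuclideanSpace ℝ (Fin n)}
    (hy : y ∈ (extChartAt (𝓡 n) x₀).target)
    (hy' : (extChartAt (𝓡 n) x₀).symm y ∈ (extChartAt (𝓡 n) x₁).source)
    (w : EuclideanSpace ℝ (Fin n)) :
    (chartVec x₀ y w : EuclideanSpace ℝ (Fin n)) =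
      (chartVec x₁ (chartTransition x₀ x₁ y) (fderiv ℝ (chartTransition x₀ x₁) y w) :
        EuclideanSpace ℝ (Fin n)) := by
  have hτ : chartTransition x₀ x₁ y ∈ (extChartAt (𝓡 n) x₁).target :=
    (extChartAt (𝓡 n) x₁).map_source hy'
  have h1 : (extChartAt (𝓡 n) x₀).symm =ᶠ[𝓝 y]
      (extChartAt (𝓡 n) x₁).symm ∘ chartTransition x₀ x₁ := by
    have hc : ContinuousAt (extChartAt (𝓡 n) x₀).symm y :=
      ((contMDiffOn_chart_symm x₀).continuousOn).continuousAt
        ((isOpen_chartTarget x₀).mem_nhds hy)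
    filter_upwards [hc.preimage_mem_nhds ((isOpen_extChartAt_source x₁).mem_nhds hy')] with z hz
    exact ((extChartAt (𝓡 n) x₁).left_inv hz).symm
  have h2 := h1.mfderiv_eq (I := 𝓘(ℝ, EuclideanSpace ℝ (Fin n))) (I' := 𝓡 n)
  have h3 := mfderiv_comp y (mdifferentiableAt_chart_symm hτ)
    (mdifferentiableAt_iff_differentiableAt.2 (differentiableAt_chartTransition hy hy'))
  have h4 := h2.trans h3
  rw [mfderiv_eq_fderiv] at h4
  exact congrArg (fun L => L w) h4

lemma metricMatrix_transition {x₀ x₁ : M} {y : EuclideanSpace ℝ (Fin n)}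
    (hy : y ∈ (extChartAt (𝓡 n) x₀).target)
    (hy' : (extChartAt (𝓡 n) x₀).symm y ∈ (extChartAt (𝓡 n) x₁).source) :
    √(metricMatrix x₀ y).det = |(fderiv ℝ (chartTransition x₀ x₁) y).det| *
      √(metricMatrix x₁ (chartTransition x₀ x₁ y)).det := by
  set τ := chartTransition (n := n) x₀ x₁ with hτ
  set J : Matrix (Fin n) (Fin n) ℝ :=
    LinearMap.toMatrix (EuclideanSpace.basisFun (Fin n) ℝ).toBasis
      (EuclideanSpace.basisFun (Fin n) ℝ).toBasis
      (fderiv ℝ τ y : EuclideanSpace ℝ (Fin n) →ₗ[ℝ] EuclideanSpace ℝ (Fin n)) with hJ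
  have hJd : (fderiv ℝ τ y).det = J.det := by
    rw [hJ, LinearMap.det_toMatrix]
  have hJe : ∀ i j, J i j = fderiv ℝ τ y (EuclideanSpace.single j 1) i := by
    intro i j
    rw [hJ, LinearMap.toMatrix_apply]
    simp
  have hpt : (extChartAt (𝓡 n) x₀).symm y = (extChartAt (𝓡 n) x₁).symm (τ y) :=
    ((extChartAt (𝓡 n) x₁).left_inv hy').symm
  -- Taking determinants turns this congruence into the Jacobian factor of the change of variables.
  have hG : metricMatrix x₀ y = J.transpose * metricMatrix x₁ (τ y) * J := by
    ext i j
    have h1 : metricMatrix x₀ y i j =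
        inner ℝ (chartVec x₁ (τ y) (fderiv ℝ τ y (EuclideanSpace.single i 1)))
          (chartVec x₁ (τ y) (fderiv ℝ τ y (EuclideanSpace.single j 1))) := by
      have e1 := chartVec_transition hy hy' (EuclideanSpace.single i (1 : ℝ))
      have e2 := chartVec_transition hy hy' (EuclideanSpace.single j (1 : ℝ))
      have e3 := inner_congr_point (n := n) hpt (chartVec x₀ y (EuclideanSpace.single i 1))
        (chartVec x₀ y (EuclideanSpace.single j 1))
      rw [metricMatrix, Matrix.of_apply]
      refine e3.trans ?_
      rw [e1, e2]
    rw [h1, inner_chartVec_eq_sum, Matrix.mul_apply]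
    simp only [Matrix.mul_apply, Matrix.transpose_apply, Finset.sum_mul, hJe]
    rw [Finset.sum_comm]
    exact Finset.sum_congr rfl fun k _ => Finset.sum_congr rfl fun l _ => by ring
  rw [hG, Matrix.det_mul, Matrix.det_mul, Matrix.det_transpose, hJd,
    show J.det * (metricMatrix x₁ (τ y)).det * J.det =
      J.det ^ 2 * (metricMatrix x₁ (τ y)).det by ring, Real.sqrt_mul (sq_nonneg _),
    Real.sqrt_sq_eq_abs]

variable [MeasurableSpace M] [BorelSpace M]

omit [RiemannianBundle (fun x : M => TangentSpace (𝓡 n) x)] in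
lemma aemeasurable_chart_symm (x₀ : M) :
    AEMeasurable (extChartAt (𝓡 n) x₀).symm (volume.restrict (extChartAt (𝓡 n) x₀).target) :=
  (contMDiffOn_chart_symm x₀).continuousOn.aemeasurable (isOpen_chartTarget x₀).measurableSet

lemma chartVolume_apply (x₀ : M) {S : Set M} (hS : MeasurableSet S) :
    chartVolume (n := n) x₀ S =
      ∫⁻ y in (extChartAt (𝓡 n) x₀).symm ⁻¹' S ∩ (extChartAt (𝓡 n) x₀).target,
        ENNReal.ofReal √(metricMatrix x₀ y).det := by
  rw [chartVolume, Measure.map_apply_of_aemeasurable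
    ((aemeasurable_chart_symm x₀).mono_ac (withDensity_absolutelyContinuous _ _)) hS,
    withDensity_apply', Measure.restrict_restrict' (isOpen_chartTarget x₀).measurableSet]

/-- The measures of two charts agree on the overlap of their domains. -/
lemma chartVolume_le {x₀ x₁ : M} {S : Set M} (hS : MeasurableSet S)
    (hS₀ : S ⊆ (extChartAt (𝓡 n) x₀).source) :
    chartVolume (n := n) x₁ S ≤ chartVolume (n := n) x₀ S := by
  rw [chartVolume_apply x₁ hS, chartVolume_apply x₀ hS]
  -- The part of `S` outside the chart around `x₁` carries no mass of `chartVolume x₁`, so only the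
  -- overlap `D` has to be transported by the change of variables.
  set D := (extChartAt (𝓡 n) x₀).target ∩
    (extChartAt (𝓡 n) x₀).symm ⁻¹' (S ∩ (extChartAt (𝓡 n) x₁).source) with hD
  have hDm : MeasurableSet D := by
    have hc : Measurable ((extChartAt (𝓡 n) x₀).target.domRestrict (extChartAt (𝓡 n) x₀).symm) :=
      (continuousOn_iff_continuous_domRestrict.1 (contMDiffOn_chart_symm x₀).continuousOn).measurable
    have h2 := hc (hS.inter (isOpen_extChartAt_source (I := 𝓡 n) x₁).measurableSet)
    have h3 := (MeasurableEmbedding.subtype_coe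
      (isOpen_chartTarget (n := n) x₀).measurableSet).measurableSet_image.2 h2
    convert h3 using 1
    ext y
    simp [hD, and_comm, and_assoc]
    exact fun h _ _ => h
  have himg : chartTransition x₀ x₁ '' D =
      (extChartAt (𝓡 n) x₁).symm ⁻¹' S ∩ (extChartAt (𝓡 n) x₁).target := by
    ext z
    constructor
    · rintro ⟨y, ⟨hy1, hy2, hy3⟩, rfl⟩
      refine ⟨?_, (extChartAt (𝓡 n) x₁).map_source hy3⟩
      rw [mem_preimage, chartTransition, (extChartAt (𝓡 n) x₁).left_inv hy3]
      exact hy2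
    · rintro ⟨hz1, hz2⟩
      refine ⟨extChartAt (𝓡 n) x₀ ((extChartAt (𝓡 n) x₁).symm z),
        ⟨(extChartAt (𝓡 n) x₀).map_source (hS₀ hz1), ?_⟩, ?_⟩
      · rw [mem_preimage, (extChartAt (𝓡 n) x₀).left_inv (hS₀ hz1)]
        exact ⟨hz1, (extChartAt (𝓡 n) x₁).map_target hz2⟩
      · rw [chartTransition, (extChartAt (𝓡 n) x₀).left_inv (hS₀ hz1),
          (extChartAt (𝓡 n) x₁).right_inv hz2]
  have hinj : InjOn (chartTransition x₀ x₁) D := by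
    intro y hy z hz h
    have h1 := (extChartAt (𝓡 n) x₁).injOn hy.2.2 hz.2.2 h
    exact (extChartAt (𝓡 n) x₀).symm.injOn hy.1 hz.1 h1
  rw [← himg, lintegral_image_eq_lintegral_abs_det_fderiv_mul volume hDm
    (fun y hy => ((differentiableAt_chartTransition hy.1 hy.2.2).hasFDerivAt).hasFDerivWithinAt)
    hinj]
  calc _ = ∫⁻ y in D, ENNReal.ofReal √(metricMatrix x₀ y).det := by
        refine setLIntegral_congr_fun hDm fun y hy => ?_
        rw [metricMatrix_transition hy.1 hy.2.2, ENNReal.ofReal_mul (abs_nonneg _)]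
    _ ≤ _ := lintegral_mono_set (show D ⊆ (extChartAt (𝓡 n) x₀).symm ⁻¹' S ∩
        (extChartAt (𝓡 n) x₀).target from fun y hy => ⟨hy.2.1, hy.1⟩)

/-- In the domain of a chart, the Riemannian volume is the volume of that chart. -/
lemma riemannianVolume_restrict_source (x₀ : M) :
    (riemannianVolume n M).restrict (extChartAt (𝓡 n) x₀).source = chartVolume (n := n) x₀ := by
  have hsm : MeasurableSet (extChartAt (𝓡 n) x₀).source :=
    (isOpen_extChartAt_source (I := 𝓡 n) x₀).measurableSet
  refine Measure.ext fun S hS => ?_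
  rw [Measure.restrict_apply hS]
  set T := S ∩ (extChartAt (𝓡 n) x₀).source with hT
  have hTm : MeasurableSet T := hS.inter hsm
  have e1 : chartVolume (n := n) x₀ S = chartVolume (n := n) x₀ T := by
    rw [chartVolume_apply x₀ hS, chartVolume_apply x₀ hTm]
    have : (extChartAt (𝓡 n) x₀).symm ⁻¹' S ∩ (extChartAt (𝓡 n) x₀).target =
        (extChartAt (𝓡 n) x₀).symm ⁻¹' T ∩ (extChartAt (𝓡 n) x₀).target := by
      ext y
      exact ⟨fun h => ⟨⟨h.1, (extChartAt (𝓡 n) x₀).map_target h.2⟩, h.2⟩, fun h => ⟨h.1.1, h.2⟩⟩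
    rw [this]
  rw [e1]
  refine le_antisymm ?_ ((le_iSup (fun x => chartVolume (n := n) x) x₀ : _) T)
  -- `ν` is above every chart volume: inside the source by the comparison on overlaps, outside
  -- because the supremum is. Hence the supremum is below `ν`, and on `T` only the first summand of
  -- `ν` counts.
  set ν : Measure M := chartVolume (n := n) x₀ +
    (riemannianVolume n M).restrict (extChartAt (𝓡 n) x₀).sourceᶜ with hν
  have h1 : riemannianVolume n M ≤ ν := by
    refine iSup_le fun x₁ => Measure.le_iff.2 fun A hA => ?_
    rw [← measure_inter_add_sdiff A hsm, hν, Measure.add_apply]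
    refine add_le_add ((chartVolume_le (hA.inter hsm) inter_subset_right).trans
      (measure_mono inter_subset_left)) ?_
    rw [Measure.restrict_apply hA]
    exact (le_iSup (fun x => chartVolume (n := n) x) x₁ : _) _
  refine (h1 T).trans (le_of_eq ?_)
  rw [hν, Measure.add_apply, Measure.restrict_apply hTm]
  have : T ∩ (extChartAt (𝓡 n) x₀).sourceᶜ = ∅ := by
    ext x; simp [hT]
  rw [this, measure_empty, add_zero]

/-- The density of the weighted volume in the chart around `x₀`. -/
noncomputable def chartDensity (φ : M → ℝ) (x₀ : M) (y : EuclideanSpace ℝ (Fin n)) : ℝ :=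
  √(metricMatrix x₀ y).det * Real.exp (-φ ((extChartAt (𝓡 n) x₀).symm y))

omit [MeasurableSpace M] [BorelSpace M] in
lemma chartDensity_pos (φ : M → ℝ) {x₀ : M} {y : EuclideanSpace ℝ (Fin n)}
    (hy : y ∈ (extChartAt (𝓡 n) x₀).target) : 0 < chartDensity φ x₀ y :=
  mul_pos (Real.sqrt_pos.2 (metricMatrix_posDef hy).det_pos) (Real.exp_pos _)

variable [IsContMDiffRiemannianBundle (𝓡 n) ∞ (EuclideanSpace ℝ (Fin n))
  (fun x : M => TangentSpace (𝓡 n) x)]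

omit [MeasurableSpace M] [BorelSpace M] in
lemma continuousOn_metricMatrix (x₀ : M) :
    ContinuousOn (metricMatrix (n := n) x₀) (extChartAt (𝓡 n) x₀).target :=
  continuousOn_pi.2 fun _ => continuousOn_pi.2 fun _ => continuousOn_inner_chartVec x₀ _ _

omit [MeasurableSpace M] [BorelSpace M] in
lemma continuousOn_sqrt_det (x₀ : M) :
    ContinuousOn (fun y => √(metricMatrix (n := n) x₀ y).det) (extChartAt (𝓡 n) x₀).target :=
  ((continuous_id.matrix_det).comp_continuousOn (continuousOn_metricMatrix x₀)).sqrt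

omit [MeasurableSpace M] [BorelSpace M] in
lemma continuousOn_chartDensity {φ : M → ℝ} (hφ : Continuous φ) (x₀ : M) :
    ContinuousOn (chartDensity (n := n) φ x₀) (extChartAt (𝓡 n) x₀).target :=
  (continuousOn_sqrt_det x₀).mul (Real.continuous_exp.comp_continuousOn
    (hφ.comp_continuousOn (contMDiffOn_chart_symm x₀).continuousOn).neg)

lemma aemeasurable_chartDensity {φ : M → ℝ} (hφ : Continuous φ) (x₀ : M) :
    AEMeasurable (fun y => ENNReal.ofReal (chartDensity (n := n) φ x₀ y))
      (volume.restrict (extChartAt (𝓡 n) x₀).target) :=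
  ((continuousOn_chartDensity hφ x₀).aemeasurable
    (isOpen_chartTarget x₀).measurableSet).ennreal_ofReal

/-- The weighted volume, in the coordinates of the chart around `x₀`. -/
noncomputable def chartMeasure (φ : M → ℝ) (x₀ : M) : Measure (EuclideanSpace ℝ (Fin n)) :=
  (volume.restrict (extChartAt (𝓡 n) x₀).target).withDensity
    fun y => ENNReal.ofReal (chartDensity φ x₀ y)

lemma aemeasurable_chart_symm_chartMeasure (φ : M → ℝ) (x₀ : M) :
    AEMeasurable (extChartAt (𝓡 n) x₀).symm (chartMeasure φ x₀) :=
  (aemeasurable_chart_symm x₀).mono_ac (withDensity_absolutelyContinuous _ _)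

theorem weightedVolume_restrict_source {φ : M → ℝ} (hφ : Continuous φ) (x₀ : M) :
    (weightedVolume n φ).restrict (extChartAt (𝓡 n) x₀).source =
      (chartMeasure φ x₀).map (extChartAt (𝓡 n) x₀).symm := by
  have hsm : MeasurableSet (extChartAt (𝓡 n) x₀).source :=
    (isOpen_extChartAt_source (I := 𝓡 n) x₀).measurableSet
  have hΩ := (isOpen_chartTarget (n := n) x₀).measurableSet
  have hφm : Measurable fun x => ENNReal.ofReal (Real.exp (-φ x)) :=
    (Real.continuous_exp.comp hφ.neg).measurable.ennreal_ofReal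
  rw [weightedVolume, restrict_withDensity hsm, riemannianVolume_restrict_source]
  refine Measure.ext fun S hS => ?_
  have hdm : AEMeasurable (fun y => ENNReal.ofReal √(metricMatrix (n := n) x₀ y).det)
      (volume.restrict (extChartAt (𝓡 n) x₀).target) :=
    ((continuousOn_sqrt_det x₀).aemeasurable hΩ).ennreal_ofReal
  have hae : AEMeasurable (extChartAt (𝓡 n) x₀).symm
      ((volume.restrict (extChartAt (𝓡 n) x₀).target).withDensity
        (fun y => ENNReal.ofReal √(metricMatrix x₀ y).det)) :=
    (aemeasurable_chart_symm x₀).mono_ac (withDensity_absolutelyContinuous _ _)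
  rw [withDensity_apply _ hS, chartVolume, Measure.restrict_map_of_aemeasurable hae hS,
    lintegral_map' hφm.aemeasurable (hae.mono_measure Measure.restrict_le_self),
    Measure.map_apply_of_aemeasurable (aemeasurable_chart_symm_chartMeasure φ x₀) hS,
    chartMeasure, withDensity_apply', restrict_withDensity',
    lintegral_withDensity_eq_lintegral_mul_non_measurable₀ _ (hdm.mono_measure
      Measure.restrict_le_self) (Eventually.of_forall fun _ => ENNReal.ofReal_lt_top)]
  refine lintegral_congr fun y => ?_
  rw [Pi.mul_apply, chartDensity, ENNReal.ofReal_mul (Real.sqrt_nonneg _)]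

end ChartMeasure

/-! ### Measurability, integrability and integrals transferred between the manifold and a chart. -/

section Transfer

variable {n : ℕ} {M : Type*} [TopologicalSpace M] [ChartedSpace (EuclideanSpace ℝ (Fin n)) M]
  [IsManifold (𝓡 n) ∞ M] [RiemannianBundle (fun x : M => TangentSpace (𝓡 n) x)]
  [IsContMDiffRiemannianBundle (𝓡 n) ∞ (EuclideanSpace ℝ (Fin n))
    (fun x : M => TangentSpace (𝓡 n) x)]

/-- The inner products with the frame are the Gram matrix applied to the coordinates, and the Gram
matrix is invertible. Measurability of the coordinates of a field is deduced from this. -/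
lemma chartCoord_apply_eq {x₀ : M} {y : EuclideanSpace ℝ (Fin n)}
    (hy : y ∈ (extChartAt (𝓡 n) x₀).target)
    (X : TangentSpace (𝓡 n) ((extChartAt (𝓡 n) x₀).symm y)) (i : Fin n) :
    chartCoord x₀ y X i = ∑ j, (metricMatrix x₀ y)⁻¹ i j *
      inner ℝ X (chartVec x₀ y (EuclideanSpace.single j 1)) := by
  set a : Fin n → ℝ := fun j => chartCoord x₀ y X j with ha
  have h1 : (metricMatrix x₀ y).mulVec a =
      fun j => (inner ℝ X (chartVec x₀ y (EuclideanSpace.single j 1)) : ℝ) := by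
    ext j
    have e : X = ∑ i, a i • chartVec x₀ y (EuclideanSpace.single i (1 : ℝ)) := by
      rw [← chartVec_eq_sum, chartVec_chartCoord hy]
    rw [e, sum_inner]
    simp only [Matrix.mulVec, dotProduct]
    refine Finset.sum_congr rfl fun i _ => ?_
    rw [real_inner_smul_left, metricMatrix, Matrix.of_apply, real_inner_comm, mul_comm]
  have h2 : IsUnit (metricMatrix x₀ y).det := (metricMatrix_posDef hy).det_pos.ne'.isUnit
  have h3 : a = (metricMatrix x₀ y)⁻¹.mulVec
      fun j => (inner ℝ X (chartVec x₀ y (EuclideanSpace.single j 1)) : ℝ) := by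
    rw [← h1, Matrix.mulVec_mulVec, Matrix.nonsing_inv_mul _ h2, Matrix.one_mulVec]
  exact congrFun h3 i

lemma inner_eq_sum_chartCoord {x₀ : M} {y : EuclideanSpace ℝ (Fin n)}
    (hy : y ∈ (extChartAt (𝓡 n) x₀).target)
    (X W : TangentSpace (𝓡 n) ((extChartAt (𝓡 n) x₀).symm y)) :
    (inner ℝ X W : ℝ) = ∑ j, chartCoord x₀ y X j *
      inner ℝ W (chartVec x₀ y (EuclideanSpace.single j 1)) := by
  have e : X = ∑ i, chartCoord x₀ y X i • chartVec x₀ y (EuclideanSpace.single i (1 : ℝ)) := by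
    rw [← chartVec_eq_sum, chartVec_chartCoord hy]
  conv_lhs => rw [e, sum_inner]
  refine Finset.sum_congr rfl fun i _ => ?_
  rw [real_inner_smul_left, real_inner_comm]

lemma continuousOn_metricMatrix_inv (x₀ : M) (i j : Fin n) :
    ContinuousOn (fun y => (metricMatrix (n := n) x₀ y)⁻¹ i j) (extChartAt (𝓡 n) x₀).target := by
  have h : ∀ y, (metricMatrix (n := n) x₀ y)⁻¹ i j =
      (metricMatrix x₀ y).det⁻¹ * (metricMatrix x₀ y).adjugate i j := fun y => by
    rw [Matrix.inv_def, Matrix.smul_apply, Ring.inverse_eq_inv', smul_eq_mul]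
  simp only [h]
  refine ContinuousOn.mul (ContinuousOn.inv₀ ?_ fun y hy => (metricMatrix_posDef hy).det_pos.ne') ?_
  · exact (continuous_id.matrix_det).comp_continuousOn (continuousOn_metricMatrix x₀)
  · have : Continuous fun A : Matrix (Fin n) (Fin n) ℝ => A.adjugate i j :=
      (continuous_id.matrix_adjugate).matrix_elem i j
    exact this.comp_continuousOn (continuousOn_metricMatrix x₀)

/-- The components of `V` in the chart around `x₀` are measurable. -/
def HasMeasurableComponents (V : (x : M) → TangentSpace (𝓡 n) x) : Prop :=
  ∀ (x₀ : M) (w : EuclideanSpace ℝ (Fin n)), AEStronglyMeasurable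
    (fun y => (inner ℝ (V ((extChartAt (𝓡 n) x₀).symm y)) (chartVec x₀ y w) : ℝ))
    (volume.restrict (extChartAt (𝓡 n) x₀).target)

omit [IsManifold (𝓡 n) ∞ M] [IsContMDiffRiemannianBundle (𝓡 n) ∞ (EuclideanSpace ℝ (Fin n))
    (fun x : M => TangentSpace (𝓡 n) x)] in
lemma IsWeakGradient.hasMeasurableComponents {f : M → ℝ} {V : (x : M) → TangentSpace (𝓡 n) x}
    (h : IsWeakGradient f V) : HasMeasurableComponents V := fun x₀ w =>
  ((h x₀).2 w).1.aestronglyMeasurable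

lemma HasMeasurableComponents.coord {V : (x : M) → TangentSpace (𝓡 n) x}
    (h : HasMeasurableComponents V) (x₀ : M) (i : Fin n) : AEStronglyMeasurable
    (fun y => chartCoord x₀ y (V ((extChartAt (𝓡 n) x₀).symm y)) i)
    (volume.restrict (extChartAt (𝓡 n) x₀).target) := by
  have hΩ := (isOpen_chartTarget (n := n) x₀).measurableSet
  have h1 : AEStronglyMeasurable (fun y => ∑ j, (metricMatrix x₀ y)⁻¹ i j *
      (inner ℝ (V ((extChartAt (𝓡 n) x₀).symm y))
        (chartVec x₀ y (EuclideanSpace.single j 1)) : ℝ))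
      (volume.restrict (extChartAt (𝓡 n) x₀).target) :=
    Finset.aestronglyMeasurable_fun_sum _ fun j _ =>
      ((continuousOn_metricMatrix_inv x₀ i j).aestronglyMeasurable hΩ).mul (h x₀ _)
  refine h1.congr ?_
  rw [EventuallyEq, ae_restrict_iff' hΩ]
  exact Eventually.of_forall fun y hy => (chartCoord_apply_eq hy _ i).symm

lemma HasMeasurableComponents.inner_chart {V W : (x : M) → TangentSpace (𝓡 n) x}
    (hV : HasMeasurableComponents V) (hW : HasMeasurableComponents W) (x₀ : M) :
    AEStronglyMeasurable (fun y => (inner ℝ (V ((extChartAt (𝓡 n) x₀).symm y))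
      (W ((extChartAt (𝓡 n) x₀).symm y)) : ℝ))
    (volume.restrict (extChartAt (𝓡 n) x₀).target) := by
  have hΩ := (isOpen_chartTarget (n := n) x₀).measurableSet
  have h1 : AEStronglyMeasurable (fun y => ∑ j, chartCoord x₀ y (V ((extChartAt (𝓡 n) x₀).symm y)) j *
      (inner ℝ (W ((extChartAt (𝓡 n) x₀).symm y))
        (chartVec x₀ y (EuclideanSpace.single j 1)) : ℝ))
      (volume.restrict (extChartAt (𝓡 n) x₀).target) :=
    Finset.aestronglyMeasurable_fun_sum _ fun j _ => (hV.coord x₀ j).mul (hW x₀ _)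
  refine h1.congr ?_
  rw [EventuallyEq, ae_restrict_iff' hΩ]
  exact Eventually.of_forall fun y hy => (inner_eq_sum_chartCoord hy _ _).symm

variable [MeasurableSpace M] [BorelSpace M] {φ : M → ℝ}

lemma ae_mem_target_chartMeasure (φ : M → ℝ) (x₀ : M) :
    ∀ᵐ y ∂chartMeasure (n := n) φ x₀, y ∈ (extChartAt (𝓡 n) x₀).target :=
  (withDensity_absolutelyContinuous _ _).ae_le
    (ae_restrict_mem (isOpen_chartTarget x₀).measurableSet)

lemma volume_restrict_absolutelyContinuous_chartMeasure (hφ : Continuous φ) (x₀ : M) :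
    volume.restrict (extChartAt (𝓡 n) x₀).target ≪ chartMeasure φ x₀ := by
  refine withDensity_absolutelyContinuous' (aemeasurable_chartDensity hφ x₀) ?_
  rw [ae_restrict_iff' (isOpen_chartTarget x₀).measurableSet]
  exact Eventually.of_forall fun y hy => by simpa using chartDensity_pos φ hy

lemma aestronglyMeasurable_comp_chart (hφ : Continuous φ) (x₀ : M) {H : M → ℝ}
    (hH : AEStronglyMeasurable H (weightedVolume n φ)) :
    AEStronglyMeasurable (fun y => H ((extChartAt (𝓡 n) x₀).symm y))
      (volume.restrict (extChartAt (𝓡 n) x₀).target) := by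
  have h1 := hH.restrict (s := (extChartAt (𝓡 n) x₀).source)
  rw [weightedVolume_restrict_source hφ] at h1
  exact (h1.comp_aemeasurable (aemeasurable_chart_symm_chartMeasure φ x₀)).mono_ac
    (volume_restrict_absolutelyContinuous_chartMeasure hφ x₀)

lemma aestronglyMeasurable_of_comp_chart (hφ : Continuous φ) (x₀ : M) {H : M → ℝ}
    (hH : AEStronglyMeasurable (fun y => H ((extChartAt (𝓡 n) x₀).symm y))
      (volume.restrict (extChartAt (𝓡 n) x₀).target)) :
    AEStronglyMeasurable H ((weightedVolume n φ).restrict (extChartAt (𝓡 n) x₀).source) := by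
  have hsm : MeasurableSet (extChartAt (𝓡 n) x₀).source :=
    (isOpen_extChartAt_source (I := 𝓡 n) x₀).measurableSet
  have hcm : AEMeasurable (extChartAt (𝓡 n) x₀)
      ((weightedVolume n φ).restrict (extChartAt (𝓡 n) x₀).source) :=
    (continuousOn_extChartAt x₀).aemeasurable hsm
  -- The restricted volume is itself an image under the inverse chart, and the chart undoes it
  -- almost everywhere.
  have hmap : ((weightedVolume n φ).restrict (extChartAt (𝓡 n) x₀).source).map
      (extChartAt (𝓡 n) x₀) = chartMeasure φ x₀ := by
    rw [weightedVolume_restrict_source hφ] at hcm ⊢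
    rw [AEMeasurable.map_map_of_aemeasurable hcm (aemeasurable_chart_symm_chartMeasure φ x₀)]
    conv_rhs => rw [← Measure.map_id (μ := chartMeasure (n := n) φ x₀)]
    refine Measure.map_congr ?_
    filter_upwards [ae_mem_target_chartMeasure φ x₀] with y hy
    exact (extChartAt (𝓡 n) x₀).right_inv hy
  have h1 : AEStronglyMeasurable (fun y => H ((extChartAt (𝓡 n) x₀).symm y))
      (((weightedVolume n φ).restrict (extChartAt (𝓡 n) x₀).source).map (extChartAt (𝓡 n) x₀)) := by
    rw [hmap]
    exact hH.mono_ac (withDensity_absolutelyContinuous _ _)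
  refine (h1.comp_aemeasurable hcm).congr ?_
  filter_upwards [ae_restrict_mem hsm] with x hx
  simp only [Function.comp_apply]
  rw [(extChartAt (𝓡 n) x₀).left_inv hx]

lemma aestronglyMeasurable_of_forall_chart [SecondCountableTopology M] (hφ : Continuous φ)
    {H : M → ℝ} (hH : ∀ x₀ : M, AEStronglyMeasurable (fun y => H ((extChartAt (𝓡 n) x₀).symm y))
      (volume.restrict (extChartAt (𝓡 n) x₀).target)) :
    AEStronglyMeasurable H (weightedVolume n φ) := by
  obtain ⟨s, hs, hcov⟩ := TopologicalSpace.countable_cover_nhds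
    fun x : M => extChartAt_source_mem_nhds (I := 𝓡 n) x
  have : Countable s := hs.to_subtype
  rw [← Measure.restrict_univ (μ := weightedVolume n φ), ← hcov, biUnion_eq_iUnion,
    aestronglyMeasurable_iUnion_iff]
  exact fun x => aestronglyMeasurable_of_comp_chart hφ x (hH x)

/-- The density has a positive lower bound on `K`, so Lebesgue measure on `K` is at most a constant
multiple of `chartMeasure`. -/
lemma memLp_comp_chart (hφ : Continuous φ) (x₀ : M) {f : M → ℝ} {r : ℝ≥0∞}
    (hf : MemLp f r (weightedVolume n φ)) {K : Set (EuclideanSpace ℝ (Fin n))} (hK : IsCompact K)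
    (hKΩ : K ⊆ (extChartAt (𝓡 n) x₀).target) :
    MemLp (fun y => f ((extChartAt (𝓡 n) x₀).symm y)) r (volume.restrict K) := by
  have h1 := hf.restrict (extChartAt (𝓡 n) x₀).source
  rw [weightedVolume_restrict_source hφ] at h1
  have h2 := h1.comp_of_map (aemeasurable_chart_symm_chartMeasure φ x₀)
  obtain ⟨m, hm, hmin⟩ := hK.exists_forall_le' ((continuousOn_chartDensity hφ x₀).mono hKΩ) (a := 0)
    fun y hy => chartDensity_pos φ (hKΩ hy)
  refine h2.of_measure_le_smul (c := (ENNReal.ofReal m)⁻¹) (by simpa using hm) ?_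
  refine Measure.le_iff.2 fun S hS => ?_
  have hm0 : ENNReal.ofReal m ≠ 0 := by simpa using hm
  rw [Measure.restrict_apply hS, Measure.smul_apply, smul_eq_mul, chartMeasure,
    withDensity_apply _ hS, Measure.restrict_restrict hS]
  calc volume (S ∩ K) = (ENNReal.ofReal m)⁻¹ * ∫⁻ _ in S ∩ K, ENNReal.ofReal m := by
        rw [setLIntegral_const, ← mul_assoc, ENNReal.inv_mul_cancel hm0 ENNReal.ofReal_ne_top,
          one_mul]
    _ ≤ (ENNReal.ofReal m)⁻¹ * ∫⁻ y in S ∩ K, ENNReal.ofReal (chartDensity φ x₀ y) := by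
        refine mul_le_mul_right (setLIntegral_mono' (hS.inter hK.measurableSet) fun y hy => ?_) _
        exact ENNReal.ofReal_le_ofReal (hmin y hy.2)
    _ ≤ _ := mul_le_mul_right (lintegral_mono_set (inter_subset_inter_right _ hKΩ)) _

/-- Integration in a chart of a function supported in its domain. -/
lemma integral_eq_integral_chart (hφ : Continuous φ) (x₀ : M) {H : M → ℝ}
    (h0 : ∀ x, x ∉ (extChartAt (𝓡 n) x₀).source → H x = 0)
    (hH : AEStronglyMeasurable (fun y => H ((extChartAt (𝓡 n) x₀).symm y))
      (volume.restrict (extChartAt (𝓡 n) x₀).target)) :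
    ∫ x, H x ∂weightedVolume n φ = ∫ y in (extChartAt (𝓡 n) x₀).target,
      chartDensity φ x₀ y * H ((extChartAt (𝓡 n) x₀).symm y) := by
  have h1 := aestronglyMeasurable_of_comp_chart hφ x₀ hH
  rw [← setIntegral_eq_integral_of_forall_compl_eq_zero h0]
  rw [weightedVolume_restrict_source hφ] at h1 ⊢
  rw [integral_map (aemeasurable_chart_symm_chartMeasure φ x₀) h1, chartMeasure,
    integral_withDensity_eq_integral_toReal_smul₀ (aemeasurable_chartDensity hφ x₀)
      (Eventually.of_forall fun _ => ENNReal.ofReal_lt_top)]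
  refine setIntegral_congr_fun (isOpen_chartTarget x₀).measurableSet fun y hy => ?_
  simp only [smul_eq_mul]
  rw [ENNReal.toReal_ofReal (chartDensity_pos φ hy).le]

lemma integrable_of_chart (hφ : Continuous φ) (x₀ : M) {H : M → ℝ}
    (h0 : ∀ x, x ∉ (extChartAt (𝓡 n) x₀).source → H x = 0)
    (hH : IntegrableOn (fun y => chartDensity φ x₀ y * H ((extChartAt (𝓡 n) x₀).symm y))
      (extChartAt (𝓡 n) x₀).target) : Integrable H (weightedVolume n φ) := by
  have hΩ := (isOpen_chartTarget (n := n) x₀).measurableSet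
  have hm : AEStronglyMeasurable (fun y => H ((extChartAt (𝓡 n) x₀).symm y))
      (volume.restrict (extChartAt (𝓡 n) x₀).target) := by
    -- Dividing by the positive continuous density recovers the measurability of `H` in the chart.
    have h2 : ContinuousOn (fun y => (chartDensity (n := n) φ x₀ y)⁻¹)
        (extChartAt (𝓡 n) x₀).target :=
      (continuousOn_chartDensity hφ x₀).inv₀ fun y hy => (chartDensity_pos φ hy).ne'
    refine ((h2.aestronglyMeasurable hΩ).mul hH.aestronglyMeasurable).congr ?_
    rw [EventuallyEq, ae_restrict_iff' hΩ]
    refine Eventually.of_forall fun y hy => ?_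
    simp only [Pi.mul_apply]
    rw [inv_mul_cancel_left₀ (chartDensity_pos φ hy).ne']
  have h1 := aestronglyMeasurable_of_comp_chart hφ x₀ hm
  have hsupp : Function.support H ⊆ (extChartAt (𝓡 n) x₀).source := fun x hx => by
    by_contra hx'; exact hx (h0 x hx')
  rw [← integrableOn_iff_integrable_of_support_subset hsupp, IntegrableOn]
  rw [weightedVolume_restrict_source hφ] at h1 ⊢
  rw [integrable_map_measure h1 (aemeasurable_chart_symm_chartMeasure φ x₀), chartMeasure,
    integrable_withDensity_iff_integrable_smul₀' (aemeasurable_chartDensity hφ x₀)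
      (Eventually.of_forall fun _ => ENNReal.ofReal_lt_top)]
  refine hH.congr_fun (fun y hy => ?_) hΩ
  simp only [smul_eq_mul, Function.comp_apply]
  rw [ENNReal.toReal_ofReal (chartDensity_pos φ hy).le]

end Transfer

/-! ### Test functions supported in a chart. -/

section ChartTest

variable {n : ℕ} {M : Type*} [TopologicalSpace M] [ChartedSpace (EuclideanSpace ℝ (Fin n)) M]
  [IsManifold (𝓡 n) ∞ M]

/-- A test function in a chart, extended by zero. -/
lemma isTestFunction_indicator_chart [T2Space M] (x₀ : M) {ζ : EuclideanSpace ℝ (Fin n) → ℝ}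
    (hζ : ContDiff ℝ ∞ ζ) (hζs : HasCompactSupport ζ)
    (hζΩ : tsupport ζ ⊆ (extChartAt (𝓡 n) x₀).target) :
    IsTestFunction n
        ((extChartAt (𝓡 n) x₀).source.indicator fun x => ζ (extChartAt (𝓡 n) x₀ x)) ∧
      tsupport ((extChartAt (𝓡 n) x₀).source.indicator fun x => ζ (extChartAt (𝓡 n) x₀ x)) ⊆
        (extChartAt (𝓡 n) x₀).source := by
  set ψ := (extChartAt (𝓡 n) x₀).source.indicator fun x => ζ (extChartAt (𝓡 n) x₀ x) with hψ
  set S := (extChartAt (𝓡 n) x₀).symm '' tsupport ζ with hS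
  have hSc : IsCompact S :=
    hζs.isCompact.image_of_continuousOn ((contMDiffOn_chart_symm x₀).continuousOn.mono hζΩ)
  have hSs : S ⊆ (extChartAt (𝓡 n) x₀).source := by
    rintro _ ⟨y, hy, rfl⟩; exact (extChartAt (𝓡 n) x₀).map_target (hζΩ hy)
  have hz : ∀ x, x ∉ S → ψ x = 0 := by
    intro x hx
    by_cases hxs : x ∈ (extChartAt (𝓡 n) x₀).source
    · rw [hψ, indicator_of_mem hxs]
      refine image_eq_zero_of_notMem_tsupport fun h => hx ⟨_, h, ?_⟩
      exact (extChartAt (𝓡 n) x₀).left_inv hxs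
    · rw [hψ, indicator_of_notMem hxs]
  have hts : tsupport ψ ⊆ S := closure_minimal (fun x hx => by
    by_contra h; exact hx (hz x h)) hSc.isClosed
  refine ⟨⟨fun x => ?_, hSc.of_isClosed_subset (isClosed_tsupport _) hts⟩, hts.trans hSs⟩
  -- Near a point of `S` the function is a composition with the chart. Off `S`, which is closed
  -- because it is compact in a Hausdorff space, it vanishes.
  by_cases hx : x ∈ S
  · have hso := isOpen_extChartAt_source (I := 𝓡 n) x₀
    have h1 : ContMDiffAt (𝓡 n) 𝓘(ℝ, ℝ) ∞ (fun x => ζ (extChartAt (𝓡 n) x₀ x)) x :=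
      hζ.contMDiff.contMDiffAt.comp x
        ((contMDiffOn_extChartAt (I := 𝓡 n) (x := x₀)).contMDiffAt
          ((chartAt (EuclideanSpace ℝ (Fin n)) x₀).open_source.mem_nhds
            (by have := hSs hx; rwa [extChartAt_source] at this)))
    refine h1.congr_of_eventuallyEq ?_
    filter_upwards [hso.mem_nhds (hSs hx)] with z hzz
    rw [hψ, indicator_of_mem hzz]
  · refine (contMDiffAt_const (c := (0 : ℝ))).congr_of_eventuallyEq ?_
    filter_upwards [hSc.isClosed.isOpen_compl.mem_nhds hx] with z hzz
    exact hz z hzz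

/-- A test function supported in the domain of a chart, in the coordinates of the chart. -/
lemma contDiff_indicator_comp_chart_symm {x₀ : M} {χ : M → ℝ} (hχ : IsTestFunction n χ)
    (hχΩ : tsupport χ ⊆ (extChartAt (𝓡 n) x₀).source) :
    ContDiff ℝ ∞ ((extChartAt (𝓡 n) x₀).target.indicator
        fun y => χ ((extChartAt (𝓡 n) x₀).symm y)) ∧
      HasCompactSupport ((extChartAt (𝓡 n) x₀).target.indicator
        fun y => χ ((extChartAt (𝓡 n) x₀).symm y)) ∧
      tsupport ((extChartAt (𝓡 n) x₀).target.indicator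
        fun y => χ ((extChartAt (𝓡 n) x₀).symm y)) ⊆ (extChartAt (𝓡 n) x₀).target := by
  set κ := (extChartAt (𝓡 n) x₀).target.indicator fun y => χ ((extChartAt (𝓡 n) x₀).symm y) with hκ
  set S := extChartAt (𝓡 n) x₀ '' tsupport χ with hS
  have hSc : IsCompact S :=
    hχ.2.isCompact.image_of_continuousOn ((continuousOn_extChartAt x₀).mono hχΩ)
  have hSs : S ⊆ (extChartAt (𝓡 n) x₀).target := by
    rintro _ ⟨y, hy, rfl⟩; exact (extChartAt (𝓡 n) x₀).map_source (hχΩ hy)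
  have hz : ∀ y, y ∉ S → κ y = 0 := by
    intro y hy
    by_cases hys : y ∈ (extChartAt (𝓡 n) x₀).target
    · rw [hκ, indicator_of_mem hys]
      refine image_eq_zero_of_notMem_tsupport fun h => hy ⟨_, h, ?_⟩
      exact (extChartAt (𝓡 n) x₀).right_inv hys
    · rw [hκ, indicator_of_notMem hys]
  have hts : tsupport κ ⊆ S := closure_minimal (fun x hx => by
    by_contra h; exact hx (hz x h)) hSc.isClosed
  refine ⟨contDiff_iff_contDiffAt.2 fun y => ?_,
    hSc.of_isClosed_subset (isClosed_tsupport _) hts, hts.trans hSs⟩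
  by_cases hy : y ∈ S
  · have hΩ := (isOpen_chartTarget (n := n) x₀).mem_nhds (hSs hy)
    have h1 : ContMDiffAt 𝓘(ℝ, EuclideanSpace ℝ (Fin n)) 𝓘(ℝ, ℝ) ∞
        (fun y => χ ((extChartAt (𝓡 n) x₀).symm y)) y :=
      hχ.1.contMDiffAt.comp y ((contMDiffOn_chart_symm x₀).contMDiffAt hΩ)
    refine (contMDiffAt_iff_contDiffAt.1 h1).congr_of_eventuallyEq ?_
    filter_upwards [hΩ] with z hzz
    rw [hκ, indicator_of_mem hzz]
  · refine (contDiffAt_const (c := (0 : ℝ))).congr_of_eventuallyEq ?_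
    filter_upwards [hSc.isClosed.isOpen_compl.mem_nhds hy] with z hzz
    exact hz z hzz

lemma mfderiv_eq_zero_of_notMem_tsupport {ψ : M → ℝ} {x : M} (hx : x ∉ tsupport ψ) :
    mfderiv (𝓡 n) 𝓘(ℝ, ℝ) ψ x = 0 := by
  have h1 : ψ =ᶠ[𝓝 x] fun _ => (0 : ℝ) := by
    filter_upwards [(isClosed_tsupport ψ).isOpen_compl.mem_nhds hx] with z hz
    exact image_eq_zero_of_notMem_tsupport hz
  rw [h1.mfderiv_eq]
  exact mfderiv_const

variable [RiemannianBundle (fun x : M => TangentSpace (𝓡 n) x)]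

lemma inner_gradient_right (ψ : M → ℝ) (x : M) (X : TangentSpace (𝓡 n) x) :
    inner ℝ X (gradient n ψ x) = mfderiv (𝓡 n) 𝓘(ℝ, ℝ) ψ x X := by
  rw [real_inner_comm, inner_gradient]

variable [IsContMDiffRiemannianBundle (𝓡 n) ∞ (EuclideanSpace ℝ (Fin n))
  (fun x : M => TangentSpace (𝓡 n) x)]

lemma inner_gradient_eq_sum {x₀ : M} {y : EuclideanSpace ℝ (Fin n)}
    (hy : y ∈ (extChartAt (𝓡 n) x₀).target) {ψ : M → ℝ} (hψ : ContMDiff (𝓡 n) 𝓘(ℝ, ℝ) ∞ ψ)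
    (X : TangentSpace (𝓡 n) ((extChartAt (𝓡 n) x₀).symm y)) :
    inner ℝ X (gradient n ψ ((extChartAt (𝓡 n) x₀).symm y)) = ∑ j, chartCoord x₀ y X j *
      fderiv ℝ (fun z => ψ ((extChartAt (𝓡 n) x₀).symm z)) y (EuclideanSpace.single j 1) := by
  rw [inner_eq_sum_chartCoord hy]
  refine Finset.sum_congr rfl fun j _ => ?_
  rw [inner_gradient, fderiv_comp_chart_symm hy (hψ.mdifferentiableAt (by simp))]

end ChartTest

/-! ### The local test on the manifold. -/

section LocalEstimate

variable {n : ℕ} {M : Type*} [MetricSpace M] [ChartedSpace (EuclideanSpace ℝ (Fin n)) M]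
  [IsManifold (𝓡 n) ∞ M] [RiemannianBundle (fun x : M => TangentSpace (𝓡 n) x)]
  [IsContMDiffRiemannianBundle (𝓡 n) ∞ (EuclideanSpace ℝ (Fin n))
    (fun x : M => TangentSpace (𝓡 n) x)]
  [IsRiemannianManifold (𝓡 n) M] [MeasurableSpace M] [BorelSpace M]

omit [IsManifold (𝓡 n) ∞ M] [IsContMDiffRiemannianBundle (𝓡 n) ∞ (EuclideanSpace ℝ (Fin n))
    (fun x : M => TangentSpace (𝓡 n) x)] [IsRiemannianManifold (𝓡 n) M] [BorelSpace M] in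
-- The target exponent is conjugate to `p`, so that the flux `‖V‖^(p-2) V` pairs with gradients in
-- `L^p`.
lemma memLp_norm_rpow {φ : M → ℝ} {p : ℝ} (hp : 1 < p) {V : (x : M) → TangentSpace (𝓡 n) x}
    (hV : MemLp (fun x => ‖V x‖) (ENNReal.ofReal p) (weightedVolume n φ)) :
    MemLp (fun x => ‖V x‖ ^ (p - 1)) (ENNReal.ofReal (p / (p - 1))) (weightedVolume n φ) := by
  have h := hV.norm_rpow_div (ENNReal.ofReal (p - 1))
  rw [ENNReal.toReal_ofReal (by linarith), ← ENNReal.ofReal_div_of_pos (by linarith)] at h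
  simpa using h

/-- At `s = 0` both sides vanish because `1 < p`, whatever the value of `0 ^ (p - 2)`. -/
lemma rpow_sub_two_mul {p s : ℝ} (hp : 1 < p) (hs : 0 ≤ s) : s ^ (p - 2) * s = s ^ (p - 1) := by
  rcases hs.eq_or_lt with rfl | hs
  · rw [mul_zero, Real.zero_rpow (by linarith)]
  · rw [← Real.rpow_add_one hs.ne']; ring_nf

/-- The equation `f = L_{p,φ} v`, where `V` is the gradient of `v`, in a chart. -/
lemma IsWeakDriftPLaplacian.chart {φ : M → ℝ} (hφ : Continuous φ) {p : ℝ}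
    {f : M → ℝ} {V : (x : M) → TangentSpace (𝓡 n) x}
    (hf : AEStronglyMeasurable f (weightedVolume n φ)) (hV : HasMeasurableComponents V)
    (hVn : AEStronglyMeasurable (fun x => ‖V x‖) (weightedVolume n φ))
    (h : IsWeakDriftPLaplacian φ p V f) (x₀ : M) {ζ : EuclideanSpace ℝ (Fin n) → ℝ}
    (hζ : ContDiff ℝ ∞ ζ) (hζs : HasCompactSupport ζ)
    (hζΩ : tsupport ζ ⊆ (extChartAt (𝓡 n) x₀).target) :
    ∫ y in (extChartAt (𝓡 n) x₀).target,
        chartDensity φ x₀ y * f ((extChartAt (𝓡 n) x₀).symm y) * ζ y =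
      -∫ y in (extChartAt (𝓡 n) x₀).target, ∑ j, chartDensity φ x₀ y *
        (‖V ((extChartAt (𝓡 n) x₀).symm y)‖ ^ (p - 2) *
          chartCoord x₀ y (V ((extChartAt (𝓡 n) x₀).symm y)) j) *
            fderiv ℝ ζ y (EuclideanSpace.single j 1) := by
  obtain ⟨hψ, hψs⟩ := isTestFunction_indicator_chart x₀ hζ hζs hζΩ
  set ψ := (extChartAt (𝓡 n) x₀).source.indicator fun x => ζ (extChartAt (𝓡 n) x₀ x) with hψd
  have hΩo := isOpen_chartTarget (n := n) x₀
  have hΩ := hΩo.measurableSet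
  have hψζ : ∀ y ∈ (extChartAt (𝓡 n) x₀).target, ψ ((extChartAt (𝓡 n) x₀).symm y) = ζ y := by
    intro y hy
    rw [hψd, indicator_of_mem ((extChartAt (𝓡 n) x₀).map_target hy),
      (extChartAt (𝓡 n) x₀).right_inv hy]
  have hin : ∀ y ∈ (extChartAt (𝓡 n) x₀).target,
      (inner ℝ (V ((extChartAt (𝓡 n) x₀).symm y)) (gradient n ψ ((extChartAt (𝓡 n) x₀).symm y)) : ℝ)
        = ∑ j, chartCoord x₀ y (V ((extChartAt (𝓡 n) x₀).symm y)) j *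
            fderiv ℝ ζ y (EuclideanSpace.single j 1) := by
    intro y hy
    rw [inner_gradient_eq_sum hy hψ.1]
    have : (fun z => ψ ((extChartAt (𝓡 n) x₀).symm z)) =ᶠ[𝓝 y] ζ := by
      filter_upwards [hΩo.mem_nhds hy] with z hz using hψζ z hz
    rw [this.fderiv_eq]
  have h1 := h ψ hψ
  rw [integral_eq_integral_chart hφ x₀, integral_eq_integral_chart hφ x₀] at h1
  · refine Eq.trans (setIntegral_congr_fun hΩ fun y hy => ?_) (h1.trans (congrArg _
      (setIntegral_congr_fun hΩ fun y hy => ?_)))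
    · simp only [hψζ y hy]; ring
    · simp only [hin y hy, Finset.mul_sum]
      exact Finset.sum_congr rfl fun j _ => by ring
  · intro x hx
    rw [inner_gradient_right, mfderiv_eq_zero_of_notMem_tsupport fun h => hx (hψs h)]
    exact mul_zero _
  · refine AEStronglyMeasurable.mul (f := fun y => ‖V ((extChartAt (𝓡 n) x₀).symm y)‖ ^ (p - 2)) ?_ ?_
    · exact ((aestronglyMeasurable_comp_chart hφ x₀ hVn).aemeasurable.pow_const _).aestronglyMeasurable
    · have h2 : AEStronglyMeasurable (fun y =>
          ∑ j, chartCoord x₀ y (V ((extChartAt (𝓡 n) x₀).symm y)) j *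
            fderiv ℝ ζ y (EuclideanSpace.single j 1))
          (volume.restrict (extChartAt (𝓡 n) x₀).target) :=
        Finset.aestronglyMeasurable_fun_sum _ fun j _ => (hV.coord x₀ j).mul
          ((hζ.continuous_fderiv (by simp)).clm_apply continuous_const).aestronglyMeasurable
      refine h2.congr ?_
      rw [EventuallyEq, ae_restrict_iff' hΩ]
      exact Eventually.of_forall fun y hy => (hin y hy).symm
  · intro x hx
    rw [hψd, indicator_of_notMem hx, mul_zero]
  · exact aestronglyMeasurable_comp_chart hφ x₀
      (hf.mul hψ.1.continuous.aestronglyMeasurable)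

/-- Test of `f = L_{p,φ} v` by `χ θ(w) η`, where `χ` is a test function in a chart, `w` has the weak
gradient `W`, and `η` is Lipschitz. -/
theorem abs_integral_chart_test_le {φ : M → ℝ} (hφ : Continuous φ) {p : ℝ} (hp : 1 < p)
    {f : M → ℝ} {r : ℝ≥0∞} (hr : 1 ≤ r) (hf : MemLp f r (weightedVolume n φ))
    {V : (x : M) → TangentSpace (𝓡 n) x} (hVm : HasMeasurableComponents V)
    (hVp : MemLp (fun x => ‖V x‖) (ENNReal.ofReal p) (weightedVolume n φ))
    (h : IsWeakDriftPLaplacian φ p V f)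
    {v : M → ℝ} {W : (x : M) → TangentSpace (𝓡 n) x} (hW : IsWeakGradient v W)
    (hWp : MemLp (fun x => ‖W x‖) (ENNReal.ofReal p) (weightedVolume n φ))
    {θ : ℝ → ℝ} (hθ : ContDiff ℝ ∞ θ) {C : ℝ} (hθC : ∀ s, |θ s| ≤ C) (hθC' : ∀ s, |deriv θ s| ≤ C)
    {η : M → ℝ} {l : ℝ} (hl : 0 ≤ l) (hη : ∀ x y, |η x - η y| ≤ l * dist x y)
    (hηc : Continuous η) (hη1 : ∀ x, |η x| ≤ 1) (x₀ : M) {χ : M → ℝ} (hχ : IsTestFunction n χ)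
    (hχΩ : tsupport χ ⊆ (extChartAt (𝓡 n) x₀).source) (hχ0 : ∀ x, 0 ≤ χ x) :
    Integrable (fun x => χ x * (f x * θ (v x) * η x) +
      ‖V x‖ ^ (p - 2) * inner ℝ (V x) (gradient n χ x) * θ (v x) * η x +
      χ x * (deriv θ (v x) * (‖V x‖ ^ (p - 2) * inner ℝ (V x) (W x)) * η x))
      (weightedVolume n φ) ∧
    |∫ x, (χ x * (f x * θ (v x) * η x) +
      ‖V x‖ ^ (p - 2) * inner ℝ (V x) (gradient n χ x) * θ (v x) * η x +
      χ x * (deriv θ (v x) * (‖V x‖ ^ (p - 2) * inner ℝ (V x) (W x)) * η x)) ∂weightedVolume n φ| ≤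
    ∫ x, χ x * (2 * l * |θ (v x)| * ‖V x‖ ^ (p - 1)) ∂weightedVolume n φ := by
  obtain ⟨hκ, hκs, hκΩ⟩ := contDiff_indicator_comp_chart_symm hχ hχΩ
  set κ := (extChartAt (𝓡 n) x₀).target.indicator fun y => χ ((extChartAt (𝓡 n) x₀).symm y) with hκd
  have hΩo := isOpen_chartTarget (n := n) x₀
  have hΩ := hΩo.measurableSet
  set Ω := (extChartAt (𝓡 n) x₀).target with hΩd
  set ι := (extChartAt (𝓡 n) x₀).symm with hι
  have hρc := continuousOn_chartDensity (n := n) hφ x₀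
  set ρ := chartDensity (n := n) φ x₀ with hρ
  have hκχ : ∀ y ∈ Ω, κ y = χ (ι y) := fun y hy => by rw [hκd, indicator_of_mem hy]
  have hχz : ∀ x, x ∉ (extChartAt (𝓡 n) x₀).source → χ x = 0 := fun x hx =>
    image_eq_zero_of_notMem_tsupport fun h => hx (hχΩ h)
  have hχz' : ∀ x, x ∉ (extChartAt (𝓡 n) x₀).source →
      (inner ℝ (V x) (gradient n χ x) : ℝ) = 0 := fun x hx => by
    rw [inner_gradient_right, mfderiv_eq_zero_of_notMem_tsupport fun h => hx (hχΩ h)]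
    rfl
  have hpp : p.HolderConjugate (p / (p - 1)) := Real.HolderConjugate.conjExponent hp
  have hG := memLp_norm_rpow hp hVp
  have hGm := hG.aestronglyMeasurable
  obtain ⟨K, hK, hκK, hKΩ⟩ := exists_compact_between hκs hΩo hκΩ
  have hvm : AEStronglyMeasurable (fun y => v (ι y)) (volume.restrict Ω) :=
    (hW x₀).1.aestronglyMeasurable
  have hV2m : AEStronglyMeasurable (fun y => ‖V (ι y)‖ ^ (p - 2)) (volume.restrict Ω) :=
    ((aestronglyMeasurable_comp_chart hφ x₀ hVp.1).aemeasurable.pow_const _).aestronglyMeasurable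
  -- The Euclidean flux `A j` is the density times `‖V‖^(p-2)` times the `j`-th coordinate of `V`;
  -- summed against the components of `W` it gives the Riemannian inner product. Summed against the
  -- gradient of the mollified `η`, it is at most `2 * l * ρ * ‖V‖^(p-1)`, which is the choice of
  -- `a`.
  have key := abs_integral_test_le (ι := Fin n) (b := fun j => EuclideanSpace.single j (1 : ℝ))
    (Ω := Ω) hΩo hpp (f := fun y => ρ y * f (ι y)) (v := fun y => v (ι y))
    (A := fun j y => ρ y * (‖V (ι y)‖ ^ (p - 2) * chartCoord x₀ y (V (ι y)) j))
    (d := fun j y => inner ℝ (W (ι y)) (chartVec x₀ y (EuclideanSpace.single j 1)))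
    ?_ ?_ ?_ ?_ ?_ ?_ hκ hκs hκΩ (fun y => ?_) hθ hθC hθC' (η := fun y => η (ι y)) ?_
    (fun y => hη1 _) (a := fun y => 2 * l * (ρ y * ‖V (ι y)‖ ^ (p - 1))) ?_ hK hKΩ hκK ?_
  · have hH : ∀ y ∈ Ω, ρ y * f (ι y) * (κ y * θ (v (ι y)) * η (ι y)) +
        ∑ j, ρ y * (‖V (ι y)‖ ^ (p - 2) * chartCoord x₀ y (V (ι y)) j) *
          (fderiv ℝ κ y (EuclideanSpace.single j 1) * θ (v (ι y)) * η (ι y) +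
            κ y * (deriv θ (v (ι y)) * inner ℝ (W (ι y)) (chartVec x₀ y
              (EuclideanSpace.single j 1))) * η (ι y)) =
        ρ y * (χ (ι y) * (f (ι y) * θ (v (ι y)) * η (ι y)) +
          ‖V (ι y)‖ ^ (p - 2) * inner ℝ (V (ι y)) (gradient n χ (ι y)) * θ (v (ι y)) * η (ι y) +
          χ (ι y) * (deriv θ (v (ι y)) * (‖V (ι y)‖ ^ (p - 2) * inner ℝ (V (ι y)) (W (ι y))) *
            η (ι y))) := by
      intro y hy
      have hd : fderiv ℝ κ y = fderiv ℝ (fun z => χ (ι z)) y := by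
        refine Filter.EventuallyEq.fderiv_eq ?_
        filter_upwards [hΩo.mem_nhds hy] with z hz using hκχ z hz
      rw [inner_gradient_eq_sum hy hχ.1, inner_eq_sum_chartCoord hy, hκχ y hy,
        hd]
      simp only [Finset.mul_sum, Finset.sum_mul, mul_add, Finset.sum_add_distrib]
      rw [add_assoc]
      congr 1
      · ring
      · congr 1 <;> exact Finset.sum_congr rfl fun j _ => by ring
    obtain ⟨k1, k2⟩ := key
    rw [setIntegral_congr_fun hΩ hH] at k2
    have k1' := k1.congr_fun hH hΩ
    have hz : ∀ x, x ∉ (extChartAt (𝓡 n) x₀).source → χ x * (f x * θ (v x) * η x) +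
      ‖V x‖ ^ (p - 2) * inner ℝ (V x) (gradient n χ x) * θ (v x) * η x +
      χ x * (deriv θ (v x) * (‖V x‖ ^ (p - 2) * inner ℝ (V x) (W x)) * η x) = 0 := by
      intro x hx
      rw [hχz x hx, hχz' x hx]
      simp
    have hint := integrable_of_chart hφ x₀ hz k1'
    refine ⟨hint, ?_⟩
    rw [integral_eq_integral_chart hφ x₀ hz (aestronglyMeasurable_comp_chart hφ x₀ hint.1),
      integral_eq_integral_chart hφ x₀ (fun x hx => by rw [hχz x hx, zero_mul])]
    · refine k2.trans (le_of_eq (setIntegral_congr_fun hΩ fun y hy => ?_))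
      simp only [hκχ y hy]
      ring
    · refine ((aestronglyMeasurable_comp_chart hφ x₀ hχ.1.continuous.aestronglyMeasurable).mul
        ((hθ.continuous.abs.comp_aestronglyMeasurable hvm).const_mul (2 * l) |>.mul
          (aestronglyMeasurable_comp_chart hφ x₀ hGm)))
  · intro K' hK' hK'Ω
    have h1 := memLp_comp_chart hφ x₀ hf hK' hK'Ω
    have : IsFiniteMeasure (volume.restrict K') := ⟨by simpa using hK'.measure_lt_top⟩
    exact IntegrableOn.continuousOn_mul (hρc.mono hK'Ω) (h1.integrable hr) hK'
  -- On a compact set each coordinate of `V` is at most `m⁻¹ * ‖V‖` and the density is bounded, so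
  -- the flux inherits its integrability from `‖V‖^(p-1)`.
  · intro j K' hK' hK'Ω
    have h1 := memLp_comp_chart hφ x₀ hG hK' hK'Ω
    obtain ⟨m, C₁, r₁, hm, -, -, hm', -, -⟩ := exists_norm_chartVec_bounds hK' hK'Ω
    obtain ⟨C₂, hC₂⟩ := hK'.exists_bound_of_continuousOn (hρc.mono hK'Ω)
    have hsub : volume.restrict K' ≤ volume.restrict Ω := Measure.restrict_mono hK'Ω le_rfl
    refine (h1.const_mul (C₂ * m⁻¹)).of_le ?_ ?_
    · exact ((hρc.aestronglyMeasurable hΩ).mul (hV2m.mul (hVm.coord x₀ j))).mono_measure hsub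
    · rw [ae_restrict_iff' hK'.measurableSet]
      refine Eventually.of_forall fun y hy => ?_
      have e1 : |chartCoord x₀ y (V (ι y)) j| ≤ m⁻¹ * ‖V (ι y)‖ := by
        have e2 := hm' y hy (chartCoord x₀ y (V (ι y)))
        rw [chartVec_chartCoord (hK'Ω hy)] at e2
        rw [← div_eq_inv_mul, le_div_iff₀ hm, mul_comm]
        refine le_trans (mul_le_mul_of_nonneg_left ?_ hm.le) e2
        exact PiLp.norm_apply_le (chartCoord x₀ y (V (ι y))) j
      have e0 : 0 ≤ ‖V (ι y)‖ := norm_nonneg _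
      have hρy := hC₂ y hy
      rw [norm_mul, norm_mul, norm_mul, ← rpow_sub_two_mul hp e0, norm_mul, norm_mul]
      rw [Real.norm_eq_abs (chartCoord _ _ _ _), Real.norm_of_nonneg e0]
      have hC20 := (norm_nonneg _).trans hρy
      rw [Real.norm_of_nonneg hC20, Real.norm_of_nonneg (inv_pos.2 hm).le]
      calc _ ≤ C₂ * (‖‖V (ι y)‖ ^ (p - 2)‖ * (m⁻¹ * ‖V (ι y)‖)) :=
            mul_le_mul hρy (mul_le_mul_of_nonneg_left e1 (norm_nonneg _)) (by positivity) hC20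
        _ = _ := by ring
  · exact fun ζ hζ hζs hζΩ => h.chart hφ hf.1 hVm hVp.1 x₀ hζ hζs hζΩ
  · exact fun K' hK' hK'Ω => (hW x₀).1.integrableOn_compact_subset hK'Ω hK'
  · intro j K' hK' hK'Ω
    obtain ⟨m, C₁, r₁, -, -, -, -, hC₁, -⟩ := exists_norm_chartVec_bounds hK' hK'Ω
    refine ((memLp_comp_chart hφ x₀ hWp hK' hK'Ω).const_mul C₁).of_le
      ((hW.hasMeasurableComponents x₀ _).mono_measure (Measure.restrict_mono hK'Ω le_rfl)) ?_
    rw [ae_restrict_iff' hK'.measurableSet]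
    refine Eventually.of_forall fun y hy => ?_
    have e1 := hC₁ y hy (EuclideanSpace.single j 1)
    rw [PiLp.norm_single, norm_one, mul_one] at e1
    have e0 : 0 ≤ ‖W (ι y)‖ := norm_nonneg _
    rw [norm_mul, Real.norm_of_nonneg e0]
    refine (norm_inner_le_norm (𝕜 := ℝ) _ _).trans ?_
    rw [mul_comm]
    exact mul_le_mul_of_nonneg_right (e1.trans (le_abs_self _)) e0
  · exact fun j ζ hζ hζs hζΩ => ((hW x₀).2 _).2 ζ hζ hζs hζΩ
  · rw [hκd]
    exact indicator_nonneg (fun y _ => hχ0 _) y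
  · exact hηc.comp_continuousOn (contMDiffOn_chart_symm x₀).continuousOn
  · have h1 := memLp_comp_chart hφ x₀ hG hκs hκΩ
    have : IsFiniteMeasure (volume.restrict (tsupport κ)) :=
      ⟨by simpa using hκs.isCompact.measure_lt_top⟩
    have hp1 : (1 : ℝ≥0∞) ≤ ENNReal.ofReal (p / (p - 1)) := by
      rw [ENNReal.one_le_ofReal]; exact hpp.symm.lt.le
    exact (IntegrableOn.continuousOn_mul (hρc.mono hκΩ) (h1.integrable hp1) hκs).const_mul _
  · filter_upwards [eventually_abs_fderiv_mollify_le hl hη hκs hK hκK hKΩ] with N hN y hy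
    have hyΩ := hκΩ hy
    set D := fderiv ℝ (mollify N (K.indicator fun y => η (ι y))) y with hD
    have e1 : ∑ j, ρ y * (‖V (ι y)‖ ^ (p - 2) * chartCoord x₀ y (V (ι y)) j) *
        D (EuclideanSpace.single j 1) =
        D ((ρ y * ‖V (ι y)‖ ^ (p - 2)) • chartCoord x₀ y (V (ι y))) := by
      conv_rhs => rw [← sum_single_eq (chartCoord x₀ y (V (ι y)))]
      rw [map_smul, map_sum, smul_eq_mul, Finset.mul_sum]
      refine Finset.sum_congr rfl fun j _ => ?_
      rw [map_smul, smul_eq_mul]; ring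
    have e0 : 0 ≤ ‖V (ι y)‖ := norm_nonneg _
    rw [e1]
    refine (hN y hy _).trans (le_of_eq ?_)
    rw [chartVec_smul, chartVec_chartCoord hyΩ, norm_smul, norm_mul,
      Real.norm_of_nonneg (chartDensity_pos φ hyΩ).le,
      Real.norm_of_nonneg (Real.rpow_nonneg e0 _), ← rpow_sub_two_mul hp e0]
    ring

end LocalEstimate

/-! ### A finite partition of unity subordinate to charts. -/

section Partition

variable {n : ℕ} {M : Type*} [TopologicalSpace M] [T2Space M] [SecondCountableTopology M]
  [ChartedSpace (EuclideanSpace ℝ (Fin n)) M] [IsManifold (𝓡 n) ∞ M]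

omit [T2Space M] [SecondCountableTopology M] [IsManifold (𝓡 n) ∞ M] in
lemma hasMFDerivAt_finsetSum {ι : Type*} {s : Finset ι} {x : M} {f : ι → M → ℝ}
    {D : ι → TangentSpace (𝓡 n) x →L[ℝ] ℝ}
    (h : ∀ i ∈ s, HasMFDerivAt (𝓡 n) 𝓘(ℝ, ℝ) (f i) x (D i)) :
    HasMFDerivAt (𝓡 n) 𝓘(ℝ, ℝ) (∑ i ∈ s, f i) x (∑ i ∈ s, D i) := by
  classical
  induction s using Finset.induction_on with
  | empty => simpa using! hasMFDerivAt_const (0 : ℝ) x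
  | insert i s hi ih =>
    have e : ∑ j ∈ insert i s, D j = D i + ∑ j ∈ s, D j := Finset.sum_insert hi
    have h1 := (h i (Finset.mem_insert_self i s)).add
      (ih fun j hj => h j (Finset.mem_insert_of_mem hj))
    rw [Finset.sum_insert hi]
    exact Eq.mpr (congrArg (HasMFDerivAt (𝓡 n) 𝓘(ℝ, ℝ) (f i + ∑ j ∈ s, f j) x) e) h1

/-- A finite partition of unity on a compact set by test functions supported in charts. -/
lemma exists_partition_test {K : Set M} (hK : IsCompact K) :
    ∃ (s : Finset M) (χ : M → M → ℝ),
      (∀ i ∈ s, IsTestFunction n (χ i) ∧ tsupport (χ i) ⊆ (extChartAt (𝓡 n) i).source ∧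
        ∀ x, 0 ≤ χ i x) ∧
      (∀ x ∈ K, ∑ i ∈ s, χ i x = 1) ∧ ∀ x, ∑ i ∈ s, χ i x ≤ 1 := by
  classical
  have : LocallyCompactSpace M := ChartedSpace.locallyCompactSpace (EuclideanSpace ℝ (Fin n)) M
  have h1 : ∀ x : M, ∃ L : Set M, IsCompact L ∧ x ∈ interior L ∧
      L ⊆ (extChartAt (𝓡 n) x).source := fun x =>
    exists_compact_subset (isOpen_extChartAt_source (I := 𝓡 n) x) (mem_extChartAt_source x)
  -- Subordination to the interiors of compact sets `L x` makes the supports compact.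
  choose L hL hxL hLs using h1
  obtain ⟨s, -, hs⟩ := hK.elim_nhds_subcover (fun x => interior (L x))
    fun x _ => isOpen_interior.mem_nhds (hxL x)
  obtain ⟨f, hf⟩ := SmoothPartitionOfUnity.exists_isSubordinate (𝓡 n) hK.isClosed
    (fun i : s => interior (L i)) (fun _ => isOpen_interior) (fun x hx => by
      obtain ⟨i, hi, hxi⟩ := mem_iUnion₂.1 (hs hx)
      exact mem_iUnion.2 ⟨⟨i, hi⟩, hxi⟩)
  have hsum : ∀ x, ∑ i ∈ s, (if h : i ∈ s then f ⟨i, h⟩ x else 0) = ∑ᶠ i, f i x := by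
    intro x
    rw [finsum_eq_sum_of_fintype, ← Finset.sum_coe_sort s]
    exact Finset.sum_congr rfl fun i _ => by rw [dif_pos i.2]
  refine ⟨s, fun i x => if h : i ∈ s then f ⟨i, h⟩ x else 0, fun i hi => ?_, fun x hx => ?_,
    fun x => ?_⟩
  · simp only [dif_pos hi]
    have hsub : tsupport (f ⟨i, hi⟩) ⊆ L i := (hf ⟨i, hi⟩).trans interior_subset
    exact ⟨⟨(f ⟨i, hi⟩).contMDiff, (hL i).of_isClosed_subset (isClosed_tsupport _) hsub⟩,
      hsub.trans (hLs i), fun x => f.nonneg _ x⟩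
  · rw [hsum]; exact f.sum_eq_one hx
  · rw [hsum]; exact f.sum_le_one x

end Partition

/-! ### The test on the whole manifold. -/

section GlobalIdentity

variable {n : ℕ} {M : Type*} [MetricSpace M] [ChartedSpace (EuclideanSpace ℝ (Fin n)) M]
  [IsManifold (𝓡 n) ∞ M] [RiemannianBundle (fun x : M => TangentSpace (𝓡 n) x)]
  [IsContMDiffRiemannianBundle (𝓡 n) ∞ (EuclideanSpace ℝ (Fin n))
    (fun x : M => TangentSpace (𝓡 n) x)]
  [IsRiemannianManifold (𝓡 n) M] [SecondCountableTopology M] [MeasurableSpace M] [BorelSpace M]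

/-- Test of `f = L_{p,φ} v` by `θ(w) η`, where `w` has the weak gradient `W` and `η` is Lipschitz
with compact support. -/
theorem abs_integral_test_lipschitz_le {φ : M → ℝ} (hφ : Continuous φ) {p : ℝ} (hp : 1 < p)
    {f : M → ℝ} {r : ℝ≥0∞} (hr : 1 ≤ r) (hf : MemLp f r (weightedVolume n φ))
    {V : (x : M) → TangentSpace (𝓡 n) x} (hVm : HasMeasurableComponents V)
    (hVp : MemLp (fun x => ‖V x‖) (ENNReal.ofReal p) (weightedVolume n φ))
    (h : IsWeakDriftPLaplacian φ p V f)
    {v : M → ℝ} {W : (x : M) → TangentSpace (𝓡 n) x} (hW : IsWeakGradient v W)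
    (hWp : MemLp (fun x => ‖W x‖) (ENNReal.ofReal p) (weightedVolume n φ))
    {θ : ℝ → ℝ} (hθ : ContDiff ℝ ∞ θ) {C : ℝ} (hθC : ∀ s, |θ s| ≤ C) (hθC' : ∀ s, |deriv θ s| ≤ C)
    (hθv : Integrable (fun x => |θ (v x)| * ‖V x‖ ^ (p - 1)) (weightedVolume n φ))
    {η : M → ℝ} {l : ℝ} (hl : 0 ≤ l) (hη : ∀ x y, |η x - η y| ≤ l * dist x y)
    (hηc : Continuous η) (hηs : HasCompactSupport η) (hη1 : ∀ x, |η x| ≤ 1) :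
    |∫ x, (f x * θ (v x) +
      deriv θ (v x) * (‖V x‖ ^ (p - 2) * inner ℝ (V x) (W x))) * η x ∂weightedVolume n φ| ≤
    2 * l * ∫ x, |θ (v x)| * ‖V x‖ ^ (p - 1) ∂weightedVolume n φ := by
  obtain ⟨s, χ, hχ, hχ1, hχle⟩ := exists_partition_test (n := n) hηs.isCompact
  have hi := fun i (hi : i ∈ s) => abs_integral_chart_test_le hφ hp hr hf hVm hVp h hW hWp hθ hθC
    hθC' hl hη hηc hη1 i (hχ i hi).1 (hχ i hi).2.1 (hχ i hi).2.2
  -- Near a point with `η ≠ 0` the partition sums to one, so the gradients of the `χ i` cancel and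
  -- localizing leaves no error.
  have hgrad : ∀ x, η x ≠ 0 → ∑ i ∈ s, (inner ℝ (V x) (gradient n (χ i) x) : ℝ) = 0 := by
    intro x hx
    have h1 : (∑ i ∈ s, χ i) =ᶠ[𝓝 x] fun _ => (1 : ℝ) := by
      filter_upwards [(hηc.isOpen_preimage _ isOpen_ne).mem_nhds hx] with z hz
      rw [Finset.sum_apply]
      exact hχ1 z (subset_tsupport _ hz)
    let D : M → TangentSpace (𝓡 n) x →L[ℝ] ℝ := fun i => mfderiv (𝓡 n) 𝓘(ℝ, ℝ) (χ i) x
    have h2 : HasMFDerivAt (𝓡 n) 𝓘(ℝ, ℝ) (∑ i ∈ s, χ i) x (∑ i ∈ s, D i) :=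
      hasMFDerivAt_finsetSum fun i hi =>
        ((hχ i hi).1.1.mdifferentiableAt (x := x) (by simp)).hasMFDerivAt
    have h3 : mfderiv (𝓡 n) 𝓘(ℝ, ℝ) (∑ i ∈ s, χ i) x = 0 := by
      rw [h1.mfderiv_eq]; exact mfderiv_const
    have h4 := congrArg (fun L => L (V x)) (h2.mfderiv.symm.trans h3)
    simp only [inner_gradient_right]
    refine Eq.trans ?_ h4
    exact (_root_.sum_apply s D (V x)).symm
  have hsum : ∀ x, (f x * θ (v x) +
      deriv θ (v x) * (‖V x‖ ^ (p - 2) * inner ℝ (V x) (W x))) * η x =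
      ∑ i ∈ s, (χ i x * (f x * θ (v x) * η x) +
      ‖V x‖ ^ (p - 2) * inner ℝ (V x) (gradient n (χ i) x) * θ (v x) * η x +
      χ i x * (deriv θ (v x) * (‖V x‖ ^ (p - 2) * inner ℝ (V x) (W x)) * η x)) := by
    intro x
    rcases eq_or_ne (η x) 0 with h0 | h0
    · simp [h0]
    · rw [Finset.sum_add_distrib, Finset.sum_add_distrib, ← Finset.sum_mul, ← Finset.sum_mul,
        ← Finset.sum_mul, ← Finset.sum_mul, ← Finset.mul_sum, hgrad x h0,
        hχ1 x (subset_tsupport _ h0)]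
      ring
  have hint : ∀ i ∈ s, Integrable (fun x => χ i x * (2 * l * |θ (v x)| * ‖V x‖ ^ (p - 1)))
      (weightedVolume n φ) := fun i hi => by
    have h1 := (hθv.const_mul (2 * l)).bdd_mul (c := 1) (f := χ i)
      (hχ i hi).1.1.continuous.aestronglyMeasurable (Eventually.of_forall fun x => by
        rw [Real.norm_of_nonneg ((hχ i hi).2.2 x)]
        exact (Finset.single_le_sum (f := fun i => χ i x) (fun j hj => (hχ j hj).2.2 x) hi).trans
          (hχle x))
    simpa only [mul_assoc] using h1
  rw [integral_congr_ae (Eventually.of_forall hsum), integral_finsetSum _ fun i his => (hi i his).1]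
  calc _ ≤ ∑ i ∈ s, ∫ x, χ i x * (2 * l * |θ (v x)| * ‖V x‖ ^ (p - 1)) ∂weightedVolume n φ :=
        (Finset.abs_sum_le_sum_abs _ _).trans (Finset.sum_le_sum fun i his => (hi i his).2)
    _ = ∫ x, ∑ i ∈ s, χ i x * (2 * l * |θ (v x)| * ‖V x‖ ^ (p - 1)) ∂weightedVolume n φ :=
        (integral_finsetSum _ hint).symm
    _ ≤ ∫ x, 2 * l * (|θ (v x)| * ‖V x‖ ^ (p - 1)) ∂weightedVolume n φ := by
        refine integral_mono (integrable_finsetSum _ hint) (hθv.const_mul _) fun x => ?_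
        simp only
        rw [← Finset.sum_mul]
        have h0 : 0 ≤ 2 * l * |θ (v x)| * ‖V x‖ ^ (p - 1) :=
          mul_nonneg (by positivity) (Real.rpow_nonneg (norm_nonneg _) _)
        refine (mul_le_of_le_one_left h0 (hχle x)).trans (le_of_eq (by ring))
    _ = _ := integral_const_mul _ _

omit [IsRiemannianManifold (𝓡 n) M] in
lemma HasMeasurableComponents.aestronglyMeasurable_inner {φ : M → ℝ} (hφ : Continuous φ)
    {V W : (x : M) → TangentSpace (𝓡 n) x} (hV : HasMeasurableComponents V)
    (hW : HasMeasurableComponents W) :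
    AEStronglyMeasurable (fun x => (inner ℝ (V x) (W x) : ℝ)) (weightedVolume n φ) :=
  aestronglyMeasurable_of_forall_chart hφ fun x₀ => hV.inner_chart hW x₀

lemma abs_rpow_mul_inner_le {p : ℝ} (hp : 1 < p) {x : M} (X Y : TangentSpace (𝓡 n) x) :
    |‖X‖ ^ (p - 2) * inner ℝ X Y| ≤ ‖X‖ ^ (p - 1) * ‖Y‖ := by
  have h0 : 0 ≤ ‖X‖ := norm_nonneg _
  rw [abs_mul, abs_of_nonneg (Real.rpow_nonneg h0 _), ← rpow_sub_two_mul hp h0, mul_assoc]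
  exact mul_le_mul_of_nonneg_left (abs_real_inner_le_norm _ _) (Real.rpow_nonneg h0 _)

lemma integrable_rpow_mul_inner {φ : M → ℝ} (hφ : Continuous φ) {p : ℝ} (hp : 1 < p)
    {V W : (x : M) → TangentSpace (𝓡 n) x}
    (hV : HasMeasurableComponents V) (hW : HasMeasurableComponents W)
    (hVp : MemLp (fun x => ‖V x‖) (ENNReal.ofReal p) (weightedVolume n φ))
    (hWp : MemLp (fun x => ‖W x‖) (ENNReal.ofReal p) (weightedVolume n φ)) :
    Integrable (fun x => ‖V x‖ ^ (p - 2) * inner ℝ (V x) (W x)) (weightedVolume n φ) := by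
  have : ENNReal.HolderConjugate (ENNReal.ofReal (p / (p - 1))) (ENNReal.ofReal p) :=
    (Real.HolderConjugate.conjExponent hp).symm.ennrealOfReal
  have h1 : Integrable (fun x => ‖V x‖ ^ (p - 1) * ‖W x‖) (weightedVolume n φ) :=
    (memLp_norm_rpow hp hVp).integrable_mul hWp
  refine h1.mono' ?_ (Eventually.of_forall fun x => abs_rpow_mul_inner_le hp _ _)
  exact (hVp.1.aemeasurable.pow_const _).aestronglyMeasurable.mul
    (hV.aestronglyMeasurable_inner hφ hW)

/-- Test of `f = L_{p,φ} v` by `θ(w)`, where `w` has the weak gradient `W`. -/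
theorem integral_test_truncated [CompleteSpace M] {φ : M → ℝ} (hφ : Continuous φ) {p : ℝ}
    (hp : 1 < p) {f : M → ℝ} {r : ℝ≥0∞} (hr : 1 ≤ r) (hf : MemLp f r (weightedVolume n φ))
    {V : (x : M) → TangentSpace (𝓡 n) x} (hVm : HasMeasurableComponents V)
    (hVp : MemLp (fun x => ‖V x‖) (ENNReal.ofReal p) (weightedVolume n φ))
    (h : IsWeakDriftPLaplacian φ p V f)
    {v : M → ℝ} {W : (x : M) → TangentSpace (𝓡 n) x} (hW : IsWeakGradient v W)
    (hWp : MemLp (fun x => ‖W x‖) (ENNReal.ofReal p) (weightedVolume n φ))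
    {θ : ℝ → ℝ} (hθ : ContDiff ℝ ∞ θ) {C : ℝ} (hθC : ∀ s, |θ s| ≤ C) (hθC' : ∀ s, |deriv θ s| ≤ C)
    (hv : AEStronglyMeasurable v (weightedVolume n φ))
    (hθp : MemLp (fun x => θ (v x)) (ENNReal.ofReal p) (weightedVolume n φ))
    (hfθ : Integrable (fun x => f x * θ (v x)) (weightedVolume n φ)) :
    ∫ x, f x * θ (v x) ∂weightedVolume n φ =
      -∫ x, deriv θ (v x) * (‖V x‖ ^ (p - 2) * inner ℝ (V x) (W x)) ∂weightedVolume n φ := by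
  -- The cutoffs below need a centre.
  rcases isEmpty_or_nonempty M with hM | ⟨⟨x₀⟩⟩
  · simp [Measure.eq_zero_of_isEmpty]
  have : ENNReal.HolderConjugate (ENNReal.ofReal p) (ENNReal.ofReal (p / (p - 1))) :=
    (Real.HolderConjugate.conjExponent hp).ennrealOfReal
  have hθv : Integrable (fun x => |θ (v x)| * ‖V x‖ ^ (p - 1)) (weightedVolume n φ) :=
    hθp.abs.integrable_mul (memLp_norm_rpow hp hVp)
  have hVW := integrable_rpow_mul_inner hφ hp hVm hW.hasMeasurableComponents hVp hWp
  have hVW' : Integrable (fun x => deriv θ (v x) * (‖V x‖ ^ (p - 2) * inner ℝ (V x) (W x)))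
      (weightedVolume n φ) :=
    hVW.bdd_mul ((hθ.continuous_deriv (by simp)).comp_aestronglyMeasurable hv)
      (Eventually.of_forall fun x => hθC' _)
  set H := fun x => f x * θ (v x) +
      deriv θ (v x) * (‖V x‖ ^ (p - 2) * inner ℝ (V x) (W x)) with hH
  have hHi : Integrable H (weightedVolume n φ) := hfθ.add hVW'
  -- These cutoffs tend to one pointwise, have Lipschitz constant `1 / (N + 1)`, and are compactly
  -- supported by Hopf–Rinow. The error is `2 / (N + 1)` times a fixed integral, finite because `θ
  -- (v)` is in `L^p` and `‖V‖^(p-1)` in the dual space.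
  set η : ℕ → M → ℝ := fun N x => max 0 (1 - dist x x₀ / (N + 1)) with hηd
  have hη0 : ∀ N x, 0 ≤ η N x := fun N x => le_max_left _ _
  have hη1 : ∀ N x, |η N x| ≤ 1 := fun N x => by
    rw [abs_of_nonneg (hη0 N x)]
    refine max_le zero_le_one ?_
    have : 0 ≤ dist x x₀ / (N + 1) := by positivity
    linarith
  have hηc : ∀ N, Continuous (η N) := fun N => by fun_prop
  have hηL : ∀ N x y, |η N x - η N y| ≤ 1 / (N + 1 : ℝ) * dist x y := fun N x y => by
    have h1 := abs_max_sub_max_le_abs (1 - dist x x₀ / (N + 1)) (1 - dist y x₀ / (N + 1)) (0 : ℝ)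
    rw [max_comm, max_comm _ (0 : ℝ)] at h1
    refine h1.trans ?_
    have h2 : 1 - dist x x₀ / (N + 1) - (1 - dist y x₀ / (N + 1)) =
        1 / (N + 1 : ℝ) * (dist y x₀ - dist x x₀) := by ring
    rw [h2, abs_mul, abs_of_nonneg (by positivity : (0 : ℝ) ≤ 1 / (N + 1))]
    refine mul_le_mul_of_nonneg_left ?_ (by positivity)
    rw [dist_comm x y]
    exact abs_dist_sub_le _ _ _
  have hηs : ∀ N, HasCompactSupport (η N) := fun N => by
    refine HasCompactSupport.intro (isCompact_closedBall_of_complete n x₀ (N + 1)) fun x hx => ?_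
    rw [Metric.mem_closedBall, not_le] at hx
    refine max_eq_left ?_
    have : 1 ≤ dist x x₀ / (N + 1) := (one_le_div (by positivity)).2 hx.le
    linarith
  have hle := fun N : ℕ => abs_integral_test_lipschitz_le hφ hp hr hf hVm hVp h hW hWp hθ hθC hθC'
    hθv (l := 1 / (N + 1 : ℝ)) (by positivity) (hηL N) (hηc N) (hηs N) (hη1 N)
  have hlim : Tendsto (fun N => ∫ x, H x * η N x ∂weightedVolume n φ) atTop
      (𝓝 (∫ x, H x ∂weightedVolume n φ)) := by
    refine tendsto_integral_of_dominated_convergence (fun x => |H x|)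
      (fun N => hHi.1.mul (hηc N).aestronglyMeasurable) hHi.abs
      (fun N => Eventually.of_forall fun x => ?_) (Eventually.of_forall fun x => ?_)
    · rw [norm_mul]
      exact mul_le_of_le_one_right (norm_nonneg _) (hη1 N x)
    · have h1 : Tendsto (fun N : ℕ => max 0 (1 - dist x x₀ * (1 / ((N : ℝ) + 1)))) atTop
          (𝓝 (max 0 (1 - dist x x₀ * 0))) :=
        tendsto_const_nhds.max
          (tendsto_const_nhds.sub (tendsto_one_div_add_atTop_nhds_zero_nat.const_mul _))
      rw [mul_zero, sub_zero, max_eq_right zero_le_one] at h1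
      have h2 := h1.const_mul (H x)
      rw [mul_one] at h2
      refine h2.congr fun N => ?_
      rw [hηd]; simp only [mul_one_div]
  have hlim0 : Tendsto (fun N : ℕ => 2 * (1 / ((N : ℝ) + 1)) *
      ∫ x, |θ (v x)| * ‖V x‖ ^ (p - 1) ∂weightedVolume n φ) atTop (𝓝 0) := by
    have := (tendsto_one_div_add_atTop_nhds_zero_nat (𝕜 := ℝ)).const_mul 2 |>.mul_const
      (∫ x, |θ (v x)| * ‖V x‖ ^ (p - 1) ∂weightedVolume n φ)
    simpa using this
  have h0 := le_of_tendsto_of_tendsto' hlim.abs hlim0 hle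
  have h1 : ∫ x, H x ∂weightedVolume n φ = 0 := abs_eq_zero.1 (le_antisymm h0 (abs_nonneg _))
  rw [hH, integral_add hfθ hVW'] at h1
  linarith

end GlobalIdentity

/-! ### Powers and Lebesgue norms. -/

section LebesguePowers

variable {α : Type*} [MeasurableSpace α] {μ : Measure α}

lemma _root_.MeasureTheory.MemLp.integrable_abs_rpow {f : α → ℝ} {s : ℝ} (hs : 0 < s)
    (hf : MemLp f (ENNReal.ofReal s) μ) : Integrable (fun x => |f x| ^ s) μ := by
  have h := hf.integrable_norm_rpow (by simpa using hs) ENNReal.ofReal_ne_top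
  rwa [ENNReal.toReal_ofReal hs.le] at h

lemma integral_abs_rpow_eq {f : α → ℝ} {s : ℝ} (hs : 0 < s) (hf : MemLp f (ENNReal.ofReal s) μ) :
    ∫ x, |f x| ^ s ∂μ = (eLpNorm f (ENNReal.ofReal s) μ).toReal ^ s := by
  have h0 : 0 ≤ ∫ x, |f x| ^ s ∂μ :=
    integral_nonneg fun x => Real.rpow_nonneg (abs_nonneg _) _
  rw [hf.eLpNorm_eq_integral_rpow_norm (by simpa using hs) ENNReal.ofReal_ne_top,
    ENNReal.toReal_ofReal hs.le, ENNReal.toReal_ofReal (by positivity)]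
  simp only [Real.norm_eq_abs]
  rw [Real.rpow_inv_rpow h0 hs.ne']

/-- The bound absorbs the excess power, `|f|^p ≤ C^(p-s) * |f|^s`. This puts truncations into the
space `L^p` required by the cutoff argument. -/
lemma memLp_of_abs_le {f : α → ℝ} {C s p : ℝ} (hs : 0 < s) (hsp : s ≤ p)
    (hf : MemLp f (ENNReal.ofReal s) μ) (hC : ∀ x, |f x| ≤ C) : MemLp f (ENNReal.ofReal p) μ := by
  have hp : 0 < p := hs.trans_le hsp
  rw [← integrable_norm_rpow_iff hf.1 (by simpa using hp) ENNReal.ofReal_ne_top,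
    ENNReal.toReal_ofReal hp.le]
  refine ((hf.integrable_abs_rpow hs).const_mul (C ^ (p - s))).mono'
    (hf.1.norm.aemeasurable.pow_const _).aestronglyMeasurable (Eventually.of_forall fun x => ?_)
  have h0 := abs_nonneg (f x)
  rw [Real.norm_of_nonneg (Real.rpow_nonneg (norm_nonneg _) _), Real.norm_eq_abs]
  calc |f x| ^ p = |f x| ^ (p - s) * |f x| ^ s := by
        rcases h0.eq_or_lt with h | h
        · rw [← h, Real.zero_rpow hp.ne', Real.zero_rpow hs.ne', mul_zero]
        · rw [← Real.rpow_add h, sub_add_cancel]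
    _ ≤ C ^ (p - s) * |f x| ^ s :=
        mul_le_mul_of_nonneg_right (Real.rpow_le_rpow h0 (hC x) (by linarith))
          (Real.rpow_nonneg h0 _)

lemma abs_integral_mul_le {f g : α → ℝ} {s r : ℝ} (hsr : s.HolderConjugate r)
    (hf : MemLp f (ENNReal.ofReal s) μ) (hg : MemLp g (ENNReal.ofReal r) μ) :
    ∫ x, |f x * g x| ∂μ ≤ (∫ x, |f x| ^ s ∂μ) ^ (1 / s) * (∫ x, |g x| ^ r ∂μ) ^ (1 / r) := by
  have h := integral_mul_norm_le_Lp_mul_Lq hsr hf hg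
  simpa only [Real.norm_eq_abs, abs_mul] using h

lemma add_rpow_le {x y s : ℝ} (hx : 0 ≤ x) (hy : 0 ≤ y) (hs : 0 ≤ s) :
    (x + y) ^ s ≤ 2 ^ s * (x ^ s + y ^ s) := by
  have h1 : x + y ≤ 2 * max x y := by linarith [le_max_left x y, le_max_right x y]
  have h2 : (max x y) ^ s ≤ x ^ s + y ^ s := by
    have := Real.rpow_nonneg hx s
    have := Real.rpow_nonneg hy s
    rcases max_choice x y with h | h <;> rw [h] <;> linarith
  calc (x + y) ^ s ≤ (2 * max x y) ^ s := Real.rpow_le_rpow (by positivity) h1 hs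
    _ = 2 ^ s * (max x y) ^ s := Real.mul_rpow (by norm_num) (le_max_of_le_left hx)
    _ ≤ _ := mul_le_mul_of_nonneg_left h2 (by positivity)

end LebesguePowers

/-! ### Smooth bounded truncations. -/

section Truncation

/-- A bounded smooth approximation of the identity. -/
noncomputable def truncation (N : ℕ) (s : ℝ) : ℝ := (N + 1) * Real.arctan (s / (N + 1))

lemma contDiff_truncation (N : ℕ) : ContDiff ℝ ∞ (truncation N) := by
  unfold truncation
  exact contDiff_const.mul (ContDiff.arctan (contDiff_id.div_const _))

lemma deriv_truncation (N : ℕ) (s : ℝ) :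
    deriv (truncation N) s = 1 / (1 + (s / (N + 1)) ^ 2) := by
  have hN : (N : ℝ) + 1 ≠ 0 := by positivity
  have h := (((hasDerivAt_id s).div_const ((N : ℝ) + 1)).arctan).const_mul ((N : ℝ) + 1)
  refine (h.deriv : deriv (truncation N) s = _).trans ?_
  simp only [id]
  field_simp

lemma abs_deriv_truncation_le (N : ℕ) (s : ℝ) : |deriv (truncation N) s| ≤ 1 := by
  rw [deriv_truncation, abs_of_nonneg (by positivity)]
  rw [div_le_one (by positivity)]
  have := sq_nonneg (s / ((N : ℝ) + 1)); linarith

lemma abs_truncation_le (N : ℕ) (s : ℝ) : |truncation N s| ≤ 2 * (N + 1) := by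
  rw [truncation, abs_mul, abs_of_nonneg (by positivity : (0 : ℝ) ≤ N + 1), mul_comm]
  -- The constant `2` bounds `π / 2`.
  refine mul_le_mul_of_nonneg_right (abs_le.2 ⟨?_, ?_⟩) (by positivity)
  · have := Real.neg_pi_div_two_lt_arctan (s / (N + 1)); have := Real.pi_le_four; linarith
  · have := Real.arctan_lt_pi_div_two (s / (N + 1)); have := Real.pi_le_four; linarith

lemma abs_truncation_le_abs (N : ℕ) (s : ℝ) : |truncation N s| ≤ |s| := by
  have h := Convex.norm_image_sub_le_of_norm_deriv_le (𝕜 := ℝ) (f := truncation N) (C := 1)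
    (s := univ) (x := 0) (y := s)
    (fun x _ => ((contDiff_truncation N).differentiable (by simp)).differentiableAt)
    (fun x _ => abs_deriv_truncation_le N x) convex_univ (mem_univ _) (mem_univ _)
  simpa [truncation] using h

lemma tendsto_truncation_arg (s : ℝ) : Tendsto (fun N : ℕ => s / ((N : ℝ) + 1)) atTop (𝓝 0) := by
  have h := (tendsto_one_div_add_atTop_nhds_zero_nat (𝕜 := ℝ)).const_mul s
  simpa only [mul_one_div, mul_zero] using h

lemma tendsto_deriv_truncation (s : ℝ) :
    Tendsto (fun N => deriv (truncation N) s) atTop (𝓝 1) := by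
  simp only [deriv_truncation]
  have h : Continuous fun z : ℝ => 1 / (1 + z ^ 2) :=
    continuous_const.div (by fun_prop) fun z => by positivity
  simpa [Function.comp_def] using (h.tendsto 0).comp (tendsto_truncation_arg s)

/-- This is the derivative of `arctan` at zero along the increments `s / (N + 1)`, which must be
nonzero; hence the separate case `s = 0`. -/
lemma tendsto_truncation (s : ℝ) : Tendsto (fun N => truncation N s) atTop (𝓝 s) := by
  rcases eq_or_ne s 0 with rfl | hs
  · simp [truncation]
  have h := (Real.hasDerivAt_arctan 0).tendsto_slope_zero
  have h1 : Tendsto (fun N : ℕ => s / ((N : ℝ) + 1)) atTop (𝓝[≠] 0) :=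
    tendsto_nhdsWithin_iff.2 ⟨tendsto_truncation_arg s, Eventually.of_forall fun N =>
      div_ne_zero hs (by positivity)⟩
  have h2 := (h.comp h1).const_mul s
  simp only [Function.comp_def, zero_add, Real.arctan_zero, sub_zero, smul_eq_mul] at h2
  norm_num at h2
  refine h2.congr fun N => ?_
  have hN : (N : ℝ) + 1 ≠ 0 := by positivity
  rw [truncation]
  field_simp

end Truncation

/-! ### Removal of the truncation. -/

section Pairing

variable {n : ℕ} {M : Type*} [MetricSpace M] [ChartedSpace (EuclideanSpace ℝ (Fin n)) M]
  [IsManifold (𝓡 n) ∞ M] [RiemannianBundle (fun x : M => TangentSpace (𝓡 n) x)]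
  [IsContMDiffRiemannianBundle (𝓡 n) ∞ (EuclideanSpace ℝ (Fin n))
    (fun x : M => TangentSpace (𝓡 n) x)]
  [IsRiemannianManifold (𝓡 n) M] [CompleteSpace M] [SecondCountableTopology M]
  [MeasurableSpace M] [BorelSpace M]

/-- On a complete manifold, `f = L_{p,φ} v` may be tested by every `w ∈ L^r_φ` with weak gradient in
`L^p_φ`, where `r ≤ p` and `f` is in the dual space of `L^r_φ`. -/
theorem integral_mul_eq_neg_integral_inner {φ : M → ℝ} (hφ : Continuous φ) {p : ℝ}
    (hp : 1 < p) {s r : ℝ} (hsr : s.HolderConjugate r) (hrp : r ≤ p)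
    {f : M → ℝ} (hf : MemLp f (ENNReal.ofReal s) (weightedVolume n φ))
    {V : (x : M) → TangentSpace (𝓡 n) x} (hVm : HasMeasurableComponents V)
    (hVp : MemLp (fun x => ‖V x‖) (ENNReal.ofReal p) (weightedVolume n φ))
    (h : IsWeakDriftPLaplacian φ p V f)
    {v : M → ℝ} {W : (x : M) → TangentSpace (𝓡 n) x} (hW : IsWeakGradient v W)
    (hv : MemLp v (ENNReal.ofReal r) (weightedVolume n φ))
    (hWp : MemLp (fun x => ‖W x‖) (ENNReal.ofReal p) (weightedVolume n φ)) :
    ∫ x, f x * v x ∂weightedVolume n φ =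
      -∫ x, ‖V x‖ ^ (p - 2) * inner ℝ (V x) (W x) ∂weightedVolume n φ := by
  have hs1 : (1 : ℝ≥0∞) ≤ ENNReal.ofReal s := by rw [ENNReal.one_le_ofReal]; exact hsr.lt.le
  have : ENNReal.HolderConjugate (ENNReal.ofReal s) (ENNReal.ofReal r) := hsr.ennrealOfReal
  have hfv : Integrable (fun x => f x * v x) (weightedVolume n φ) := hf.integrable_mul hv
  have hVW := integrable_rpow_mul_inner hφ hp hVm hW.hasMeasurableComponents hVp hWp
  have hθm : ∀ N, AEStronglyMeasurable (fun x => truncation N (v x)) (weightedVolume n φ) :=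
    fun N => (contDiff_truncation N).continuous.comp_aestronglyMeasurable hv.1
  have hbd : ∀ N x, |f x * truncation N (v x)| ≤ |f x * v x| := fun N x => by
    rw [abs_mul, abs_mul]
    exact mul_le_mul_of_nonneg_left (abs_truncation_le_abs N _) (abs_nonneg _)
  -- Each truncation is bounded and in `L^r` with `r ≤ p`, hence in `L^p`. As it is at most `|v|`
  -- with derivative at most one, both sides are dominated uniformly in `N`.
  have key : ∀ N, ∫ x, f x * truncation N (v x) ∂weightedVolume n φ =
      -∫ x, deriv (truncation N) (v x) * (‖V x‖ ^ (p - 2) * inner ℝ (V x) (W x))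
        ∂weightedVolume n φ := fun N => by
    refine integral_test_truncated (C := 2 * (N + 1)) hφ hp hs1 hf hVm hVp h hW hWp
      (contDiff_truncation N) (abs_truncation_le N) (fun s => ?_) hv.1 ?_ ?_
    · refine (abs_deriv_truncation_le N s).trans ?_
      have : (0 : ℝ) ≤ N := N.cast_nonneg
      linarith
    · exact memLp_of_abs_le hsr.symm.pos hrp
        (hv.of_le (hθm N) (Eventually.of_forall fun x => abs_truncation_le_abs N _))
        fun x => abs_truncation_le N _
    · exact hfv.mono (hf.1.mul (hθm N)) (Eventually.of_forall fun x => hbd N x)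
  have h1 : Tendsto (fun N => ∫ x, f x * truncation N (v x) ∂weightedVolume n φ) atTop
      (𝓝 (∫ x, f x * v x ∂weightedVolume n φ)) :=
    tendsto_integral_of_dominated_convergence (fun x => |f x * v x|)
      (fun N => hf.1.mul (hθm N)) hfv.abs (fun N => Eventually.of_forall fun x => hbd N x)
      (Eventually.of_forall fun x => (tendsto_truncation _).const_mul _)
  have h2 : Tendsto (fun N => ∫ x, deriv (truncation N) (v x) *
      (‖V x‖ ^ (p - 2) * inner ℝ (V x) (W x)) ∂weightedVolume n φ) atTop
      (𝓝 (∫ x, ‖V x‖ ^ (p - 2) * inner ℝ (V x) (W x) ∂weightedVolume n φ)) := by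
    refine tendsto_integral_of_dominated_convergence
      (fun x => |‖V x‖ ^ (p - 2) * inner ℝ (V x) (W x)|)
      (fun N => (((contDiff_truncation N).continuous_deriv (by simp)).comp_aestronglyMeasurable
        hv.1).mul hVW.1) hVW.abs (fun N => Eventually.of_forall fun x => ?_)
      (Eventually.of_forall fun x => ?_)
    · rw [norm_mul]
      exact mul_le_of_le_one_left (norm_nonneg _) (abs_deriv_truncation_le N _)
    · have := (tendsto_deriv_truncation (v x)).mul_const
        (‖V x‖ ^ (p - 2) * inner ℝ (V x) (W x))
      rwa [one_mul] at this
  simp only [key] at h1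
  exact tendsto_nhds_unique h1 h2.neg

end Pairing

/-! ### Elementary inequalities for the signed power. -/

section SignedPow

lemma abs_signedPow {q : ℝ} (hq : 0 < q) (x : ℝ) : |signedPow q x| = |x| ^ q := by
  rw [signedPow, abs_mul, abs_of_nonneg (Real.rpow_nonneg (abs_nonneg x) _)]
  rcases (abs_nonneg x).eq_or_lt with h | h
  · rw [← h, Real.zero_rpow hq.ne', mul_zero]
  · rw [← Real.rpow_add_one h.ne']; ring_nf

lemma signedPow_mul (q x y : ℝ) : signedPow q (x * y) = signedPow q x * signedPow q y := by
  simp only [signedPow, abs_mul]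
  rw [Real.mul_rpow (abs_nonneg x) (abs_nonneg y)]; ring

lemma mul_signedPow {q : ℝ} (hq : 0 < q) (x : ℝ) : x * signedPow q x = |x| ^ (q + 1) := by
  rw [signedPow]
  rcases (abs_nonneg x).eq_or_lt with h | h
  · rw [abs_eq_zero.1 h.symm, mul_zero, mul_zero, abs_zero, Real.zero_rpow (by linarith)]
  · calc x * (|x| ^ (q - 1) * x) = |x| ^ (q - 1) * (|x| * |x|) := by rw [abs_mul_abs_self]; ring
      _ = _ := by
        rw [← mul_assoc, ← Real.rpow_add_one h.ne', ← Real.rpow_add_one h.ne']; ring_nf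

lemma measurable_signedPow (q : ℝ) : Measurable (signedPow q) := by
  unfold signedPow; fun_prop

lemma abs_signedPow_rpow {q : ℝ} (hq : 0 < q) (x : ℝ) :
    |signedPow q x| ^ ((q + 1) / q) = |x| ^ (q + 1) := by
  rw [abs_signedPow hq, ← Real.rpow_mul (abs_nonneg x), mul_div_cancel₀ _ hq.ne']

lemma holderConjugate_add_one {q : ℝ} (hq : 0 < q) : (q + 1).HolderConjugate ((q + 1) / q) := by
  have h := Real.HolderConjugate.conjExponent (p := q + 1) (by linarith)
  rwa [Real.conjExponent, add_sub_cancel_right] at h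

/-- The convexity of `|·|^{q+1}`. -/
lemma rpow_add_one_sub_ge {q : ℝ} (hq : 0 < q) (x y : ℝ) :
    (q + 1) * (signedPow q x * (y - x)) ≤ |y| ^ (q + 1) - |x| ^ (q + 1) := by
  have hq1 : 0 < q + 1 := by linarith
  -- Since `x * signedPow q x = |x| ^ (q + 1)`, Young's inequality for `y * signedPow q x` is the
  -- tangent inequality of the convex function.
  have h := Real.young_inequality y (signedPow q x) (holderConjugate_add_one hq)
  rw [abs_signedPow_rpow hq] at h
  have h1 := mul_signedPow hq x
  have h2 := mul_le_mul_of_nonneg_left h hq1.le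
  have h3 : (q + 1) * (|y| ^ (q + 1) / (q + 1) + |x| ^ (q + 1) / ((q + 1) / q)) =
      |y| ^ (q + 1) + q * |x| ^ (q + 1) := by field_simp
  rw [h3] at h2
  have h4 : (q + 1) * (signedPow q x * (y - x)) =
      (q + 1) * (y * signedPow q x) - (q + 1) * (x * signedPow q x) := by ring
  rw [h4, h1]; linarith

/-- Both sides are homogeneous of degree `q + 1`. If `|y - x|` is small relative to `|x|`, scaling
to `x = 1` and continuity there give the first term; otherwise `|x|` and `|y|` are at most constants
times `|y - x|`, which gives the second. -/
lemma exists_signedPow_sub_le {q ε : ℝ} (hq : 0 < q) (hε : 0 < ε) :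
    ∃ C, 0 ≤ C ∧ ∀ x y, |signedPow q y - signedPow q x| ^ ((q + 1) / q) ≤
      ε * |x| ^ (q + 1) + C * |y - x| ^ (q + 1) := by
  have hr : 0 < (q + 1) / q := by positivity
  have hc : ContinuousAt (fun z => |signedPow q z - 1| ^ ((q + 1) / q)) 1 := by
    have h1 : ContinuousAt (signedPow q) 1 := by
      unfold signedPow
      exact (continuous_abs.continuousAt.rpow_const (Or.inl (by simp))).mul continuousAt_id
    exact (h1.sub continuousAt_const).abs.rpow_const (Or.inr hr.le)
  have h0 : |signedPow q 1 - 1| ^ ((q + 1) / q) < ε := by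
    simp [signedPow, Real.zero_rpow hr.ne', hε]
  obtain ⟨δ, hδ, hδε⟩ := Metric.eventually_nhds_iff.1 (hc.eventually (gt_mem_nhds h0))
  refine ⟨((1 + 1 / δ) ^ q + (1 / δ) ^ q) ^ ((q + 1) / q), by positivity, fun x y => ?_⟩
  rcases lt_or_ge (|y - x|) (δ * |x|) with h | h
  · have hx : x ≠ 0 := by
      rintro rfl; rw [abs_zero, mul_zero] at h; exact absurd h (not_lt.2 (abs_nonneg _))
    have hx' : 0 < |x| := abs_pos.2 hx
    have e1 : signedPow q y - signedPow q x = signedPow q x * (signedPow q (y / x) - 1) := by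
      rw [mul_sub, ← signedPow_mul, mul_div_cancel₀ _ hx, mul_one]
    have e2 : dist (y / x) 1 < δ := by
      rw [Real.dist_eq, div_sub_one hx, abs_div, div_lt_iff₀ hx']; exact h
    rw [e1, abs_mul, Real.mul_rpow (abs_nonneg _) (abs_nonneg _), abs_signedPow_rpow hq, mul_comm]
    have := mul_le_mul_of_nonneg_right (hδε e2).le (Real.rpow_nonneg (abs_nonneg x) (q + 1))
    refine this.trans (le_add_of_nonneg_right ?_)
    exact mul_nonneg (by positivity) (Real.rpow_nonneg (abs_nonneg _) _)
  · have hx : |x| ≤ 1 / δ * |y - x| := by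
      rw [one_div, ← div_eq_inv_mul, le_div_iff₀ hδ, mul_comm]; exact h
    have hy : |y| ≤ (1 + 1 / δ) * |y - x| := by
      have : |y| ≤ |y - x| + |x| := by simpa using abs_add_le (y - x) x
      linarith
    have hd := abs_nonneg (y - x)
    have e1 : |signedPow q y - signedPow q x| ≤
        ((1 + 1 / δ) ^ q + (1 / δ) ^ q) * |y - x| ^ q := by
      refine (abs_sub _ _).trans ?_
      rw [abs_signedPow hq, abs_signedPow hq, add_mul, ← Real.mul_rpow (by positivity) hd,
        ← Real.mul_rpow (by positivity) hd]
      exact add_le_add (Real.rpow_le_rpow (abs_nonneg _) hy hq.le)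
        (Real.rpow_le_rpow (abs_nonneg _) hx hq.le)
    have e2 := Real.rpow_le_rpow (abs_nonneg _) e1 hr.le
    rw [Real.mul_rpow (by positivity) (Real.rpow_nonneg hd _), ← Real.rpow_mul hd,
      mul_div_cancel₀ _ hq.ne'] at e2
    refine e2.trans (le_add_of_nonneg_left ?_)
    exact mul_nonneg hε.le (Real.rpow_nonneg (abs_nonneg _) _)

end SignedPow

/-! ### Time derivatives of the pairings and of the energy. -/

section Evolution

variable {α : Type*} [MeasurableSpace α] {μ : Measure α}

lemma memLp_signedPow {q : ℝ} (hq : 0 < q) {f : α → ℝ} (hf : MemLp f (ENNReal.ofReal (q + 1)) μ) :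
    MemLp (fun x => signedPow q (f x)) (ENNReal.ofReal ((q + 1) / q)) μ := by
  have hr : 0 < (q + 1) / q := by positivity
  have hm : AEStronglyMeasurable (fun x => signedPow q (f x)) μ :=
    ((measurable_signedPow q).comp_aemeasurable hf.1.aemeasurable).aestronglyMeasurable
  rw [← integrable_norm_rpow_iff hm (by simpa using hr) ENNReal.ofReal_ne_top,
    ENNReal.toReal_ofReal hr.le]
  simp only [Real.norm_eq_abs, abs_signedPow_rpow hq]
  exact hf.integrable_abs_rpow (by linarith)

/-- The continuity of `f ↦ f^q` from `L^{q+1}` to `L^{(q+1)/q}`. -/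
lemma tendsto_integral_signedPow_sub {ι : Type*} {l : Filter ι} {q : ℝ} (hq : 0 < q)
    {f : α → ℝ} {F : ι → α → ℝ} (hf : MemLp f (ENNReal.ofReal (q + 1)) μ)
    (hF : ∀ᶠ i in l, MemLp (F i) (ENNReal.ofReal (q + 1)) μ)
    (h : Tendsto (fun i => ∫ x, |F i x - f x| ^ (q + 1) ∂μ) l (𝓝 0)) :
    Tendsto (fun i => ∫ x, |signedPow q (F i x) - signedPow q (f x)| ^ ((q + 1) / q) ∂μ) l
      (𝓝 0) := by
  have hq1 : 0 < q + 1 := by linarith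
  have hr : 0 < (q + 1) / q := by positivity
  have hi := hf.integrable_abs_rpow hq1
  set A := ∫ x, |f x| ^ (q + 1) ∂μ with hA
  have hA0 : 0 ≤ A := integral_nonneg fun x => Real.rpow_nonneg (abs_nonneg _) _
  refine tendsto_order.2 ⟨fun b hb => Eventually.of_forall fun i => hb.trans_le
    (integral_nonneg fun x => Real.rpow_nonneg (abs_nonneg _) _), fun b hb => ?_⟩
  -- With this `ε` the fixed term contributes at most `b / 2`; `A + 1` replaces `A` to avoid
  -- dividing by zero.
  obtain ⟨C, hC, hle⟩ := exists_signedPow_sub_le hq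
    (show 0 < b / (2 * (A + 1)) by positivity)
  have h1 : ∀ᶠ i in l, C * ∫ x, |F i x - f x| ^ (q + 1) ∂μ < b / 2 := by
    have := h.const_mul C
    rw [mul_zero] at this
    exact this.eventually (gt_mem_nhds (by linarith))
  filter_upwards [h1, hF] with i hi1 hFi
  have h2 : Integrable (fun x => |F i x - f x| ^ (q + 1)) μ :=
    (hFi.sub hf).integrable_abs_rpow hq1
  have h3 : ∫ x, |signedPow q (F i x) - signedPow q (f x)| ^ ((q + 1) / q) ∂μ ≤
      ∫ x, (b / (2 * (A + 1)) * |f x| ^ (q + 1) + C * |F i x - f x| ^ (q + 1)) ∂μ :=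
    integral_mono (((memLp_signedPow hq hFi).sub (memLp_signedPow hq hf)).integrable_abs_rpow hr)
      ((hi.const_mul _).add (h2.const_mul _)) fun x => hle _ _
  have h4 : b / (2 * (A + 1)) * A ≤ b / 2 := by
    rw [div_mul_eq_mul_div, div_le_div_iff₀ (by positivity) (by norm_num)]
    nlinarith
  have h5 : ∫ x, (b / (2 * (A + 1)) * |f x| ^ (q + 1) + C * |F i x - f x| ^ (q + 1)) ∂μ =
      b / (2 * (A + 1)) * A + C * ∫ x, |F i x - f x| ^ (q + 1) ∂μ := by
    rw [integral_add (hi.const_mul _) (h2.const_mul _), integral_const_mul, integral_const_mul]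
  linarith

variable {s r a t : ℝ} {u : ℝ → α → ℝ} {w : α → ℝ}

lemma eventually_memLp_add (ht : a < t) (hu : ∀ τ, a < τ → MemLp (u τ) (ENNReal.ofReal s) μ) :
    ∀ᶠ h : ℝ in 𝓝[≠] 0, MemLp (u (t + h)) (ENNReal.ofReal s) μ := by
  have h1 : Tendsto (fun h : ℝ => t + h) (𝓝[≠] 0) (𝓝 t) := by
    have : Continuous fun h : ℝ => t + h := by fun_prop
    have := this.tendsto 0
    rw [add_zero] at this
    exact this.mono_left nhdsWithin_le_nhds
  filter_upwards [h1.eventually (lt_mem_nhds ht)] with h hh using hu _ hh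

lemma tendsto_integral_quotient_sub (hs : 0 < s) (ht : a < t)
    (hu : ∀ τ, a < τ → MemLp (u τ) (ENNReal.ofReal s) μ) (hw : MemLp w (ENNReal.ofReal s) μ)
    (hlim : Tendsto (fun h : ℝ => eLpNorm (fun x => (u (t + h) x - u t x) / h - w x)
      (ENNReal.ofReal s) μ) (𝓝[≠] 0) (𝓝 0)) :
    Tendsto (fun h : ℝ => ∫ x, |(u (t + h) x - u t x) / h - w x| ^ s ∂μ) (𝓝[≠] 0) (𝓝 0) := by
  have h1 := (ENNReal.tendsto_toReal ENNReal.zero_ne_top).comp hlim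
  have h2 := h1.rpow_const (Or.inr hs.le) (p := s)
  rw [ENNReal.toReal_zero, Real.zero_rpow hs.ne'] at h2
  refine h2.congr' ?_
  filter_upwards [eventually_memLp_add ht hu] with h hh
  have h3 : MemLp (fun x => (u (t + h) x - u t x) / h - w x) (ENNReal.ofReal s) μ := by
    have := ((hh.sub (hu t ht)).const_mul h⁻¹).sub hw
    refine this.ae_eq (Eventually.of_forall fun x => ?_)
    simp [div_eq_inv_mul]
  rw [integral_abs_rpow_eq hs h3]; rfl

/-- The derivative of a pairing with a fixed function. -/
lemma hasDerivAt_integral_mul (hsr : s.HolderConjugate r) (ht : a < t)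
    (hu : ∀ τ, a < τ → MemLp (u τ) (ENNReal.ofReal s) μ) (hw : MemLp w (ENNReal.ofReal s) μ)
    (hlim : Tendsto (fun h : ℝ => eLpNorm (fun x => (u (t + h) x - u t x) / h - w x)
      (ENNReal.ofReal s) μ) (𝓝[≠] 0) (𝓝 0))
    {g : α → ℝ} (hg : MemLp g (ENNReal.ofReal r) μ) :
    HasDerivAt (fun τ => ∫ x, u τ x * g x ∂μ) (∫ x, w x * g x ∂μ) t := by
  have hs := hsr.pos
  have : ENNReal.HolderConjugate (ENNReal.ofReal s) (ENNReal.ofReal r) := hsr.ennrealOfReal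
  rw [hasDerivAt_iff_tendsto_slope_zero, tendsto_iff_norm_sub_tendsto_zero]
  have h1 := tendsto_integral_quotient_sub hs ht hu hw hlim
  have h2 := (h1.rpow_const (Or.inr (one_div_pos.2 hs).le) (p := 1 / s)).mul_const
    ((∫ x, |g x| ^ r ∂μ) ^ (1 / r))
  rw [Real.zero_rpow (one_div_pos.2 hs).ne', zero_mul] at h2
  refine squeeze_zero' (Eventually.of_forall fun _ => norm_nonneg _) ?_ h2
  filter_upwards [eventually_memLp_add ht hu] with h hh
  have i1 : Integrable (fun x => u (t + h) x * g x) μ := hh.integrable_mul hg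
  have i2 : Integrable (fun x => u t x * g x) μ := (hu t ht).integrable_mul hg
  have i3 : Integrable (fun x => w x * g x) μ := hw.integrable_mul hg
  have i4 : Integrable (fun x => h⁻¹ * (u (t + h) x * g x - u t x * g x)) μ :=
    (i1.sub i2).const_mul _
  have h3 : MemLp (fun x => (u (t + h) x - u t x) / h - w x) (ENNReal.ofReal s) μ := by
    have := ((hh.sub (hu t ht)).const_mul h⁻¹).sub hw
    refine this.ae_eq (Eventually.of_forall fun x => ?_)
    simp [div_eq_inv_mul]
  rw [smul_eq_mul, ← integral_sub i1 i2, ← integral_const_mul, ← integral_sub i4 i3, Real.norm_eq_abs]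
  refine (abs_integral_le_integral_abs).trans (le_trans (le_of_eq ?_)
    (abs_integral_mul_le hsr h3 hg))
  refine integral_congr_ae (Eventually.of_forall fun x => ?_)
  simp only
  congr 1
  ring

/-- The derivative of `∫ |u|^{q+1}`. -/
lemma hasDerivAt_integral_rpow {q : ℝ} (hq : 0 < q) (ht : a < t)
    (hu : ∀ τ, a < τ → MemLp (u τ) (ENNReal.ofReal (q + 1)) μ)
    (hw : MemLp w (ENNReal.ofReal (q + 1)) μ)
    (hlim : Tendsto (fun h : ℝ => eLpNorm (fun x => (u (t + h) x - u t x) / h - w x)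
      (ENNReal.ofReal (q + 1)) μ) (𝓝[≠] 0) (𝓝 0)) :
    HasDerivAt (fun τ => ∫ x, |u τ x| ^ (q + 1) ∂μ)
      ((q + 1) * ∫ x, w x * signedPow q (u t x) ∂μ) t := by
  have hq1 : 0 < q + 1 := by linarith
  have hsr := holderConjugate_add_one hq
  have hr := hsr.symm.pos
  set r := (q + 1) / q with hrd
  have : ENNReal.HolderConjugate (ENNReal.ofReal (q + 1)) (ENNReal.ofReal r) := hsr.ennrealOfReal
  have hv := fun τ hτ => memLp_signedPow hq (hu τ hτ)
  -- The energy is compared with its pairing against the fixed function `u(t)^q`. For `b = u(t+h)`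
  -- and `c = u(t)`, convexity used in both directions gives `0 ≤ |b|^(q+1) - |c|^(q+1) - (q+1) c^q
  -- (b-c) ≤ (q+1) (b-c) (b^q - c^q)`. After division by `h`, Hölder bounds the discrepancy by the
  -- norm of the difference quotient, which stays bounded, times that of `b^q - c^q`, which tends to
  -- zero.
  have hB := hasDerivAt_integral_mul hsr ht hu hw hlim (hv t ht)
  have hQ := tendsto_integral_quotient_sub hq1 ht hu hw hlim
  set W := ∫ x, |w x| ^ (q + 1) ∂μ with hWd
  have hWi := hw.integrable_abs_rpow hq1
  -- the quotients are bounded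
  have hmem : ∀ᶠ h : ℝ in 𝓝[≠] 0,
      MemLp (fun x => (u (t + h) x - u t x) / h) (ENNReal.ofReal (q + 1)) μ := by
    filter_upwards [eventually_memLp_add ht hu] with h hh
    refine ((hh.sub (hu t ht)).const_mul h⁻¹).ae_eq (Eventually.of_forall fun x => ?_)
    simp [div_eq_inv_mul]
  have hQb : ∀ᶠ h : ℝ in 𝓝[≠] 0,
      ∫ x, |(u (t + h) x - u t x) / h| ^ (q + 1) ∂μ ≤ 2 ^ (q + 1) * (1 + W) := by
    filter_upwards [hQ.eventually (gt_mem_nhds one_pos), hmem] with h h1 hm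
    have i1 : Integrable (fun x => |(u (t + h) x - u t x) / h - w x| ^ (q + 1)) μ :=
      (hm.sub hw).integrable_abs_rpow hq1
    have h2 : ∫ x, |(u (t + h) x - u t x) / h| ^ (q + 1) ∂μ ≤
        ∫ x, 2 ^ (q + 1) * (|(u (t + h) x - u t x) / h - w x| ^ (q + 1) + |w x| ^ (q + 1)) ∂μ := by
      refine integral_mono (hm.integrable_abs_rpow hq1) ((i1.add hWi).const_mul _) fun x => ?_
      refine le_trans (Real.rpow_le_rpow (abs_nonneg _) ?_ hq1.le)
        (add_rpow_le (abs_nonneg _) (abs_nonneg _) hq1.le)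
      simpa using abs_add_le ((u (t + h) x - u t x) / h - w x) (w x)
    rw [integral_const_mul, integral_add i1 hWi] at h2
    refine h2.trans (mul_le_mul_of_nonneg_left ?_ (by positivity))
    linarith
  -- continuity in time
  have hc : Tendsto (fun h : ℝ => ∫ x, |u (t + h) x - u t x| ^ (q + 1) ∂μ) (𝓝[≠] 0) (𝓝 0) := by
    have h1 : Tendsto (fun h : ℝ => |h| ^ (q + 1) * (2 ^ (q + 1) * (1 + W))) (𝓝[≠] 0) (𝓝 0) := by
      have h2 : Tendsto (fun h : ℝ => |h|) (𝓝[≠] 0) (𝓝 |0|) :=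
        continuous_abs.continuousAt.mono_left nhdsWithin_le_nhds
      have h3 := (h2.rpow_const (Or.inr hq1.le) (p := q + 1)).mul_const (2 ^ (q + 1) * (1 + W))
      rwa [abs_zero, Real.zero_rpow hq1.ne', zero_mul] at h3
    refine squeeze_zero' (Eventually.of_forall fun h =>
      integral_nonneg fun x => Real.rpow_nonneg (abs_nonneg _) _) ?_ h1
    filter_upwards [hQb, self_mem_nhdsWithin] with h h2 hne
    refine le_trans (le_of_eq ?_) (mul_le_mul_of_nonneg_left h2 (Real.rpow_nonneg (abs_nonneg h) _))
    rw [← integral_const_mul]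
    refine integral_congr_ae (Eventually.of_forall fun x => ?_)
    simp only
    rw [← Real.mul_rpow (abs_nonneg _) (abs_nonneg _), ← abs_mul, mul_div_cancel₀ _ hne]
  have hvc := tendsto_integral_signedPow_sub hq (hu t ht) (eventually_memLp_add ht hu) hc
  rw [hasDerivAt_iff_tendsto_slope_zero] at hB ⊢
  have h1 := hB.const_mul (q + 1)
  suffices hdiff : Tendsto (fun h : ℝ => h⁻¹ • (∫ x, |u (t + h) x| ^ (q + 1) ∂μ -
      ∫ x, |u t x| ^ (q + 1) ∂μ) - (q + 1) * (h⁻¹ • (∫ x, u (t + h) x * signedPow q (u t x) ∂μ -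
        ∫ x, u t x * signedPow q (u t x) ∂μ))) (𝓝[≠] 0) (𝓝 0) by
    have h2 := hdiff.add h1
    rw [zero_add] at h2
    refine h2.congr fun h => ?_
    ring
  have h2 := ((hvc.rpow_const (Or.inr (one_div_pos.2 hr).le) (p := 1 / r)).const_mul
    ((2 ^ (q + 1) * (1 + W)) ^ (1 / (q + 1)))).const_mul (q + 1)
  rw [Real.zero_rpow (one_div_pos.2 hr).ne', mul_zero, mul_zero] at h2
  refine squeeze_zero_norm' ?_ h2
  filter_upwards [hQb, hmem, eventually_memLp_add ht hu, self_mem_nhdsWithin] with h hb hm hh hne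
  have hvh := memLp_signedPow hq hh
  have i1 : Integrable (fun x => u (t + h) x * signedPow q (u t x)) μ := hh.integrable_mul (hv t ht)
  have i2 : Integrable (fun x => u t x * signedPow q (u t x)) μ :=
    (hu t ht).integrable_mul (hv t ht)
  have i3 := hh.integrable_abs_rpow hq1
  have i4 := (hu t ht).integrable_abs_rpow hq1
  have i5 : Integrable (fun x => (u (t + h) x - u t x) / h *
      (signedPow q (u (t + h) x) - signedPow q (u t x))) μ :=
    hm.integrable_mul (hvh.sub (hv t ht))
  have i6 : Integrable (fun x => h⁻¹ * (|u (t + h) x| ^ (q + 1) - |u t x| ^ (q + 1))) μ :=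
    (i3.sub i4).const_mul _
  have i7 : Integrable (fun x => (q + 1) * (h⁻¹ * (u (t + h) x * signedPow q (u t x) -
      u t x * signedPow q (u t x)))) μ := ((i1.sub i2).const_mul _).const_mul _
  rw [smul_eq_mul, smul_eq_mul, ← integral_sub i1 i2, ← integral_sub i3 i4, ← integral_const_mul,
    ← integral_const_mul, ← integral_const_mul, ← integral_sub i6 i7, Real.norm_eq_abs]
  have h3 : |∫ x, (h⁻¹ * (|u (t + h) x| ^ (q + 1) - |u t x| ^ (q + 1)) -
      (q + 1) * (h⁻¹ * (u (t + h) x * signedPow q (u t x) - u t x * signedPow q (u t x)))) ∂μ| ≤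
      ∫ x, (q + 1) * |(u (t + h) x - u t x) / h *
        (signedPow q (u (t + h) x) - signedPow q (u t x))| ∂μ := by
    refine abs_integral_le_integral_abs.trans (integral_mono (i6.sub i7).abs
      (i5.abs.const_mul _) fun x => ?_)
    simp only
    set b := u (t + h) x
    set c := u t x
    have e1 : h⁻¹ * (|b| ^ (q + 1) - |c| ^ (q + 1)) -
        (q + 1) * (h⁻¹ * (b * signedPow q c - c * signedPow q c)) =
        h⁻¹ * (|b| ^ (q + 1) - |c| ^ (q + 1) - (q + 1) * (signedPow q c * (b - c))) := by ring
    have e2 : (b - c) / h * (signedPow q b - signedPow q c) =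
        h⁻¹ * ((b - c) * (signedPow q b - signedPow q c)) := by ring
    rw [e1, e2, abs_mul, abs_mul, mul_left_comm (q + 1) |h⁻¹|]
    refine mul_le_mul_of_nonneg_left ?_ (abs_nonneg h⁻¹)
    have f1 := rpow_add_one_sub_ge hq c b
    have f2 := rpow_add_one_sub_ge hq b c
    rw [abs_of_nonneg (by linarith)]
    have f3 : |b| ^ (q + 1) - |c| ^ (q + 1) - (q + 1) * (signedPow q c * (b - c)) ≤
        (q + 1) * ((b - c) * (signedPow q b - signedPow q c)) := by linarith
    exact f3.trans (mul_le_mul_of_nonneg_left (le_abs_self _) hq1.le)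
  rw [integral_const_mul] at h3
  refine h3.trans (mul_le_mul_of_nonneg_left ?_ hq1.le)
  refine (abs_integral_mul_le hsr hm (hvh.sub (hv t ht))).trans ?_
  refine mul_le_mul_of_nonneg_right (Real.rpow_le_rpow ?_ hb (by positivity)) ?_
  · exact integral_nonneg fun x => Real.rpow_nonneg (abs_nonneg _) _
  · exact Real.rpow_nonneg (integral_nonneg fun x => Real.rpow_nonneg (abs_nonneg _) _) _

end Evolution

/-! ### The energy of a solution. -/

section Conclusion

variable {n : ℕ} {M : Type*} [MetricSpace M] [ChartedSpace (EuclideanSpace ℝ (Fin n)) M]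
  [IsManifold (𝓡 n) ∞ M] [RiemannianBundle (fun x : M => TangentSpace (𝓡 n) x)]
  [IsContMDiffRiemannianBundle (𝓡 n) ∞ (EuclideanSpace ℝ (Fin n))
    (fun x : M => TangentSpace (𝓡 n) x)]
  [IsRiemannianManifold (𝓡 n) M] [CompleteSpace M] [SecondCountableTopology M]
  [MeasurableSpace M] [BorelSpace M]

/-- The energy of a solution which is positive at some time decays at most polynomially. -/
theorem IsSolution.exists_energy_lower_bound {φ : M → ℝ} (hφ : Continuous φ)
    {p q a : ℝ} (hp : 1 < p) (hq : 0 < q) (hδ : 0 < q * (p - 1) - 1)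
    {u : ℝ → M → ℝ} (hu : IsSolution n φ p q a u) {t₁ : ℝ} (ht₁ : a < t₁)
    (hpos : 0 < energy n φ q u t₁) :
    ∃ c c' : ℝ, 0 < c ∧ 0 ≤ c' ∧ ∀ t : ℝ, a < t →
      (c + c' * (t - a)) ^ (-((q + 1) / (q * (p - 1) - 1))) ≤ energy n φ q u t := by
  obtain ⟨ut, V, h⟩ := hu
  have hp0 : 0 < p := by linarith
  have hsr := holderConjugate_add_one hq
  -- Positivity of `δ` enters the testing argument here: the exponent of the space containing `u^q`
  -- does not exceed `p`.
  have hrp : (q + 1) / q ≤ p := by rw [div_le_iff₀ hq]; nlinarith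
  have hum : ∀ t, a < t → MemLp (u t) (ENNReal.ofReal (q + 1)) (weightedVolume n φ) :=
    fun t ht => by obtain ⟨⟨G, hG, -⟩, -⟩ := h t ht; exact hG.2.1
  have hutm : ∀ t, a < t → MemLp (ut t) (ENNReal.ofReal (q + 1)) (weightedVolume n φ) :=
    fun t ht => by obtain ⟨-, ⟨G, hG, -⟩, -⟩ := h t ht; exact hG.2.1
  have hlim := fun t ht => (h t ht).2.2.1
  have hW := fun t ht => (h t ht).2.2.2.1
  have hVp := fun t ht => (h t ht).2.2.2.2.1
  have heq := fun t ht => (h t ht).2.2.2.2.2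
  have hVm := fun t ht => (hW t ht).hasMeasurableComponents
  have hvm := fun t ht => memLp_signedPow hq (hum t ht)
  -- The case `s = t` identifies the dissipation; different times give the bound on `D`.
  have hid : ∀ s t, a < s → a < t →
      ∫ x, ut t x * signedPow q (u s x) ∂weightedVolume n φ =
        -∫ x, ‖V t x‖ ^ (p - 2) * inner ℝ (V t x) (V s x) ∂weightedVolume n φ := fun s t hs ht =>
    integral_mul_eq_neg_integral_inner hφ hp hsr hrp (hutm t ht) (hVm t ht) (hVp t ht) (heq t ht)
      (hW s hs) (hvm s hs) (hVp s hs)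
  refine lower_bound_of_pairings hp hq hδ
    (J := fun t => ∫ x, ‖V t x‖ ^ p ∂weightedVolume n φ)
    (B := fun s t => ∫ x, u t x * signedPow q (u s x) ∂weightedVolume n φ)
    (D := fun s t => ∫ x, ut t x * signedPow q (u s x) ∂weightedVolume n φ)
    (fun t ht => ?_) (fun t _ => ?_) (fun t _ => ?_) (fun s t hs ht => ?_) (fun s _ => ?_)
    (fun s t hs ht => ?_) (fun s t hs ht => ?_) ht₁ hpos
  · refine (hasDerivAt_integral_rpow hq ht hum (hutm t ht) (hlim t ht)).congr_deriv ?_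
    rw [hid t t ht ht, mul_neg]
    congr 2
    refine integral_congr_ae (Eventually.of_forall fun x => ?_)
    have h0 : 0 ≤ ‖V t x‖ := norm_nonneg _
    simp only
    rw [real_inner_self_eq_norm_mul_norm, ← mul_assoc, rpow_sub_two_mul hp h0]
    rcases h0.eq_or_lt with h1 | h1
    · rw [← h1, mul_zero, Real.zero_rpow hp0.ne']
    · rw [← Real.rpow_add_one h1.ne', sub_add_cancel]
  · exact integral_nonneg fun x => Real.rpow_nonneg (abs_nonneg _) _
  · exact integral_nonneg fun x => Real.rpow_nonneg (norm_nonneg _) _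
  · exact hasDerivAt_integral_mul hsr ht hum (hutm t ht) (hlim t ht) (hvm s hs)
  · exact integral_congr_ae (Eventually.of_forall fun x => mul_signedPow hq _)
  · have h1 := abs_integral_mul_le hsr (hum t ht) (hvm s hs)
    simp only [abs_signedPow_rpow hq, one_div_div] at h1
    rw [mul_comm] at h1
    exact (le_abs_self _).trans (abs_integral_le_integral_abs.trans h1)
  · rw [hid s t hs ht, neg_neg]
    have hpp := (Real.HolderConjugate.conjExponent hp).symm
    have h1 := abs_integral_mul_le hpp (memLp_norm_rpow hp (hVp t ht)) (hVp s hs)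
    have h2 : ∀ x, |‖V t x‖ ^ (p - 1)| ^ (p / (p - 1)) = ‖V t x‖ ^ p := fun x => by
      have h0 : 0 ≤ ‖V t x‖ := norm_nonneg _
      rw [abs_of_nonneg (Real.rpow_nonneg h0 _), ← Real.rpow_mul h0,
        mul_div_cancel₀ _ (by linarith : p - 1 ≠ 0)]
    have h3 : ∀ x, |‖V s x‖| = ‖V s x‖ := fun x => abs_of_nonneg (norm_nonneg _)
    simp only [Real.conjExponent, h2, h3, one_div_div] at h1
    refine (integral_mono (integrable_rpow_mul_inner hφ hp (hVm t ht) (hVm s hs) (hVp t ht)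
      (hVp s hs)) ?_ fun x => ?_).trans h1
    · have : ENNReal.HolderConjugate (ENNReal.ofReal (p / (p - 1))) (ENNReal.ofReal p) :=
        hpp.ennrealOfReal
      exact ((memLp_norm_rpow hp (hVp t ht)).integrable_mul (hVp s hs)).abs
    · simp only
      exact (le_abs_self _).trans ((abs_rpow_mul_inner_le hp _ _).trans (le_abs_self _))

omit [IsManifold (𝓡 n) ∞ M] [IsContMDiffRiemannianBundle (𝓡 n) ∞ (EuclideanSpace ℝ (Fin n))
  (fun x : M => TangentSpace (𝓡 n) x)] [IsRiemannianManifold (𝓡 n) M] [CompleteSpace M]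
  [SecondCountableTopology M] [BorelSpace M] in
lemma IsSolution.exists_energy_pos {φ : M → ℝ} {p q a : ℝ} (hq : 0 < q) {u : ℝ → M → ℝ}
    (hu : IsSolution n φ p q a u) (hnt : ¬ IsTrivial n φ a u) :
    ∃ t, a < t ∧ 0 < energy n φ q u t := by
  obtain ⟨ut, V, h⟩ := hu
  by_contra! hle
  refine hnt fun t ht => ?_
  obtain ⟨⟨G, hG, -⟩, -⟩ := h t ht
  have hi := hG.2.1.integrable_abs_rpow (by linarith)
  have h0 : ∫ x, |u t x| ^ (q + 1) ∂weightedVolume n φ = 0 :=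
    le_antisymm (hle t ht) (integral_nonneg fun x => Real.rpow_nonneg (abs_nonneg _) _)
  rw [integral_eq_zero_iff_of_nonneg (fun x => Real.rpow_nonneg (abs_nonneg _) _) hi] at h0
  filter_upwards [h0] with x hx
  have := (Real.rpow_eq_zero (abs_nonneg _) (by linarith : q + 1 ≠ 0)).1 hx
  exact abs_eq_zero.1 this

end Conclusion

end DoublyNonlinear

/-! ### Both statements of the theorem. -/

theorem corollary3 {n : ℕ} {M : Type*} [MetricSpace M]
    [ChartedSpace (EuclideanSpace ℝ (Fin n)) M] [IsManifold (𝓡 n) ∞ M]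
    [RiemannianBundle (fun x : M => TangentSpace (𝓡 n) x)]
    [IsContMDiffRiemannianBundle (𝓡 n) ∞ (EuclideanSpace ℝ (Fin n))
      (fun x : M => TangentSpace (𝓡 n) x)]
    [IsRiemannianManifold (𝓡 n) M] [CompleteSpace M] [SecondCountableTopology M]
    [MeasurableSpace M] [BorelSpace M]
    (φ : M → ℝ) (hφ : ContMDiff (𝓡 n) 𝓘(ℝ, ℝ) ∞ φ)
    (p q a : ℝ) (hp : 1 < p) (hq : 0 < q) (hδ : 0 < q * (p - 1) - 1)
    (u : ℝ → M → ℝ) (hu : DoublyNonlinear.IsSolution n φ p q a u) :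
    (¬ DoublyNonlinear.IsTrivial n φ a u →
      (∃ c c' : ℝ, 0 < c ∧ 0 ≤ c' ∧ ∀ t : ℝ, a < t →
        (c + c' * (t - a)) ^ (-((q + 1) / (q * (p - 1) - 1))) ≤
          DoublyNonlinear.energy n φ q u t) ∧
      ∀ k : ℝ, DoublyNonlinear.VanishesToOrder n φ q a u k →
        k ≤ (q + 1) / (q * (p - 1) - 1)) ∧
    (DoublyNonlinear.VanishesToInfiniteOrder n φ q a u → DoublyNonlinear.IsTrivial n φ a u) := by
  have part1 : ¬ DoublyNonlinear.IsTrivial n φ a u →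
      (∃ c c' : ℝ, 0 < c ∧ 0 ≤ c' ∧ ∀ t : ℝ, a < t →
        (c + c' * (t - a)) ^ (-((q + 1) / (q * (p - 1) - 1))) ≤
          DoublyNonlinear.energy n φ q u t) ∧
      ∀ k : ℝ, DoublyNonlinear.VanishesToOrder n φ q a u k →
        k ≤ (q + 1) / (q * (p - 1) - 1) := by
    intro hnt
    obtain ⟨t₁, ht₁, hpos⟩ := hu.exists_energy_pos hq hnt
    obtain ⟨c, c', hc, hc', hlow⟩ :=
      hu.exists_energy_lower_bound hφ.continuous hp hq hδ ht₁ hpos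
    refine ⟨⟨c, c', hc, hc', hlow⟩, fun k ⟨C, _, hup⟩ => ?_⟩
    exact DoublyNonlinear.order_le_of_bounds hc hc' (by positivity) hlow hup
  refine ⟨part1, fun hinf => ?_⟩
  by_contra hnt
  -- A single integer order above the critical one already contradicts the bound on the vanishing
  -- order.
  obtain ⟨k, hk⟩ := exists_nat_gt ((q + 1) / (q * (p - 1) - 1))
  have hk0 : 0 < k := by
    have : (0 : ℝ) < k := lt_trans (by positivity) hk
    exact_mod_cast this
  exact absurd ((part1 hnt).2 k (hinf k hk0)) (not_le.2 hk)
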